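/- An instance of Constrained Correlation Clustering consists of a graph $G=(V,E)$ on $n$ nodes and two sets $F,H\subseteq\binom V2$ of friendly and hostile pairs. A clustering is a partition $C$ of $V$; $E_C$ denotes the set of pairs of distinct nodes in a common cluster, and the cost of $C$ is $|E\,\triangle\,E_C|$. The clustering is valid if no friendly pair is separated and no hostile pair is in a common cluster. An algorithm is a $\rho$-approximation if on every instance it returns a valid clustering whose cost is at most $\rho$ times the cost of every valid clustering, or answers ``Impossible'' in case no valid clustering exists. Running times are those of a deterministic word RAM with words of $\Theta(\log n)$ bits whose input is given by adjacency matrices; $\widetilde O(n^3)=n^3(\log n)^{O(1)}$. Supernodes are the connected components of $(V,F)$; two (not necessarily distinct) supernodes are hostile if some hostile pair has one node in each. If no supernode is hostile to itself, a graph $G'$ on $V$ is called a transformed graph if it arises from $G$ as follows: (1) add all edges inside supernodes; (2) delete all edges between hostile supernodes; (3) as long as there are distinct supernodes $U_1,U_2,U_3$ with $U_1,U_2$ hostile and edges $u_1u_3$, $u_2u_3'$ with $u_1\in U_1$, $u_2\in U_2$, $u_3,u_3'\in U_3$, delete both edges of some such pair of edges; (4) for any two distinct supernodes $U,W$, insert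 all edges between $U$ and $W$ if the number of edges left between them is larger than $\frac{3-\sqrt5}{2}|U||W|$, and otherwise delete all of them. A PIVOT clustering of a graph is one obtained by repeatedly choosing some unclustered node and making it, together with its unclustered neighbours, a cluster. **Theorem.** (a) There is a deterministic algorithm for Constrained Correlation Clustering that runs in time $\widetilde O(n^3)$ and is a $16$-approximation. (b) Moreover, for every constant $\varepsilon>0$ and $\alpha=3+\varepsilon$ there is a deterministic algorithm running in time $\widetilde O(n^3)$ that answers ``Impossible'' if some supernode is hostile to itself, that otherwise returns a PIVOT clustering $C$ of some transformed graph $G'=(V,E')$ with $|E'\,\triangle\,E_C|\le\alpha\,|E'\,\triangle\,E_D|$ for every clustering $D$ of $V$, and that is an $\big((\alpha+1)(1+\sqrt5)+\alpha\big)$-approximation for Constrained Correlation Clustering. -/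

import Mathlib

/-! ### Constrained Correlation Clustering

A clustering of `V` is a partition of `V`, given by its equivalence relation
"being in the same cluster" (`Setoid V`). Sets of unordered pairs of distinct nodes
are given as simple graphs. -/

namespace CCC

/-- The edge set `E_C` of a clustering `C`: all pairs of distinct nodes in a common cluster. -/
def clusterGraph {V : Type*} (C : Setoid V) : SimpleGraph V where
  Adj u v := u ≠ v ∧ C u v
  symm := ⟨fun _ _ h => ⟨h.1.symm, C.symm h.2⟩⟩
  loopless := ⟨fun _ h => h.1 rfl⟩

/-- The cost `|E ∆ E_C|` of the clustering `C` for the preferences `E`. -/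
noncomputable def cost {V : Type*} (E : SimpleGraph V) (C : Setoid V) : ℕ :=
  (symmDiff E.edgeSet (clusterGraph C).edgeSet).ncard

/-- An instance on the node set `V`: preferences `E`, friendly pairs `F`, hostile pairs `H`. -/
structure Inst (V : Type*) where
  E : SimpleGraph V
  F : SimpleGraph V
  H : SimpleGraph V

/-- A clustering is valid if it separates no friendly pair and joins no hostile pair. -/
def Inst.IsValid {V : Type*} (I : Inst V) (C : Setoid V) : Prop :=
  (∀ u v, I.F.Adj u v → C u v) ∧ ∀ u v, I.H.Adj u v → ¬ C u v

/-- Correct answers of a `ρ`-approximation: "Impossible" (`none`) if there is no valid clustering,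
else a valid clustering whose cost is at most `ρ` times the cost of any valid clustering. -/
def Inst.IsApproxAnswer {V : Type*} (I : Inst V) (ρ : ℝ) : Option (Setoid V) → Prop
  | none => ¬ ∃ D, I.IsValid D
  | some C => I.IsValid C ∧ ∀ D, I.IsValid D → (cost I.E C : ℝ) ≤ ρ * cost I.E D

/-! ### The PIVOT meta-algorithm -/

open Classical in
/-- `PivotRun G R L`: repeatedly picking some remaining node `u` as a pivot and removing `u` and
its remaining neighbours as a cluster can turn the set `R` of remaining nodes into the list `L`
of clusters. -/
inductive PivotRun {V : Type*} (G : SimpleGraph V) : Finset V → List (Finset V) → Prop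
  | nil : PivotRun G ∅ []
  | cons (R : Finset V) (u : V) (L : List (Finset V)) (hu : u ∈ R)
      (h : PivotRun G (R \ R.filter (fun v => v = u ∨ G.Adj u v)) L) :
      PivotRun G R (R.filter (fun v => v = u ∨ G.Adj u v) :: L)

/-- `C` is a clustering that PIVOT returns on `G` for some choice of the pivots. -/
def IsPivotClustering {V : Type*} [Fintype V] (G : SimpleGraph V) (C : Setoid V) : Prop :=
  ∃ L, PivotRun G Finset.univ L ∧ ∀ u v, C u v ↔ ∃ K ∈ L, u ∈ K ∧ v ∈ K

/-! ### The transformation of the graph -/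

section Transform

variable {V : Type*} (I : Inst V)

/-- Supernodes are the connected components of `(V, F)`. -/
abbrev Inst.SN : Type _ := I.F.ConnectedComponent

/-- The supernode of a node. -/
abbrev Inst.s (u : V) : I.SN := I.F.connectedComponentMk u

/-- Two (possibly equal) supernodes are hostile if some hostile pair connects them. -/
def Inst.Hostile (U W : I.SN) : Prop := ∃ u w, I.s u = U ∧ I.s w = W ∧ I.H.Adj u w

/-- Add all edges inside supernodes. -/
def Inst.E₁ : SimpleGraph V := I.E ⊔ SimpleGraph.fromRel fun u v => I.s u = I.s v

/-- Delete all edges between hostile supernodes. -/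
def Inst.E₂ : SimpleGraph V := I.E₁ \ SimpleGraph.fromRel fun u v => I.Hostile (I.s u) (I.s v)

/-- One iteration of the dropping loop: `U₁, U₂, U₃` are distinct supernodes, `U₁, U₂` are
hostile, and an edge between `U₁, U₃` and an edge between `U₂, U₃` are dropped together. -/
def Inst.DropStep (A B : SimpleGraph V) : Prop :=
  ∃ u₁ u₂ u₃ u₃' : V, I.s u₃' = I.s u₃ ∧ I.s u₁ ≠ I.s u₂ ∧ I.s u₁ ≠ I.s u₃ ∧ I.s u₂ ≠ I.s u₃ ∧
    I.Hostile (I.s u₁) (I.s u₂) ∧ A.Adj u₁ u₃ ∧ A.Adj u₂ u₃' ∧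
    B = A.deleteEdges {s(u₁, u₃), s(u₂, u₃')}

/-- `A` is a possible edge set at the end of the dropping loop. -/
def Inst.IsDropResult (A : SimpleGraph V) : Prop :=
  Relation.ReflTransGen I.DropStep I.E₂ A ∧ ∀ B, ¬ I.DropStep A B

/-- The number `|A(U, W)|` of edges of `A` between the supernodes `U` and `W`. -/
noncomputable def Inst.between (A : SimpleGraph V) (U W : I.SN) : ℕ :=
  {e | e ∈ A.edgeSet ∧ ∃ u w, I.s u = U ∧ I.s w = W ∧ e = s(u, w)}.ncard

/-- Rounding: inside supernodes `A` is kept; between two distinct supernodes `U, W` all edges are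
present if `|A(U, W)| > (3 - √5) / 2 * |U| * |W|`, and no edge otherwise. -/
noncomputable def Inst.round (A : SimpleGraph V) : SimpleGraph V :=
  SimpleGraph.fromRel fun u v =>
    (I.s u = I.s v ∧ A.Adj u v) ∨
    (I.s u ≠ I.s v ∧
      (3 - √5) / 2 * (I.s u).supp.ncard * (I.s v).supp.ncard < (I.between A (I.s u) (I.s v) : ℝ))

/-- Possible answers of the procedure that answers "Impossible" if some supernode is hostile to
itself, and otherwise transforms the graph into `G'` and returns a PIVOT clustering of `G'` that
is an `α`-approximation for (unconstrained) Correlation Clustering on `G'`. -/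
def Inst.IsTransformPivotAnswer [Fintype V] (α : ℝ) : Option (Setoid V) → Prop
  | none => ∃ U, I.Hostile U U
  | some C => (¬ ∃ U, I.Hostile U U) ∧
      ∃ A, I.IsDropResult A ∧ IsPivotClustering (I.round A) C ∧
        ∀ D, (cost (I.round A) C : ℝ) ≤ α * cost (I.round A) D

end Transform

end CCC

/-! ### A deterministic word RAM

Words have `w` bits and are represented by the numbers below `2 ^ w`; every computed value is
reduced modulo `2 ^ w`. A program is a fixed structured command over registers and a memory that
is addressed by words. Every elementary instruction and every test costs one step. -/

namespace WordRAM

/-- Contents of the registers and of the memory cells. -/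
structure State where
  reg : ℕ → ℕ
  mem : ℕ → ℕ

/-- Arithmetic operations. Subtraction is truncated at `0`. -/
inductive Op
  | add | sub | mul | div | mod

def Op.eval : Op → ℕ → ℕ → ℕ
  | .add, x, y => x + y
  | .sub, x, y => x - y
  | .mul, x, y => x * y
  | .div, x, y => x / y
  | .mod, x, y => x % y

/-- Comparisons of two registers. -/
inductive Test
  | lt (a b : ℕ)
  | eq (a b : ℕ)

def Test.Holds (σ : State) : Test → Prop
  | .lt a b => σ.reg a < σ.reg b
  | .eq a b => σ.reg a = σ.reg b

inductive Cmd
  | skip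
  /-- put the constant `c` into register `r` -/
  | const (r c : ℕ)
  /-- put the result of `o` on registers `a`, `b` into register `r` -/
  | op (o : Op) (r a b : ℕ)
  /-- put the memory cell addressed by register `a` into register `r` -/
  | load (r a : ℕ)
  /-- put register `r` into the memory cell addressed by register `a` -/
  | store (a r : ℕ)
  | seq (c d : Cmd)
  | ite (b : Test) (c d : Cmd)
  | while (b : Test) (c : Cmd)

def State.setReg (σ : State) (r x : ℕ) : State := { σ with reg := Function.update σ.reg r x }

def State.setMem (σ : State) (a x : ℕ) : State := { σ with mem := Function.update σ.mem a x }

/-- `Exec w c σ τ t`: with `w`-bit words, the command `c` started in the state `σ` halts in the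
state `τ` after exactly `t` steps. -/
inductive Exec (w : ℕ) : Cmd → State → State → ℕ → Prop
  | skip (σ : State) : Exec w .skip σ σ 1
  | const (σ : State) (r c : ℕ) : Exec w (.const r c) σ (σ.setReg r (c % 2 ^ w)) 1
  | op (σ : State) (o : Op) (r a b : ℕ) :
      Exec w (.op o r a b) σ (σ.setReg r (o.eval (σ.reg a) (σ.reg b) % 2 ^ w)) 1
  | load (σ : State) (r a : ℕ) : Exec w (.load r a) σ (σ.setReg r (σ.mem (σ.reg a))) 1
  | store (σ : State) (a r : ℕ) : Exec w (.store a r) σ (σ.setMem (σ.reg a) (σ.reg r)) 1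
  | seq {c d : Cmd} {σ τ υ : State} {t t' : ℕ} (hc : Exec w c σ τ t) (hd : Exec w d τ υ t') :
      Exec w (.seq c d) σ υ (t + t')
  | ite_true {b : Test} {c d : Cmd} {σ τ : State} {t : ℕ} (hb : b.Holds σ)
      (hc : Exec w c σ τ t) : Exec w (.ite b c d) σ τ (t + 1)
  | ite_false {b : Test} {c d : Cmd} {σ τ : State} {t : ℕ} (hb : ¬ b.Holds σ)
      (hd : Exec w d σ τ t) : Exec w (.ite b c d) σ τ (t + 1)
  | while_true {b : Test} {c : Cmd} {σ τ υ : State} {t t' : ℕ} (hb : b.Holds σ)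
      (hc : Exec w c σ τ t) (hd : Exec w (.while b c) τ υ t') :
      Exec w (.while b c) σ υ (t + t' + 1)
  | while_false {b : Test} {c : Cmd} {σ : State} (hb : ¬ b.Holds σ) :
      Exec w (.while b c) σ σ 1

/-- The machine is deterministic. -/
theorem Exec.deterministic {w : ℕ} {c : Cmd} {σ τ τ' : State} {t t' : ℕ}
    (h : Exec w c σ τ t) (h' : Exec w c σ τ' t') : τ = τ' ∧ t = t' := by
  induction h generalizing τ' t' with
  | skip | const | op | load | store => cases h'; exact ⟨rfl, rfl⟩
  | seq _ _ ih₁ ih₂ =>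
    cases h' with
    | seq k₁ k₂ =>
      obtain ⟨rfl, rfl⟩ := ih₁ k₁
      obtain ⟨rfl, rfl⟩ := ih₂ k₂
      exact ⟨rfl, rfl⟩
  | ite_true hb _ ih =>
    cases h' with
    | ite_true _ k => obtain ⟨rfl, rfl⟩ := ih k; exact ⟨rfl, rfl⟩
    | ite_false hb' _ => exact absurd hb hb'
  | ite_false hb _ ih =>
    cases h' with
    | ite_true hb' _ => exact absurd hb' hb
    | ite_false _ k => obtain ⟨rfl, rfl⟩ := ih k; exact ⟨rfl, rfl⟩
  | while_true hb _ _ ih₁ ih₂ =>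
    cases h' with
    | while_true _ k₁ k₂ =>
      obtain ⟨rfl, rfl⟩ := ih₁ k₁
      obtain ⟨rfl, rfl⟩ := ih₂ k₂
      exact ⟨rfl, rfl⟩
    | while_false hb' => exact absurd hb hb'
  | while_false hb =>
    cases h' with
    | while_true hb' _ _ => exact absurd hb' hb
    | while_false _ => exact ⟨rfl, rfl⟩

end WordRAM

namespace CCC

open Classical in
/-- The input on the nodes `0, …, n - 1`: register `0` holds `n`, all other registers are `0`;
the memory starts with the `n × n` adjacency matrices of `E`, `F`, `H`, row by row, and is `0`
elsewhere. -/
noncomputable def Inst.encode {n : ℕ} (I : Inst (Fin n)) : WordRAM.State where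
  reg r := if r = 0 then n else 0
  mem a :=
    if ∃ u v : Fin n, (I.E.Adj u v ∧ a = u * n + v) ∨ (I.F.Adj u v ∧ a = n * n + (u * n + v)) ∨
      (I.H.Adj u v ∧ a = 2 * (n * n) + (u * n + v)) then 1 else 0

/-- The answer read off from a final state: register `0` is `0` for "Impossible"; otherwise memory
cell `v` holds the name of the cluster of node `v`. -/
def answer (n : ℕ) (σ : WordRAM.State) : Option (Setoid (Fin n)) :=
  if σ.reg 0 = 0 then none else some (Setoid.ker fun v : Fin n => σ.mem v)

/-- `P` is an algorithm with running time `Õ(n ^ 3)` on a word RAM with words of `Ω(log n)` bits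
(for every word length `w ≥ κ * log₂ (n + 2)`), and all its answers satisfy `Spec`. -/
def SolvesInSoftCubicTime (P : WordRAM.Cmd)
    (Spec : ∀ n : ℕ, Inst (Fin n) → Option (Setoid (Fin n)) → Prop) : Prop :=
  ∃ κ c k : ℕ, ∀ (n : ℕ) (I : Inst (Fin n)) (w : ℕ), (n + 2) ^ κ ≤ 2 ^ w →
    ∃ (σ : WordRAM.State) (t : ℕ), WordRAM.Exec w P I.encode σ t ∧
      t ≤ c * (n + 1) ^ 3 * Nat.log 2 (n + 2) ^ k ∧ Spec n I (answer n σ)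

end CCC

/-! ### A small language with arrays and bounded loops, compiled to the word RAM -/

/-! The program builds a transformed graph G' with edge set E', computes near-optimal weights for
the problem of covering the bad triples of G' (three nodes with exactly two edges), and lets the
weights choose the pivots.

Validity. In G' the nodes of a supernode are twins, so a pivot takes a supernode entirely or not at
all. Hostile supernodes are not adjacent and, once the dropping loop has ended, have no common
neighbour, so no closed neighbourhood meets both (`Inst.IsDropResult.isValid`).

Distance. Fix a valid clustering D and give a pair the sign 1 if D separates it and -1 otherwise.
Two edges dropped together cannot both lie inside clusters of D, for D would then join hostile
supernodes; so the signs of the dropped edges have a nonnegative sum. Twice this sum is added to |E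
∆ E'|, and the result is compared with 3 |E ∆ E_D| block by block (`Inst.IsDropResult.block_le`).
The rounding threshold only has to lie between 1/4 and 1/2. Hence |E ∆ E'| ≤ 3 cost(D), and two
triangle inequalities give the factor 3(α + 1) + α. It equals 16 for α = 13/4, and it is at most the
claimed factor because 3 ≤ 1 + √5.

PIVOT. A pivot u causes disagreements only at pairs vw for which uvw is bad. If every bad triple has
weight at least T, averaging yields a pivot whose number of bad triples times T is at most three
times the weight of the opposite pairs (`exists_charged_pivot`). Such a pair loses an endpoint when
the cluster of u is removed, so no weight is spent twice, and cost · T is at most three times the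
total weight (`ChargedRun.cost_le`). The disagreements of any clustering D hit every bad triple
(`Bad.hit`), so cost(D) bounds the optimal ratio of total weight to T from above.

Weights. In each phase T grows by about the factor 1 + 1/q, and each bad triple that is now too
light has its three weights multiplied by about this factor, once. Every such step raises the
logarithmic potential of D, the sum of log W over the disagreements of D. As weights stay below 2T,
the potential grows slowly, and this limits the growth of the total weight. If the best ratio over
all phases missed `factor q` times the optimum, the total would stay too small for the final T
(`PhaseInv.near_optimal`). Logarithmically many phases suffice, and `factor q` tends to 1.

Machine. Programs are written in a language of arrays and bounded loops, verified by weakest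
preconditions and compiled (`Pr.sound`). All numbers are polynomial in n, so words of logarithmic
length suffice. The time is read off from the nesting of the loops (`Pr.time_le`): three loops over
nodes and one over phases. -/

namespace RamLang

open WordRAM

/-- Abstract states: variables and two-dimensional arrays. -/
structure St where
  v : ℕ → ℕ
  a : ℕ → ℕ → ℕ → ℕ

def upd (f : ℕ → ℕ → ℕ) (i j k : ℕ) : ℕ → ℕ → ℕ :=
  fun i' j' => if i' = i ∧ j' = j then k else f i' j'

def St.setV (s : St) (x k : ℕ) : St := { s with v := fun y => if y = x then k else s.v y }

def St.setA (s : St) (t i j k : ℕ) : St :=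
  { s with a := fun t' => if t' = t then upd (s.a t) i j k else s.a t' }

@[simp] theorem setV_v (s : St) (x k y : ℕ) :
    (s.setV x k).v y = if y = x then k else s.v y := rfl
@[simp] theorem setV_a (s : St) (x k : ℕ) : (s.setV x k).a = s.a := rfl
@[simp] theorem setA_v (s : St) (t i j k : ℕ) : (s.setA t i j k).v = s.v := rfl
@[simp] theorem setA_a (s : St) (t i j k t' : ℕ) :
    (s.setA t i j k).a t' = if t' = t then upd (s.a t) i j k else s.a t' := rfl

inductive Ex
  | lit (c : ℕ)
  | var (x : ℕ)
  | bin (o : Op) (a b : Ex)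
  | get (t : ℕ) (i j : Ex)

def Ex.eval (s : St) : Ex → ℕ
  | .lit c => c
  | .var x => s.v x
  | .bin o a b => o.eval (a.eval s) (b.eval s)
  | .get t i j => s.a t (i.eval s) (j.eval s)

/-- No overflow (values stay below `M`) and no array access out of bounds. -/
def Ex.ok (n M : ℕ) (s : St) : Ex → Prop
  | .lit c => c < M
  | .var _ => True
  | .bin .add a b => a.ok n M s ∧ b.ok n M s ∧ a.eval s + b.eval s < M
  | .bin .mul a b => a.ok n M s ∧ b.ok n M s ∧ a.eval s * b.eval s < M
  | .bin _ a b => a.ok n M s ∧ b.ok n M s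
  | .get _ i j => i.ok n M s ∧ j.ok n M s ∧ i.eval s < n ∧ j.eval s < n

inductive Bx
  | lt (a b : Ex)
  | eq (a b : Ex)

def Bx.Holds (s : St) : Bx → Prop
  | .lt a b => a.eval s < b.eval s
  | .eq a b => a.eval s = b.eval s

def Bx.ok (n M : ℕ) (s : St) : Bx → Prop
  | .lt a b => a.ok n M s ∧ b.ok n M s
  | .eq a b => a.ok n M s ∧ b.ok n M s

/-- Programs. `loop x y p` runs `p` for `x = 0, …, y - 1`. -/
inductive Pr
  | skip
  | assign (x : ℕ) (e : Ex)
  | set (t : ℕ) (i j e : Ex)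
  | seq (p q : Pr)
  | ite (b : Bx) (p q : Pr)
  | loop (x y : ℕ) (p : Pr)

/-- Variable `0` always holds `n`. The only other loop bound in use is the number of phases, for
which `m` will be logarithmic; keeping the two apart yields separate exponents in the running time.
-/
def lim (n m y : ℕ) : ℕ := if y = 0 then n else m

/-- Recursion on the number of iterations left. On exit the counter holds the bound, exactly as
after the compiled while loop. -/
def loopWp (F : (St → Prop) → St → Prop) (x : ℕ) : ℕ → ℕ → (St → Prop) → St → Prop
  | 0, i, Q, s => Q (s.setV x i)
  | k + 1, i, Q, s => F (loopWp F x k (i + 1) Q) (s.setV x i)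

/-- Weakest preconditions; `m` bounds the number of iterations of loops whose bound is not the
variable `0`. -/
def wp (n M m : ℕ) : Pr → (St → Prop) → St → Prop
  | .skip, Q, s => Q s
  | .assign x e, Q, s => e.ok n M s ∧ Q (s.setV x (e.eval s))
  | .set t i j e, Q, s => i.ok n M s ∧ j.ok n M s ∧ e.ok n M s ∧ i.eval s < n ∧ j.eval s < n ∧
      Q (s.setA t (i.eval s) (j.eval s) (e.eval s))
  | .seq p q, Q, s => wp n M m p (wp n M m q Q) s
  | .ite b p q, Q, s => b.ok n M s ∧ (b.Holds s → wp n M m p Q s) ∧ (¬ b.Holds s → wp n M m q Q s)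
  | .loop x y p, Q, s => s.v y ≤ lim n m y ∧ loopWp (wp n M m p) x (s.v y) 0 Q s

/-- Modified variables. -/
def Pr.mv : Pr → List ℕ
  | .skip => []
  | .assign x _ => [x]
  | .set _ _ _ _ => []
  | .seq p q => p.mv ++ q.mv
  | .ite _ p q => p.mv ++ q.mv
  | .loop x _ p => x :: p.mv

/-- Modified arrays. -/
def Pr.ma : Pr → List ℕ
  | .skip => []
  | .assign _ _ => []
  | .set t _ _ _ => [t]
  | .seq p q => p.ma ++ q.ma
  | .ite _ p q => p.ma ++ q.ma
  | .loop _ _ p => p.ma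

/-- `s'` agrees with `s` on everything that `p` cannot modify. -/
def Frame (p : Pr) (s s' : St) : Prop :=
  (∀ x, p.mv.contains x = false → s'.v x = s.v x) ∧ ∀ t, p.ma.contains t = false → s'.a t = s.a t

/-! ### Monotonicity and framing of weakest preconditions -/

theorem loopWp_mono {F : (St → Prop) → St → Prop}
    (hF : ∀ Q Q' : St → Prop, (∀ s, Q s → Q' s) → ∀ s, F Q s → F Q' s) (x k : ℕ) :
    ∀ i (Q Q' : St → Prop), (∀ s, Q s → Q' s) → ∀ s, loopWp F x k i Q s → loopWp F x k i Q' s := by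
  induction k with
  | zero => intro i Q Q' h s hs; exact h _ hs
  | succ k ih => intro i Q Q' h s hs; exact hF _ _ (ih _ _ _ h) _ hs

theorem wp_mono {n M m : ℕ} (p : Pr) : ∀ (Q Q' : St → Prop), (∀ s, Q s → Q' s) →
    ∀ s, wp n M m p Q s → wp n M m p Q' s := by
  induction p with
  | skip => intro Q Q' h s hs; exact h _ hs
  | assign x e => intro Q Q' h s hs; exact ⟨hs.1, h _ hs.2⟩
  | set t i j e =>
    intro Q Q' h s hs
    obtain ⟨h1, h2, h3, h4, h5, h6⟩ := hs
    exact ⟨h1, h2, h3, h4, h5, h _ h6⟩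
  | seq p q ihp ihq => intro Q Q' h s hs; exact ihp _ _ (ihq _ _ h) _ hs
  | ite b p q ihp ihq =>
    intro Q Q' h s hs
    exact ⟨hs.1, fun hb => ihp _ _ h _ (hs.2.1 hb), fun hb => ihq _ _ h _ (hs.2.2 hb)⟩
  | loop x y p ih => intro Q Q' h s hs; exact ⟨hs.1, loopWp_mono ih _ _ _ _ _ h _ hs.2⟩

theorem Frame.refl (p : Pr) (s : St) : Frame p s s := ⟨fun _ _ => rfl, fun _ _ => rfl⟩

theorem Frame.trans {p : Pr} {s s' s'' : St} (h : Frame p s s') (h' : Frame p s' s'') :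
    Frame p s s'' :=
  ⟨fun x hx => (h'.1 x hx).trans (h.1 x hx), fun x hx => (h'.2 x hx).trans (h.2 x hx)⟩

theorem contains_append_false {l l' : List ℕ} {x : ℕ} :
    (l ++ l').contains x = false ↔ l.contains x = false ∧ l'.contains x = false := by
  simp

theorem Frame.setV_loop (x y : ℕ) (p : Pr) (s : St) (k : ℕ) :
    Frame (.loop x y p) s (s.setV x k) := by
  refine ⟨fun z hz => ?_, fun _ _ => rfl⟩
  simp only [Pr.mv, List.contains_cons, Bool.or_eq_false_iff, beq_eq_false_iff_ne] at hz
  simp [hz.1]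

theorem Frame.body_loop {x y : ℕ} {p : Pr} {s s' : St} (h : Frame p s s') :
    Frame (.loop x y p) s s' := by
  refine ⟨fun z hz => h.1 z ?_, h.2⟩
  simp only [Pr.mv, List.contains_cons, Bool.or_eq_false_iff] at hz
  exact hz.2

theorem loopWp_frame {n M m : ℕ} {x y : ℕ} {p : Pr}
    (ih : ∀ Q s, wp n M m p Q s → wp n M m p (fun s' => Q s' ∧ Frame p s s') s) (k : ℕ) :
    ∀ i Q s, loopWp (wp n M m p) x k i Q s →
      loopWp (wp n M m p) x k i (fun s' => Q s' ∧ Frame (.loop x y p) s s') s := by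
  induction k with
  | zero => intro i Q s h; exact ⟨h, Frame.setV_loop _ _ _ _ _⟩
  | succ k ihk =>
    intro i Q s h
    refine wp_mono p _ _ ?_ _ (ih _ _ h)
    rintro s' ⟨h1, h2⟩
    refine loopWp_mono (wp_mono p) _ _ _ _ _ ?_ _ (ihk _ _ _ h1)
    rintro s'' ⟨h3, h4⟩
    exact ⟨h3, (Frame.setV_loop x y p s i).trans (h2.body_loop.trans h4)⟩

/-- What a program cannot change is visible from its syntax, so invariants only mention what does
change. `Frame` uses the Boolean `contains`, so that for concrete programs its side conditions are
closed by `rfl`. -/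
theorem wp_frame {n M m : ℕ} (p : Pr) : ∀ (Q : St → Prop) (s : St),
    wp n M m p Q s → wp n M m p (fun s' => Q s' ∧ Frame p s s') s := by
  induction p with
  | skip => intro Q s h; exact ⟨h, Frame.refl _ _⟩
  | assign x e =>
    intro Q s h
    refine ⟨h.1, h.2, fun z hz => ?_, fun _ _ => rfl⟩
    have : z ≠ x := by simpa [Pr.mv] using hz
    simp [this]
  | set t i j e =>
    intro Q s h
    obtain ⟨h1, h2, h3, h4, h5, h6⟩ := h
    refine ⟨h1, h2, h3, h4, h5, h6, fun _ _ => rfl, fun z hz => ?_⟩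
    have : z ≠ t := by simpa [Pr.ma] using hz
    simp [this]
  | seq p q ihp ihq =>
    intro Q s h
    refine wp_mono p _ _ ?_ _ (ihp _ _ h)
    rintro s' ⟨h1, h2⟩
    refine wp_mono q _ _ ?_ _ (ihq _ _ h1)
    rintro s'' ⟨h3, h4⟩
    refine ⟨h3, fun x hx => ?_, fun x hx => ?_⟩
    · obtain ⟨hx1, hx2⟩ := contains_append_false.1 hx
      rw [h4.1 x hx2, h2.1 x hx1]
    · obtain ⟨hx1, hx2⟩ := contains_append_false.1 hx
      rw [h4.2 x hx2, h2.2 x hx1]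
  | ite b p q ihp ihq =>
    intro Q s h
    refine ⟨h.1, fun hb => ?_, fun hb => ?_⟩
    · refine wp_mono p _ _ ?_ _ (ihp _ _ (h.2.1 hb))
      rintro s' ⟨h1, h2⟩
      exact ⟨h1, fun x hx => h2.1 x (contains_append_false.1 hx).1,
        fun x hx => h2.2 x (contains_append_false.1 hx).1⟩
    · refine wp_mono q _ _ ?_ _ (ihq _ _ (h.2.2 hb))
      rintro s' ⟨h1, h2⟩
      exact ⟨h1, fun x hx => h2.1 x (contains_append_false.1 hx).2,
        fun x hx => h2.2 x (contains_append_false.1 hx).2⟩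
  | loop x y p ih => intro Q s h; exact ⟨h.1, loopWp_frame ih _ _ _ _ h.2⟩

/-- Consequence rule with frame. -/
theorem wp_conseq {n M m : ℕ} {p : Pr} {Q Q' : St → Prop} {s : St} (h : wp n M m p Q s)
    (hQ : ∀ s', Frame p s s' → Q s' → Q' s') : wp n M m p Q' s :=
  wp_mono p _ _ (fun _ hs => hQ _ hs.2 hs.1) _ (wp_frame p _ _ h)

/-- Rule for loops with an invariant `Inv i` before iteration `i`. -/
theorem wp_loop {n M m : ℕ} {x y : ℕ} {p : Pr} {Q : St → Prop} {s : St} (Inv : ℕ → St → Prop)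
    (hlim : s.v y ≤ lim n m y) (h0 : Inv 0 s)
    (hstep : ∀ i < s.v y, ∀ s', Frame (.loop x y p) s s' → Inv i s' →
      wp n M m p (Inv (i + 1)) (s'.setV x i))
    (hQ : ∀ s', Frame (.loop x y p) s s' → Inv (s.v y) s' → Q (s'.setV x (s.v y))) :
    wp n M m (.loop x y p) Q s := by
  refine ⟨hlim, ?_⟩
  -- The induction on the remaining iterations carries the frame relative to the state before the
  -- loop; facts about that state are thus available in every iteration.
  have key : ∀ k i s', i + k = s.v y → Frame (.loop x y p) s s' → Inv i s' →
      loopWp (wp n M m p) x k i Q s' := by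
    intro k
    induction k with
    | zero =>
      intro i s' hi hf hI
      have : i = s.v y := by omega
      subst this
      exact hQ s' hf hI
    | succ k ih =>
      intro i s' hi hf hI
      refine wp_mono p _ _ ?_ _ (wp_frame p _ _ (hstep i (by omega) s' hf hI))
      rintro s'' ⟨h1, h2⟩
      exact ih _ _ (by omega) (hf.trans ((Frame.setV_loop x y p s' i).trans h2.body_loop)) h1
  exact key _ _ _ (by simp) (Frame.refl _ _) h0

/-! #### Compilation -/

/-- `e.comp d` puts the value of `e` into register `d` and uses only registers from `d` on. -/
def Ex.comp : Ex → ℕ → Cmd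
  | .lit c, d => .const d c
  | .var x, d => .seq (.const d 0) (.op .add d x d)
  | .bin o a b, d => .seq (a.comp d) (.seq (b.comp (d + 1)) (.op o d d (d + 1)))
  | .get t i j, d => .seq (i.comp d) (.seq (j.comp (d + 1)) (.seq (.const (d + 2) t)
      (.seq (.op .mul (d + 2) (d + 2) 0) (.seq (.op .add (d + 2) (d + 2) d)
      (.seq (.op .mul (d + 2) (d + 2) 0) (.seq (.op .add (d + 2) (d + 2) (d + 1))
      (.load d (d + 2))))))))

def Ex.cost : Ex → ℕ
  | .lit _ => 1
  | .var _ => 2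
  | .bin _ a b => a.cost + b.cost + 1
  | .get _ i j => i.cost + j.cost + 6

/-- Variables are below `64`, arrays below `32`. -/
def Ex.wf : Ex → Bool
  | .lit _ => true
  | .var x => x.blt 64
  | .bin _ a b => a.wf && b.wf
  | .get t i j => t.blt 32 && i.wf && j.wf

def Bx.wf : Bx → Bool
  | .lt a b => a.wf && b.wf
  | .eq a b => a.wf && b.wf

def Bx.comp : Bx → Cmd
  | .lt a b => .seq (a.comp 64) (b.comp 65)
  | .eq a b => .seq (a.comp 64) (b.comp 65)

def Bx.test : Bx → Test
  | .lt _ _ => .lt 64 65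
  | .eq _ _ => .eq 64 65

def Bx.cost : Bx → ℕ
  | .lt a b => a.cost + b.cost
  | .eq a b => a.cost + b.cost

def Pr.comp : Pr → Cmd
  | .skip => .skip
  | .assign x e => .seq (e.comp 64) (.seq (.const 65 0) (.op .add x 64 65))
  | .set t i j e => .seq (e.comp 64) (.seq (i.comp 65) (.seq (j.comp 66) (.seq (.const 67 t)
      (.seq (.op .mul 67 67 0) (.seq (.op .add 67 67 65)
      (.seq (.op .mul 67 67 0) (.seq (.op .add 67 67 66) (.store 67 64))))))))
  | .seq p q => .seq p.comp q.comp
  | .ite b p q => .seq b.comp (.ite b.test p.comp q.comp)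
  | .loop x y p => .seq (.const x 0)
      (.while (.lt x y) (.seq p.comp (.seq (.const 64 1) (.op .add x x 64))))

/-- Variable `0` is never assigned, so register `0` keeps the `n` needed for addresses. A loop body
touches neither the counter nor the bound, so the number of iterations is fixed on entry. -/
def Pr.wf : Pr → Bool
  | .skip => true
  | .assign x e => x.blt 64 && !(x == 0) && e.wf
  | .set t i j e => t.blt 32 && i.wf && j.wf && e.wf
  | .seq p q => p.wf && q.wf
  | .ite b p q => b.wf && p.wf && q.wf
  | .loop x y p => x.blt 64 && y.blt 64 && !(x == 0) && !(y == x) && p.wf && !p.mv.contains x &&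
      !p.mv.contains y

/-- Bound for the number of steps. -/
def Pr.time (n m : ℕ) : Pr → ℕ
  | .skip => 1
  | .assign _ e => e.cost + 2
  | .set _ i j e => i.cost + j.cost + e.cost + 6
  | .seq p q => p.time n m + q.time n m
  | .ite b p q => b.cost + 1 + p.time n m + q.time n m
  | .loop _ y p => lim n m y * (p.time n m + 3) + 2

/-- The abstract state `s` is represented by the machine state `σ`. -/
structure Rel (n M : ℕ) (s : St) (σ : State) : Prop where
  reg : ∀ x < 64, σ.reg x = s.v x
  regB : ∀ x < 64, s.v x < M
  mem : ∀ t < 32, ∀ i < n, ∀ j < n, σ.mem ((t * n + i) * n + j) = s.a t i j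
  memB : ∀ t < 32, ∀ i < n, ∀ j < n, s.a t i j < M
  zero : s.v 0 = n

/-! ### Addresses and register contents -/

theorem addr_inj {n t i j t' i' j' : ℕ} (hi : i < n) (hj : j < n) (hi' : i' < n) (hj' : j' < n)
    (h : (t * n + i) * n + j = (t' * n + i') * n + j') : t = t' ∧ i = i' ∧ j = j' := by
  have hn : 0 < n := by omega
  have key : ∀ {a b c d : ℕ}, b < n → d < n → a * n + b = c * n + d → a = c ∧ b = d := by
    intro a b c d hb hd h
    have h1 : (b + n * a) / n = (d + n * c) / n := by
      rw [show b + n * a = d + n * c by linarith [mul_comm a n, mul_comm c n]]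
    rw [Nat.add_mul_div_left _ _ hn, Nat.add_mul_div_left _ _ hn, Nat.div_eq_of_lt hb,
      Nat.div_eq_of_lt hd] at h1
    have : a = c := by omega
    subst this
    exact ⟨rfl, by omega⟩
  obtain ⟨h1, h2⟩ := key hj hj' h
  obtain ⟨h3, h4⟩ := key hi hi' h1
  exact ⟨h3, h4, h2⟩

/-- Addresses are evaluated by Horner's rule, and each partial result must fit into a word. The
constant `32` is the number of arrays. -/
theorem addr_bounds {n M t i j : ℕ} (hM : 32 * (n + 1) * (n + 1) ≤ M) (ht : t < 32) (hi : i < n)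
    (hj : j < n) : t < M ∧ t * n < M ∧ t * n + i < M ∧ (t * n + i) * n < M ∧
      (t * n + i) * n + j < M := by
  have h1 : t * n + i < 32 * n := by nlinarith
  have h2 : (t * n + i + 1) * n ≤ 32 * n * n := Nat.mul_le_mul_right n h1
  refine ⟨?_, ?_, ?_, ?_, ?_⟩ <;> nlinarith

theorem setReg_reg (σ : State) (r x y : ℕ) :
    (σ.setReg r x).reg y = if y = r then x else σ.reg y := by
  simp [State.setReg, Function.update_apply]

theorem setReg_mem (σ : State) (r x : ℕ) : (σ.setReg r x).mem = σ.mem := rfl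

theorem setMem_reg (σ : State) (r x : ℕ) : (σ.setMem r x).reg = σ.reg := rfl

theorem setMem_mem (σ : State) (r x y : ℕ) :
    (σ.setMem r x).mem y = if y = r then x else σ.mem y := by
  simp [State.setMem, Function.update_apply]

/-- Registers below `d` and the memory are unchanged. -/
def Keeps (d : ℕ) (σ τ : State) : Prop := (∀ r < d, τ.reg r = σ.reg r) ∧ τ.mem = σ.mem

theorem Keeps.trans {d : ℕ} {σ τ υ : State} (h : Keeps d σ τ) (h' : Keeps d τ υ) : Keeps d σ υ :=
  ⟨fun r hr => (h'.1 r hr).trans (h.1 r hr), h'.2.trans h.2⟩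

theorem Keeps.mono {d d' : ℕ} {σ τ : State} (h : Keeps d σ τ) (hd : d' ≤ d) : Keeps d' σ τ :=
  ⟨fun r hr => h.1 r (by omega), h.2⟩

theorem Keeps.rel {n M d : ℕ} {s : St} {σ τ : State} (h : Keeps d σ τ) (hd : 64 ≤ d)
    (hr : Rel n M s σ) : Rel n M s τ :=
  ⟨fun x hx => (h.1 x (by omega)).trans (hr.reg x hx), hr.regB,
    fun t ht i hi j hj => by rw [h.2]; exact hr.mem t ht i hi j hj, hr.memB, hr.zero⟩

theorem keeps_setReg {d r : ℕ} (σ : State) (x : ℕ) (h : d ≤ r) : Keeps d σ (σ.setReg r x) :=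
  ⟨fun r' hr => by rw [setReg_reg, if_neg (by omega)], rfl⟩

theorem Exec.addr {w n t i j : ℕ} {σ : State} (a d b : ℕ) (hab : a ≠ b) (had : a ≠ d) (ha : a ≠ 0)
    (hM : 32 * (n + 1) * (n + 1) ≤ 2 ^ w) (ht : t < 32) (hi : i < n) (hj : j < n)
    (h0 : σ.reg 0 = n) (hd : σ.reg d = i) (hb : σ.reg b = j) {c : Cmd} {τ : State} {T : ℕ}
    (h : ∀ υ : State, (∀ r, υ.reg r = if r = a then (t * n + i) * n + j else σ.reg r) →
      υ.mem = σ.mem → Exec w c υ τ T) :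
    Exec w (.seq (.const a t) (.seq (.op .mul a a 0) (.seq (.op .add a a d)
      (.seq (.op .mul a a 0) (.seq (.op .add a a b) c))))) σ τ (T + 5) := by
  obtain ⟨h1, h2, h3, h4, h5⟩ := addr_bounds hM ht hi hj
  rw [show T + 5 = 1 + (1 + (1 + (1 + (1 + T)))) by omega]
  refine Exec.seq (Exec.const _ _ _) (Exec.seq (Exec.op _ _ _ _ _) (Exec.seq (Exec.op _ _ _ _ _)
    (Exec.seq (Exec.op _ _ _ _ _) (Exec.seq (Exec.op _ _ _ _ _) (h _ ?_ rfl)))))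
  intro r
  by_cases hr : r = a
  · subst hr
    simp [setReg_reg, Op.eval, Nat.mod_eq_of_lt, h0, hd, hb, h1, h2, h3, h4, h5, Ne.symm hab,
      Ne.symm had, Ne.symm ha]
  · simp [setReg_reg, hr]

/-- Operands use increasing registers: the first value waits in `d` while the second is computed
from `d + 1` on. Registers below `d` are kept, and with `64 ≤ d` this preserves all variables. -/
theorem Ex.sound {w n : ℕ} (hM : 32 * (n + 1) * (n + 1) ≤ 2 ^ w) {s : St} (e : Ex) :
    ∀ {σ : State} {d : ℕ}, Rel n (2 ^ w) s σ → 64 ≤ d → e.wf = true → e.ok n (2 ^ w) s →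
      ∃ τ, Exec w (e.comp d) σ τ e.cost ∧ τ.reg d = e.eval s ∧ e.eval s < 2 ^ w ∧
        Keeps d σ τ := by
  have hpos : 0 < 2 ^ w := by positivity
  induction e with
  | lit c =>
    intro σ d hr hd hwf hok
    refine ⟨_, Exec.const _ _ _, ?_, hok, keeps_setReg _ _ le_rfl⟩
    simp [setReg_reg, Ex.eval, Nat.mod_eq_of_lt (show c < 2 ^ w from hok)]
  | var x =>
    intro σ d hr hd hwf hok
    have hx : x < 64 := by simpa [Ex.wf] using hwf
    have hB := hr.regB x hx
    refine ⟨_, Exec.seq (Exec.const _ _ _) (Exec.op _ _ _ _ _), ?_, hB,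
      (keeps_setReg _ _ le_rfl).trans (keeps_setReg _ _ le_rfl)⟩
    simp [setReg_reg, Ex.eval, Op.eval, show x ≠ d by omega, hr.reg x hx, Nat.mod_eq_of_lt hB]
  | bin o a b iha ihb =>
    intro σ d hr hd hwf hok
    simp only [Ex.wf, Bool.and_eq_true] at hwf
    have hok' : a.ok n (2 ^ w) s ∧ b.ok n (2 ^ w) s := by
      cases o <;> simp only [Ex.ok] at hok <;> tauto
    obtain ⟨τ, h1, h2, h3, h4⟩ := iha hr hd hwf.1 hok'.1
    obtain ⟨υ, k1, k2, k3, k4⟩ := ihb (d := d + 1) (h4.rel hd hr) (by omega) hwf.2 hok'.2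
    have hlt : o.eval (a.eval s) (b.eval s) < 2 ^ w := by
      cases o with
      | add => exact hok.2.2
      | mul => exact hok.2.2
      | sub => exact (Nat.sub_le _ _).trans_lt h3
      | div => exact (Nat.div_le_self _ _).trans_lt h3
      | mod => exact (Nat.mod_le _ _).trans_lt h3
    refine ⟨υ.setReg d (o.eval (a.eval s) (b.eval s)), ?_, by simp [setReg_reg, Ex.eval], hlt,
      (h4.trans (k4.mono (by omega))).trans (keeps_setReg _ _ le_rfl)⟩
    rw [Ex.cost, show a.cost + b.cost + 1 = a.cost + (b.cost + 1) by omega]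
    refine Exec.seq h1 (Exec.seq k1 ?_)
    have := Exec.op (w := w) υ o d d (d + 1)
    rwa [k2, k4.1 d (by omega), h2, Nat.mod_eq_of_lt hlt] at this
  | get t i j ihi ihj =>
    intro σ d hr hd hwf hok
    simp only [Ex.wf, Bool.and_eq_true, Nat.blt_eq] at hwf
    obtain ⟨hi, hj, hin, hjn⟩ := hok
    obtain ⟨τ, h1, h2, h3, h4⟩ := ihi hr hd hwf.1.2 hi
    obtain ⟨υ, k1, k2, k3, k4⟩ := ihj (d := d + 1) (h4.rel hd hr) (by omega) hwf.2 hj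
    have hr' : Rel n (2 ^ w) s υ := k4.rel (by omega) (h4.rel hd hr)
    refine ⟨υ.setReg (d + 2) ((t * n + i.eval s) * n + j.eval s) |>.setReg d
      (s.a t (i.eval s) (j.eval s)), ?_, by simp [setReg_reg, Ex.eval],
      hr.memB _ hwf.1.1 _ hin _ hjn,
      (h4.trans (k4.mono (by omega))).trans ((keeps_setReg _ _ (by omega)).trans
        (keeps_setReg _ _ le_rfl))⟩
    rw [Ex.cost, show i.cost + j.cost + 6 = i.cost + (j.cost + (1 + 5)) by omega]
    refine Exec.seq h1 (Exec.seq k1 (Exec.addr (d + 2) d (d + 1) (by omega) (by omega) (by omega)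
      hM hwf.1.1 hin hjn ((hr'.reg 0 (by omega)).trans hr'.zero)
      (by rw [k4.1 d (by omega), h2]) k2 ?_))
    intro ρ hρ hρm
    have : ρ = υ.setReg (d + 2) ((t * n + i.eval s) * n + j.eval s) := by
      obtain ⟨ρr, ρm⟩ := ρ
      simp only at hρ hρm
      subst hρm
      simp only [State.setReg, State.mk.injEq, and_true]
      funext r
      simp [hρ, Function.update_apply]
    subst this
    have h5 := Exec.load (w := w) (υ.setReg (d + 2) ((t * n + i.eval s) * n + j.eval s)) d (d + 2)
    rwa [setReg_mem, setReg_reg, if_pos rfl, hr'.mem _ hwf.1.1 _ hin _ hjn] at h5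

theorem Bx.sound {w n : ℕ} (hM : 32 * (n + 1) * (n + 1) ≤ 2 ^ w) {s : St} (b : Bx)
    {σ : State} (hr : Rel n (2 ^ w) s σ) (hwf : b.wf = true) (hok : b.ok n (2 ^ w) s) :
      ∃ τ, Exec w b.comp σ τ b.cost ∧ (b.test.Holds τ ↔ b.Holds s) ∧ Rel n (2 ^ w) s τ := by
  cases b with
  | lt a b =>
    simp only [Bx.wf, Bool.and_eq_true] at hwf
    obtain ⟨τ, h1, h2, h3, h4⟩ := a.sound hM hr le_rfl hwf.1 hok.1
    obtain ⟨υ, k1, k2, k3, k4⟩ := b.sound hM (d := 65) (h4.rel le_rfl hr) (by omega) hwf.2 hok.2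
    refine ⟨υ, Exec.seq h1 k1, ?_, k4.rel (by omega) (h4.rel le_rfl hr)⟩
    simp [Bx.test, Test.Holds, Bx.Holds, k2, k4.1 64 (by omega), h2]
  | eq a b =>
    simp only [Bx.wf, Bool.and_eq_true] at hwf
    obtain ⟨τ, h1, h2, h3, h4⟩ := a.sound hM hr le_rfl hwf.1 hok.1
    obtain ⟨υ, k1, k2, k3, k4⟩ := b.sound hM (d := 65) (h4.rel le_rfl hr) (by omega) hwf.2 hok.2
    refine ⟨υ, Exec.seq h1 k1, ?_, k4.rel (by omega) (h4.rel le_rfl hr)⟩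
    simp [Bx.test, Test.Holds, Bx.Holds, k2, k4.1 64 (by omega), h2]

theorem Rel.setV {n M : ℕ} {s : St} {σ : State} (hr : Rel n M s σ) {x k : ℕ}
    (hx0 : x ≠ 0) (hk : k < M) : Rel n M (s.setV x k) (σ.setReg x k) := by
  refine ⟨fun y hy => ?_, fun y hy => ?_, hr.mem, hr.memB, ?_⟩
  · rw [setReg_reg, setV_v, hr.reg y hy]
  · rw [setV_v]; split_ifs
    · exact hk
    · exact hr.regB y hy
  · rw [setV_v, if_neg (Ne.symm hx0), hr.zero]

/-- Framing the body shows that counter and bound are intact when the machine increments and tests.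
The increment cannot overflow, because it stays at most the bound, which is a stored word. -/
theorem Pr.sound_loop {w n m : ℕ} {x y : ℕ} {p : Pr}
    (hx : x < 64) (hy : y < 64) (hx0 : x ≠ 0) (hxy : y ≠ x) (hpx : p.mv.contains x = false)
    (hpy : p.mv.contains y = false)
    (ih : ∀ (Q : St → Prop) (s : St) (σ : State), Rel n (2 ^ w) s σ → wp n (2 ^ w) m p Q s →
      ∃ τ t s', Exec w p.comp σ τ t ∧ Rel n (2 ^ w) s' τ ∧ Q s' ∧ t ≤ p.time n m) (k : ℕ) :
    ∀ (i : ℕ) (Q : St → Prop) (s : St) (σ : State), Rel n (2 ^ w) (s.setV x i) σ →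
      s.v y = i + k → loopWp (wp n (2 ^ w) m p) x k i Q s →
      ∃ τ t s', Exec w (.while (.lt x y) (.seq p.comp (.seq (.const 64 1) (.op .add x x 64)))) σ τ t
        ∧ Rel n (2 ^ w) s' τ ∧ Q s' ∧ t ≤ k * (p.time n m + 3) + 1 := by
  induction k with
  | zero =>
    intro i Q s σ hr hi h
    refine ⟨σ, 1, _, Exec.while_false ?_, hr, h, by omega⟩
    simp [Test.Holds, hr.reg x hx, hr.reg y hy, hxy, hi]
  | succ k ihk =>
    intro i Q s σ hr hi h
    obtain ⟨τ, t, s', h1, h2, ⟨h3, h4⟩, h5⟩ := ih _ _ _ hr (wp_frame p _ _ h)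
    have e1 : s'.v x = i := by rw [h4.1 x hpx]; simp
    have e2 : s'.v y = i + (k + 1) := by rw [h4.1 y hpy]; simp [hxy, hi]
    have b1 : i + (k + 1) < 2 ^ w := by rw [← e2]; exact h2.regB y hy
    have hr' : Rel n (2 ^ w) (s'.setV x (i + 1)) ((τ.setReg 64 1).setReg x (i + 1)) :=
      ((keeps_setReg τ 1 (le_refl 64)).rel le_rfl h2).setV hx0 (by omega)
    obtain ⟨υ, t', s'', k1, k2, k3, k4⟩ := ihk (i + 1) Q s' _ hr' (by omega) h3
    refine ⟨υ, _, s'', Exec.while_true (τ := (τ.setReg 64 1).setReg x (i + 1)) ?_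
      (Exec.seq h1 (Exec.seq (t := 1) (t' := 1) (τ := τ.setReg 64 1) ?_ ?_)) k1, k2, k3, ?_⟩
    · simp [Test.Holds, hr.reg x hx, hr.reg y hy, hxy, hi]
    · have := Exec.const (w := w) τ 64 1
      rwa [Nat.mod_eq_of_lt (by omega)] at this
    · have := Exec.op (w := w) (τ.setReg 64 1) .add x x 64
      simp only [setReg_reg, Op.eval] at this
      rwa [if_neg (by omega), if_pos trivial, h2.reg x hx, e1, Nat.mod_eq_of_lt (by omega)] at this
    · have : (k + 1) * (p.time n m + 3) = k * (p.time n m + 3) + (p.time n m + 3) := by ring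
      omega

theorem Pr.sound {w n m : ℕ} (hM : 32 * (n + 1) * (n + 1) ≤ 2 ^ w) (p : Pr) :
    p.wf = true → ∀ (Q : St → Prop) (s : St) (σ : State), Rel n (2 ^ w) s σ →
      wp n (2 ^ w) m p Q s →
      ∃ τ t s', Exec w p.comp σ τ t ∧ Rel n (2 ^ w) s' τ ∧ Q s' ∧ t ≤ p.time n m := by
  induction p with
  | skip => intro _ Q s σ hr h; exact ⟨σ, 1, s, Exec.skip _, hr, h, le_rfl⟩
  | assign x e =>
    intro hwf Q s σ hr h
    simp only [Pr.wf, Bool.and_eq_true, Nat.blt_eq, Bool.not_eq_true', beq_eq_false_iff_ne] at hwf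
    obtain ⟨τ, h1, h2, h3, h4⟩ := e.sound hM hr le_rfl hwf.2 h.1
    refine ⟨(τ.setReg 65 0).setReg x (e.eval s), _, _, Exec.seq h1 (Exec.seq (t := 1) (t' := 1)
      (τ := τ.setReg 65 0) ?_ ?_),
      (((h4.mono le_rfl).trans (keeps_setReg τ 0 (by omega))).rel le_rfl hr).setV hwf.1.2 h3, h.2, by simp [Pr.time]⟩
    · simpa using Exec.const (w := w) τ 65 0
    · have := Exec.op (w := w) (τ.setReg 65 0) .add x 64 65
      simp only [setReg_reg, Op.eval] at this
      simpa [h2, Nat.mod_eq_of_lt h3] using this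
  | set t i j e =>
    intro hwf Q s σ hr h
    simp only [Pr.wf, Bool.and_eq_true, Nat.blt_eq] at hwf
    obtain ⟨⟨⟨wt, wi⟩, wj⟩, we⟩ := hwf
    obtain ⟨oi, oj, oe, hi, hj, hQ⟩ := h
    obtain ⟨τ, h1, h2, h3, h4⟩ := e.sound hM hr le_rfl we oe
    have r1 := h4.rel le_rfl hr
    obtain ⟨υ, k1, k2, k3, k4⟩ := i.sound hM (d := 65) r1 (by omega) wi oi
    have r2 := k4.rel (by omega) r1
    obtain ⟨ρ, l1, l2, l3, l4⟩ := j.sound hM (d := 66) r2 (by omega) wj oj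
    have r3 := l4.rel (by omega) r2
    have q1 : ρ.reg 64 = e.eval s := by rw [l4.1 64 (by omega), k4.1 64 (by omega), h2]
    have q2 : ρ.reg 65 = i.eval s := by rw [l4.1 65 (by omega), k2]
    have hrel : Rel n (2 ^ w) (s.setA t (i.eval s) (j.eval s) (e.eval s))
        ((ρ.setReg 67 ((t * n + i.eval s) * n + j.eval s)).setMem
          ((t * n + i.eval s) * n + j.eval s) (e.eval s)) := by
      refine ⟨fun x hx => ?_, r3.regB, fun t' ht' i' hi' j' hj' => ?_,
        fun t' ht' i' hi' j' hj' => ?_, r3.zero⟩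
      · rw [setMem_reg, setReg_reg, if_neg (by omega)]; exact r3.reg x hx
      · rw [setMem_mem, setReg_mem, setA_a]
        -- By injectivity of addresses, writing one cell disturbs no other cell of any array.
        by_cases hc : (t' * n + i') * n + j' = (t * n + i.eval s) * n + j.eval s
        · obtain ⟨rfl, rfl, rfl⟩ := addr_inj hi' hj' hi hj hc
          simp [upd]
        · rw [if_neg hc, r3.mem t' ht' i' hi' j' hj']
          split_ifs with ht
          · subst ht
            rw [upd, if_neg]
            rintro ⟨rfl, rfl⟩
            exact hc rfl
          · rfl
      · rw [setA_a]
        split_ifs with ht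
        · subst ht
          rw [upd]
          split_ifs
          · exact h3
          · exact r3.memB t' ht' i' hi' j' hj'
        · exact r3.memB t' ht' i' hi' j' hj'
    refine ⟨_, _, _, Exec.seq h1 (Exec.seq k1 (Exec.seq l1 (Exec.addr (T := 1) 67 65 66 (by omega)
      (by omega) (by omega) hM wt hi hj ((r3.reg 0 (by omega)).trans r3.zero) q2 l2
      ?_))), hrel, hQ, ?_⟩
    · intro κ hκ hκm
      have : κ = ρ.setReg 67 ((t * n + i.eval s) * n + j.eval s) := by
        obtain ⟨κr, κm⟩ := κ
        simp only at hκ hκm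
        subst hκm
        simp only [State.setReg, State.mk.injEq, and_true]
        funext r
        simp [hκ, Function.update_apply]
      subst this
      have h5 := Exec.store (w := w) (ρ.setReg 67 ((t * n + i.eval s) * n + j.eval s)) 67 64
      simp only [setReg_reg] at h5
      simpa [q1] using h5
    · simp only [Pr.time]; omega
  | seq p q ihp ihq =>
    intro hwf Q s σ hr h
    simp only [Pr.wf, Bool.and_eq_true] at hwf
    obtain ⟨τ, t, s', h1, h2, h3, h4⟩ := ihp hwf.1 _ _ _ hr h
    obtain ⟨υ, t', s'', k1, k2, k3, k4⟩ := ihq hwf.2 _ _ _ h2 h3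
    exact ⟨υ, _, s'', Exec.seq h1 k1, k2, k3, by simp only [Pr.time]; omega⟩
  | ite b p q ihp ihq =>
    intro hwf Q s σ hr h
    simp only [Pr.wf, Bool.and_eq_true] at hwf
    obtain ⟨τ, h1, h2, h3⟩ := b.sound hM hr hwf.1.1 h.1
    by_cases hb : b.Holds s
    · obtain ⟨υ, t', s'', k1, k2, k3, k4⟩ := ihp hwf.1.2 _ _ _ h3 (h.2.1 hb)
      exact ⟨υ, _, s'', Exec.seq h1 (Exec.ite_true (h2.2 hb) k1), k2, k3, by
        simp only [Pr.time]; omega⟩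
    · obtain ⟨υ, t', s'', k1, k2, k3, k4⟩ := ihq hwf.2 _ _ _ h3 (h.2.2 hb)
      exact ⟨υ, _, s'', Exec.seq h1 (Exec.ite_false (fun hh => hb (h2.1 hh)) k1), k2, k3, by
        simp only [Pr.time]; omega⟩
  | loop x y p ih =>
    intro hwf Q s σ hr h
    simp only [Pr.wf, Bool.and_eq_true, Nat.blt_eq, Bool.not_eq_true', beq_eq_false_iff_ne] at hwf
    obtain ⟨⟨⟨⟨⟨⟨hx, hy⟩, hx0⟩, hyx⟩, hp⟩, hpx⟩, hpy⟩ := hwf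
    have hpos : 0 < 2 ^ w := by positivity
    obtain ⟨τ, t, s', h1, h2, h3, h4⟩ := Pr.sound_loop hx hy hx0 hyx hpx hpy (ih hp) (s.v y) 0 Q s
      (σ.setReg x 0) (hr.setV hx0 hpos) (by omega) h.2
    refine ⟨τ, _, s', Exec.seq (t := 1) ?_ h1, h2, h3, ?_⟩
    · simpa using Exec.const (w := w) σ x 0
    · have := Nat.mul_le_mul_right (p.time n m + 3) h.1
      simp only [Pr.time]; omega

/-! #### Running times -/

/-- Nesting depth of the loops bounded by the variable `0`. -/
def Pr.depth : Pr → ℕ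
  | .skip => 0
  | .assign _ _ => 0
  | .set _ _ _ _ => 0
  | .seq p q => max p.depth q.depth
  | .ite _ p q => max p.depth q.depth
  | .loop _ y p => if y = 0 then p.depth + 1 else p.depth

/-- Nesting depth of the other loops. -/
def Pr.depth' : Pr → ℕ
  | .skip => 0
  | .assign _ _ => 0
  | .set _ _ _ _ => 0
  | .seq p q => max p.depth' q.depth'
  | .ite _ p q => max p.depth' q.depth'
  | .loop _ y p => if y = 0 then p.depth' else p.depth' + 1

def Pr.size : Pr → ℕ
  | .skip => 1
  | .assign _ e => e.cost + 2
  | .set _ i j e => i.cost + j.cost + e.cost + 6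
  | .seq p q => p.size + q.size
  | .ite b p q => b.cost + 1 + p.size + q.size
  | .loop _ _ p => p.size + 5

/-- A loop multiplies the bound of its body by `n + 1` or `m + 1` according to its kind, and
sequencing takes the larger exponents. Only the nesting depths remain to be evaluated. -/
theorem Pr.time_le (n m : ℕ) (p : Pr) :
    p.time n m ≤ p.size * ((n + 1) ^ p.depth * (m + 1) ^ p.depth') := by
  have mono : ∀ {a b a' b' : ℕ}, a ≤ a' → b ≤ b' →
      (n + 1) ^ a * (m + 1) ^ b ≤ (n + 1) ^ a' * (m + 1) ^ b' := fun h h' =>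
    Nat.mul_le_mul (Nat.pow_le_pow_right (by omega) h) (Nat.pow_le_pow_right (by omega) h')
  have one : ∀ a b : ℕ, 1 ≤ (n + 1) ^ a * (m + 1) ^ b := fun a b => Nat.pos_of_ne_zero (by positivity)
  induction p with
  | skip => simp [Pr.time, Pr.size, Pr.depth, Pr.depth']
  | assign x e => simp [Pr.time, Pr.size, Pr.depth, Pr.depth']
  | set t i j e => simp [Pr.time, Pr.size, Pr.depth, Pr.depth']
  | seq p q ihp ihq =>
    simp only [Pr.time, Pr.size, Pr.depth, Pr.depth', add_mul]
    exact add_le_add (ihp.trans (Nat.mul_le_mul_left _ (mono (le_max_left _ _) (le_max_left _ _))))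
      (ihq.trans (Nat.mul_le_mul_left _ (mono (le_max_right _ _) (le_max_right _ _))))
  | ite b p q ihp ihq =>
    simp only [Pr.time, Pr.size, Pr.depth, Pr.depth', add_mul]
    refine add_le_add (add_le_add (add_le_add ?_ ?_) ?_) ?_
    · exact Nat.le_mul_of_pos_right _ (one _ _)
    · exact Nat.le_mul_of_pos_right _ (one _ _)
    · exact ihp.trans (Nat.mul_le_mul_left _ (mono (le_max_left _ _) (le_max_left _ _)))
    · exact ihq.trans (Nat.mul_le_mul_left _ (mono (le_max_right _ _) (le_max_right _ _)))
  | loop x y p ih =>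
    simp only [Pr.time, Pr.size, Pr.depth, Pr.depth']
    have h1 := one p.depth p.depth'
    set X := (n + 1) ^ p.depth * (m + 1) ^ p.depth' with hX
    -- The factor `l + 1` instead of `l` absorbs the constant overhead, also for a loop that never
    -- runs.
    have key : ∀ l : ℕ, l * (p.time n m + 3) + 2 ≤ (p.size + 5) * ((l + 1) * X) := by
      intro l
      have h2 : p.time n m + 3 ≤ (p.size + 3) * X := by nlinarith
      have h3 := Nat.mul_le_mul_left l h2
      nlinarith [Nat.zero_le (l * X), Nat.zero_le (p.size * X)]
    by_cases hy : y = 0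
    · simp only [hy, lim, if_true, pow_succ]
      refine (key n).trans (le_of_eq ?_)
      rw [hX]; ring
    · simp only [hy, lim, if_false, pow_succ]
      refine (key m).trans (le_of_eq ?_)
      rw [hX]; ring

end RamLang

/-! ### Costs as sums over ordered pairs; charging disagreements of PIVOT to bad triples -/

namespace CCC

section Pivot

open Classical

variable {V : Type*}

/-- Each edge is seen in both orders. From here on costs are double sums over ordered pairs, at the
price of a factor 2 that cancels in the end. -/
theorem two_mul_ncard_edgeSet [Fintype V] (G : SimpleGraph V) :
    2 * G.edgeSet.ncard = ∑ u : V, ∑ v : V, if G.Adj u v then 1 else 0 := by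
  have h := G.sum_degrees_eq_twice_card_edges
  rw [← SimpleGraph.coe_edgeFinset, Set.ncard_coe_finset, ← h]
  refine Finset.sum_congr rfl fun u _ => ?_
  rw [Finset.sum_boole, ← SimpleGraph.card_neighborFinset_eq_degree,
    SimpleGraph.neighborFinset_eq_filter]
  simp

theorem two_mul_ncard_symmDiff [Fintype V] (G H : SimpleGraph V) :
    2 * (symmDiff G.edgeSet H.edgeSet).ncard =
      ∑ u : V, ∑ v : V, if (G.Adj u v ↔ H.Adj u v) then 0 else 1 := by
  have : symmDiff G.edgeSet H.edgeSet = ((G \ H) ⊔ (H \ G)).edgeSet := by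
    rw [SimpleGraph.edgeSet_sup, SimpleGraph.edgeSet_sdiff, SimpleGraph.edgeSet_sdiff]
    rfl
  rw [this, two_mul_ncard_edgeSet]
  refine Finset.sum_congr rfl fun u _ => Finset.sum_congr rfl fun v _ => ?_
  simp only [SimpleGraph.sup_adj, SimpleGraph.sdiff_adj]
  by_cases h1 : G.Adj u v <;> by_cases h2 : H.Adj u v <;> simp [h1, h2]

/-- The indicator of a disagreement of `G` with the clustering `C`. -/
noncomputable def disagree (G : SimpleGraph V) (C : Setoid V) (u v : V) : ℕ :=
  if (G.Adj u v ↔ (clusterGraph C).Adj u v) then 0 else 1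

theorem two_mul_cost [Fintype V] (G : SimpleGraph V) (C : Setoid V) :
    2 * cost G C = ∑ u : V, ∑ v : V, disagree G C u v :=
  two_mul_ncard_symmDiff _ _

/-- Matrix encoding of a graph: `3` on the diagonal, `1` for edges, `0` for non-edges. -/
noncomputable def code (G : SimpleGraph V) (u v : V) : ℕ :=
  if u = v then 3 else if G.Adj u v then 1 else 0

theorem code_comm (G : SimpleGraph V) (u v : V) : code G u v = code G v u := by
  simp [code, eq_comm, G.adj_comm]

/-- Bad triples: three distinct nodes with exactly two edges. -/
def Bad (G : SimpleGraph V) (u v w : V) : Prop := code G u v + code G u w + code G v w = 2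

theorem Bad.swap {G : SimpleGraph V} {u v w : V} : Bad G u v w ↔ Bad G u w v := by
  unfold Bad; rw [code_comm G v w]; omega

theorem Bad.rotate {G : SimpleGraph V} {u v w : V} : Bad G u v w ↔ Bad G v w u := by
  unfold Bad; rw [code_comm G v u, code_comm G w u]; omega

theorem code_eq_one {G : SimpleGraph V} {u v : V} : code G u v = 1 ↔ G.Adj u v := by
  unfold code
  split_ifs with h1 h2
  · subst h1; simp
  · simp [h2]
  · simp [h2]

theorem code_eq_zero {G : SimpleGraph V} {u v : V} : code G u v = 0 ↔ u ≠ v ∧ ¬ G.Adj u v := by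
  unfold code
  split_ifs with h1 h2 <;> simp [*]

theorem code_pos {G : SimpleGraph V} {u v : V} : 0 < code G u v ↔ v = u ∨ G.Adj u v := by
  rw [Nat.pos_iff_ne_zero, Ne, code_eq_zero, not_and_or, not_not, not_not, eq_comm]

/-- The diagonal entry `3` rules out the sum `2` as soon as two nodes coincide, so a single
comparison also tests distinctness. -/
theorem bad_iff {G : SimpleGraph V} {u v w : V} : Bad G u v w ↔
    (G.Adj u v ∧ G.Adj u w ∧ v ≠ w ∧ ¬ G.Adj v w) ∨ (G.Adj u v ∧ G.Adj v w ∧ u ≠ w ∧ ¬ G.Adj u w) ∨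
      (G.Adj u w ∧ G.Adj v w ∧ u ≠ v ∧ ¬ G.Adj u v) := by
  simp only [← code_eq_zero]
  simp only [← code_eq_one, Bad]
  have h : ∀ a b : V, code G a b = 0 ∨ code G a b = 1 ∨ code G a b = 3 := by
    intro a b; unfold code; split_ifs <;> simp
  rcases h u v with h1 | h1 | h1 <;> rcases h u w with h2 | h2 | h2 <;>
    rcases h v w with h3 | h3 | h3 <;> simp [h1, h2, h3]

/-- Every clustering disagrees with some pair of a bad triple. -/
theorem Bad.hit {G : SimpleGraph V} (D : Setoid V) {u v w : V} (h : Bad G u v w) :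
    1 ≤ disagree G D u v + disagree G D u w + disagree G D v w := by
  by_contra! hlt
  have h0 : disagree G D u v = 0 ∧ disagree G D u w = 0 ∧ disagree G D v w = 0 := by omega
  have key : ∀ {a b}, disagree G D a b = 0 → (G.Adj a b ↔ a ≠ b ∧ D a b) := by
    intro a b h
    unfold disagree at h
    split_ifs at h with h'
    exact h'
  have k1 := key h0.1
  have k2 := key h0.2.1
  have k3 := key h0.2.2
  rw [bad_iff] at h
  rcases h with ⟨a, b, c, d⟩ | ⟨a, b, c, d⟩ | ⟨a, b, c, d⟩
  · exact d (k3.2 ⟨c, D.trans (D.symm (k1.1 a).2) (k2.1 b).2⟩)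
  · exact d (k2.2 ⟨c, D.trans (k1.1 a).2 (k3.1 b).2⟩)
  · exact d (k1.2 ⟨c, D.trans (k2.1 a).2 (D.symm (k3.1 b).2)⟩)

/-- The number of (ordered) bad triples in `R` that contain `u`. -/
noncomputable def badCount (G : SimpleGraph V) (R : Finset V) (u : V) : ℕ :=
  ∑ v ∈ R, ∑ w ∈ R, if Bad G u v w then 1 else 0

/-- The weight of the pairs opposite to `u` in the bad triples in `R`. -/
noncomputable def badWeight (G : SimpleGraph V) (W : V → V → ℕ) (R : Finset V) (u : V) : ℕ :=
  ∑ v ∈ R, ∑ w ∈ R, if Bad G u v w then W v w else 0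

/-- Runs of PIVOT in which the disagreements caused by each pivot are paid for by the weights
of the pairs that are removed. -/
inductive ChargedRun (G : SimpleGraph V) (W : V → V → ℕ) (T : ℕ) :
    Finset V → List (Finset V) → Prop
  | nil : ChargedRun G W T ∅ []
  | cons (R : Finset V) (u : V) (L : List (Finset V)) (hu : u ∈ R)
      (hT : badCount G R u * T ≤ 3 * badWeight G W R u)
      (h : ChargedRun G W T (R \ R.filter (fun v => v = u ∨ G.Adj u v)) L) :
      ChargedRun G W T R (R.filter (fun v => v = u ∨ G.Adj u v) :: L)

theorem ChargedRun.pivotRun {G : SimpleGraph V} {W : V → V → ℕ} {T : ℕ} {R : Finset V}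
    {L : List (Finset V)} (h : ChargedRun G W T R L) : PivotRun G R L := by
  induction h with
  | nil => exact .nil
  | cons R u L hu _ _ ih => exact .cons R u L hu ih

/-- Without bad triples no pivot causes a disagreement, so zero weights pay for any run. This serves
the case of a clustering of cost zero, which the analysis of the weights excludes. -/
theorem PivotRun.chargedRun {G : SimpleGraph V} (hG : ∀ u v w, ¬ Bad G u v w) {R : Finset V}
    {L : List (Finset V)} (h : PivotRun G R L) : ChargedRun G (fun _ _ => 0) 1 R L := by
  induction h with
  | nil => exact .nil
  | cons R u L hu _ ih => exact .cons R u L hu (by simp [badCount, hG]) ih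

theorem PivotRun.subset {G : SimpleGraph V} {R : Finset V} {L : List (Finset V)}
    (h : PivotRun G R L) : ∀ K ∈ L, K ⊆ R := by
  induction h with
  | nil => simp
  | cons R u L hu _ ih =>
    intro K hK
    rcases List.mem_cons.1 hK with rfl | hK
    · exact Finset.filter_subset _ _
    · exact (ih K hK).trans Finset.sdiff_subset

theorem PivotRun.cover {G : SimpleGraph V} {R : Finset V} {L : List (Finset V)}
    (h : PivotRun G R L) : ∀ v ∈ R, ∃ K ∈ L, v ∈ K := by
  induction h with
  | nil => simp
  | cons R u L hu _ ih =>
    intro v hv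
    by_cases hvu : v = u ∨ G.Adj u v
    · exact ⟨_, List.mem_cons_self, by simp [hv, hvu]⟩
    · obtain ⟨K, hK, hvK⟩ := ih v (by simp [hv, hvu])
      exact ⟨K, List.mem_cons_of_mem _ hK, hvK⟩

/-- Disagreement of `G` with the family `L` of clusters. -/
noncomputable def listDisagree (G : SimpleGraph V) (L : List (Finset V)) (a b : V) : ℕ :=
  if (G.Adj a b ↔ a ≠ b ∧ ∃ K ∈ L, a ∈ K ∧ b ∈ K) then 0 else 1

theorem listDisagree_le_one (G : SimpleGraph V) (L : List (Finset V)) (a b : V) :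
    listDisagree G L a b ≤ 1 := by
  unfold listDisagree; split_ifs <;> simp

/-- A pair that meets the new cluster disagrees only as a non-edge inside it or as an edge leaving
it; in both cases the pivot completes it to a bad triple. All other pairs keep their status. -/
theorem listDisagree_cons_le {G : SimpleGraph V} {R : Finset V} {u : V} {L : List (Finset V)}
    (hL : ∀ K ∈ L, K ⊆ R \ R.filter (fun v => v = u ∨ G.Adj u v)) {a b : V} (ha : a ∈ R)
    (hb : b ∈ R) :
    listDisagree G (R.filter (fun v => v = u ∨ G.Adj u v) :: L) a b ≤
      (if Bad G u a b then 1 else 0) +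
        if ¬ (a = u ∨ G.Adj u a) ∧ ¬ (b = u ∨ G.Adj u b) then listDisagree G L a b else 0 := by
  have hout : ∀ x, (x = u ∨ G.Adj u x) → ∀ K ∈ L, x ∉ K := by
    intro x hx K hK hxK
    have := hL K hK hxK
    simp only [Finset.mem_sdiff, Finset.mem_filter, not_and] at this
    exact this.2 this.1 hx
  by_cases h2 : Bad G u a b
  · rw [if_pos h2]
    exact (listDisagree_le_one _ _ _ _).trans (Nat.le_add_right _ _)
  rw [if_neg h2, zero_add]
  rw [bad_iff] at h2
  by_cases hA : a = u ∨ G.Adj u a <;> by_cases hB : b = u ∨ G.Adj u b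
  · refine (le_of_eq (if_pos ?_)).trans (Nat.zero_le _)
    have hsame : ∃ K ∈ R.filter (fun v => v = u ∨ G.Adj u v) :: L, a ∈ K ∧ b ∈ K :=
      ⟨_, List.mem_cons_self, by simp [ha, hA], by simp [hb, hB]⟩
    simp only [hsame, and_true]
    refine ⟨fun h => h.ne, fun hab => ?_⟩
    by_contra hnab
    refine h2 (Or.inl ?_)
    rcases hA with rfl | hA
    · rcases hB with rfl | hB
      · exact absurd rfl hab
      · exact absurd hB hnab
    · rcases hB with rfl | hB
      · exact absurd hA.symm hnab
      · exact ⟨hA, hB, hab, hnab⟩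
  · refine (le_of_eq (if_pos ?_)).trans (Nat.zero_le _)
    have hns : ¬ ∃ K ∈ R.filter (fun v => v = u ∨ G.Adj u v) :: L, a ∈ K ∧ b ∈ K := by
      rintro ⟨K, hK, h1, h2⟩
      rcases List.mem_cons.1 hK with rfl | hK
      · exact hB (Finset.mem_filter.1 h2).2
      · exact hout a hA K hK h1
    simp only [hns, and_false, iff_false]
    intro h1
    push Not at hB
    rcases hA with rfl | hA
    · exact absurd h1 hB.2
    · exact h2 (Or.inr (Or.inl ⟨hA, h1, hB.1.symm, hB.2⟩))
  · refine (le_of_eq (if_pos ?_)).trans (Nat.zero_le _)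
    have hns : ¬ ∃ K ∈ R.filter (fun v => v = u ∨ G.Adj u v) :: L, a ∈ K ∧ b ∈ K := by
      rintro ⟨K, hK, h1, h2⟩
      rcases List.mem_cons.1 hK with rfl | hK
      · exact hA (Finset.mem_filter.1 h1).2
      · exact hout b hB K hK h2
    simp only [hns, and_false, iff_false]
    intro h1
    push Not at hA
    rcases hB with rfl | hB
    · exact absurd h1.symm hA.2
    · exact h2 (Or.inr (Or.inr ⟨hB, h1, hA.1.symm, hA.2⟩))
  · rw [if_pos (c := ¬ (a = u ∨ G.Adj u a) ∧ ¬ (b = u ∨ G.Adj u b)) ⟨hA, hB⟩]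
    unfold listDisagree
    simp [hA, hB]

/-- Two of the three pairs of a bad triple are edges, so one of them contains the pivot. Hence the
opposite pair loses an endpoint, and its weight is never spent again. -/
theorem bad_weight_le {G : SimpleGraph V} (W : V → V → ℕ) {u a b : V} :
    (if Bad G u a b then W a b else 0) +
        (if ¬ (a = u ∨ G.Adj u a) ∧ ¬ (b = u ∨ G.Adj u b) then W a b else 0) ≤ W a b := by
  split_ifs with h1 h2 <;> try simp
  rw [bad_iff] at h1
  tauto

theorem sum_ite_sdiff {R : Finset V} (P : V → Prop) [DecidablePred P]
    [∀ a b, Decidable (¬ P a ∧ ¬ P b)] (f : V → V → ℕ) :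
    (∑ a ∈ R, ∑ b ∈ R, if ¬ P a ∧ ¬ P b then f a b else 0) =
      ∑ a ∈ R \ R.filter P, ∑ b ∈ R \ R.filter P, f a b := by
  have : R \ R.filter P = R.filter fun v => ¬ P v := by
    ext x; simp only [Finset.mem_sdiff, Finset.mem_filter]; tauto
  rw [this, Finset.sum_filter]
  refine Finset.sum_congr rfl fun a _ => ?_
  by_cases ha : P a
  · simp [ha]
  · simp only [ha, not_false_eq_true, true_and, if_true]
    rw [Finset.sum_filter]

/-- Induction over the run: a step creates at most `badCount` disagreements, and the weight
`badWeight` that pays for them disappears from the remaining pairs. -/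
theorem ChargedRun.disagree_le {G : SimpleGraph V} {W : V → V → ℕ} {T : ℕ} {R : Finset V}
    {L : List (Finset V)} (h : ChargedRun G W T R L) :
    (∑ a ∈ R, ∑ b ∈ R, listDisagree G L a b) * T ≤ 3 * ∑ a ∈ R, ∑ b ∈ R, W a b := by
  induction h with
  | nil => simp
  | cons R u L hu hT h ih =>
    have h1 : ∑ a ∈ R, ∑ b ∈ R, listDisagree G (R.filter (fun v => v = u ∨ G.Adj u v) :: L) a b ≤
        badCount G R u + ∑ a ∈ R \ R.filter (fun v => v = u ∨ G.Adj u v),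
          ∑ b ∈ R \ R.filter (fun v => v = u ∨ G.Adj u v), listDisagree G L a b := by
      rw [← sum_ite_sdiff, badCount, ← Finset.sum_add_distrib]
      refine Finset.sum_le_sum fun a ha => ?_
      rw [← Finset.sum_add_distrib]
      exact Finset.sum_le_sum fun b hb => listDisagree_cons_le h.pivotRun.subset ha hb
    have h2 : badWeight G W R u + ∑ a ∈ R \ R.filter (fun v => v = u ∨ G.Adj u v),
          ∑ b ∈ R \ R.filter (fun v => v = u ∨ G.Adj u v), W a b ≤ ∑ a ∈ R, ∑ b ∈ R, W a b := by
      rw [← sum_ite_sdiff, badWeight, ← Finset.sum_add_distrib]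
      refine Finset.sum_le_sum fun a ha => ?_
      rw [← Finset.sum_add_distrib]
      exact Finset.sum_le_sum fun b hb => bad_weight_le W
    nlinarith [Nat.mul_le_mul_right T h1]

theorem ChargedRun.cost_le [Fintype V] {G : SimpleGraph V} {W : V → V → ℕ} {T : ℕ}
    {L : List (Finset V)} (h : ChargedRun G W T Finset.univ L) {C : Setoid V}
    (hC : ∀ u v, C u v ↔ ∃ K ∈ L, u ∈ K ∧ v ∈ K) :
    2 * cost G C * T ≤ 3 * ∑ a : V, ∑ b : V, W a b := by
  have := h.disagree_le
  rw [two_mul_cost]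
  convert this using 4 with a _ b _
  unfold disagree listDisagree
  congr 1
  simp [clusterGraph, hC]

/-- Some node can be chosen as a pivot if the weights are feasible. -/
theorem exists_charged_pivot {G : SimpleGraph V} {W : V → V → ℕ} {T : ℕ} {R : Finset V}
    (hR : R.Nonempty)
    (hT : ∀ u v w, Bad G u v w → T ≤ W u v + W u w + W v w) :
    ∃ u ∈ R, badCount G R u * T ≤ 3 * badWeight G W R u := by
  -- Averaging over all candidates. By symmetry each of the three pairs of a triple contributes the
  -- same sum `S` over ordered triples, so the right side totals `3 * S`, the sum of the weights of
  -- all bad triples, each at least `T`.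
  apply Finset.exists_le_of_sum_le hR
  set S := ∑ u ∈ R, ∑ v ∈ R, ∑ w ∈ R, if Bad G u v w then W v w else 0 with hS
  have e1 : ∑ u ∈ R, ∑ v ∈ R, ∑ w ∈ R, (if Bad G u v w then W u w else 0) = S := by
    rw [hS, Finset.sum_comm]
    refine Finset.sum_congr rfl fun v _ => Finset.sum_congr rfl fun u _ =>
      Finset.sum_congr rfl fun w _ => ?_
    rw [Bad.rotate, Bad.swap]
  have e2 : ∑ u ∈ R, ∑ v ∈ R, ∑ w ∈ R, (if Bad G u v w then W u v else 0) = S := by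
    rw [← e1]
    refine Finset.sum_congr rfl fun u _ => ?_
    rw [Finset.sum_comm]
    refine Finset.sum_congr rfl fun v _ => Finset.sum_congr rfl fun w _ => ?_
    rw [Bad.swap]
  have e3 : ∑ u ∈ R, 3 * badWeight G W R u = S + S + S := by
    rw [← Finset.mul_sum]
    simp only [badWeight, ← hS]
    ring
  rw [e3]
  nth_rewrite 1 [← e2]
  nth_rewrite 1 [← e1]
  rw [hS, ← Finset.sum_add_distrib, ← Finset.sum_add_distrib]
  refine Finset.sum_le_sum fun u _ => ?_
  rw [badCount, Finset.sum_mul, ← Finset.sum_add_distrib, ← Finset.sum_add_distrib]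
  refine Finset.sum_le_sum fun v _ => ?_
  rw [Finset.sum_mul, ← Finset.sum_add_distrib, ← Finset.sum_add_distrib]
  refine Finset.sum_le_sum fun w _ => ?_
  split_ifs with h
  · simpa using hT u v w h
  · simp

theorem PivotRun.cost_eq_zero [Fintype V] {G : SimpleGraph V} {D : Setoid V} (hD : cost G D = 0)
    {L : List (Finset V)} (h : PivotRun G Finset.univ L) {C : Setoid V}
    (hC : ∀ u v, C u v ↔ ∃ K ∈ L, u ∈ K ∧ v ∈ K) : cost G C = 0 := by
  have h0 : ∀ u v, disagree G D u v = 0 := by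
    have := two_mul_cost G D
    rw [hD] at this
    intro u v
    have h1 := (Finset.sum_eq_zero_iff.1 this.symm) u (Finset.mem_univ _)
    exact (Finset.sum_eq_zero_iff.1 h1) v (Finset.mem_univ _)
  have hG : ∀ u v w, ¬ Bad G u v w := by
    intro u v w hb
    have := hb.hit D
    simp [h0] at this
  have := (h.chargedRun hG).cost_le hC
  simpa using this

end Pivot

end CCC

/-! ### Multiplicative weights for the covering problem of bad triples -/

namespace CCC

section Weights

open Classical

variable {V : Type*}

/-- The `+ 1` makes up for the rounded division, so that an integer weight grows at least by the
factor `1 + 1 / q`. -/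
def bump (q k : ℕ) : ℕ := k + (k / q + 1)

/-- Increase the weight of the pair `x`, `y`. -/
noncomputable def bumpPair (q : ℕ) (W : V → V → ℕ) (x y : V) (a b : V) : ℕ :=
  if (a = x ∧ b = y) ∨ (a = y ∧ b = x) then bump q (W a b) else W a b

theorem bump_ge {q : ℕ} (hq : 0 < q) (k : ℕ) : (k : ℝ) * (1 + 1 / q) ≤ bump q k := by
  have h : (k : ℝ) ≤ q * (k / q + 1 : ℕ) := by
    have := Nat.div_add_mod k q
    have h2 := Nat.mod_lt k hq
    exact_mod_cast (by nlinarith : k ≤ q * (k / q + 1))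
  have hq' : (0 : ℝ) < q := by exact_mod_cast hq
  have h3 : (k : ℝ) / q ≤ (k / q + 1 : ℕ) := by rw [div_le_iff₀ hq']; linarith
  unfold bump
  push_cast at h3 ⊢
  have : (k : ℝ) * (1 + 1 / q) = k + k / q := by ring
  linarith

theorem sum_pair_ite [Fintype V] {x y : V} (hxy : x ≠ y) (f : V → V → ℝ) :
    ∑ a : V, ∑ b : V, (if (a = x ∧ b = y) ∨ (a = y ∧ b = x) then f a b else 0) = f x y + f y x := by
  have h1 : ∀ a b : V, (if (a = x ∧ b = y) ∨ (a = y ∧ b = x) then f a b else 0) =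
      (if a = x then if b = y then f a b else 0 else 0) +
        (if a = y then if b = x then f a b else 0 else 0) := by
    intro a b
    by_cases h1 : a = x <;> by_cases h2 : b = y <;> by_cases h3 : a = y <;> by_cases h4 : b = x <;>
      simp_all
  simp only [h1, Finset.sum_add_distrib]
  congr 1
  · rw [Finset.sum_eq_single x (by intro b _ hb; simp [hb]) (by simp)]
    simp
  · rw [Finset.sum_eq_single y (by intro b _ hb; simp [hb]) (by simp)]
    simp

theorem bumpPair_comm {q : ℕ} {W : V → V → ℕ} (hW : ∀ a b, W a b = W b a) (x y a b : V) :
    bumpPair q W x y a b = bumpPair q W x y b a := by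
  unfold bumpPair
  rw [hW a b]
  congr 1
  ext; tauto

theorem le_bumpPair (q : ℕ) (W : V → V → ℕ) (x y a b : V) : W a b ≤ bumpPair q W x y a b := by
  unfold bumpPair bump
  split_ifs
  · exact Nat.le_add_right _ _
  · exact le_rfl

theorem sum_bumpPair [Fintype V] {q : ℕ} {W : V → V → ℕ} (hW : ∀ a b, W a b = W b a) {x y : V}
    (hxy : x ≠ y) : (∑ a : V, ∑ b : V, (bumpPair q W x y a b : ℝ)) =
      ∑ a : V, ∑ b : V, (W a b : ℝ) + 2 * (W x y / q + 1 : ℕ) := by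
  have h1 : ∀ a b, (bumpPair q W x y a b : ℝ) = W a b +
      if (a = x ∧ b = y) ∨ (a = y ∧ b = x) then ((W a b / q + 1 : ℕ) : ℝ) else 0 := by
    intro a b
    unfold bumpPair bump
    split_ifs <;> push_cast <;> ring
  simp only [h1, Finset.sum_add_distrib]
  rw [sum_pair_ite hxy (fun a b => ((W a b / q + 1 : ℕ) : ℝ)), hW y x]
  ring

/-- Logarithmic potential of the weights on the pairs that disagree with `D`. -/
noncomputable def potential [Fintype V] (G : SimpleGraph V) (D : Setoid V) (W : V → V → ℕ) : ℝ :=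
  ∑ a : V, ∑ b : V, disagree G D a b * Real.log (W a b)

theorem disagree_comm (G : SimpleGraph V) (D : Setoid V) (a b : V) :
    disagree G D a b = disagree G D b a := by
  simp [disagree, G.adj_comm a b, (clusterGraph D).adj_comm a b]

/-- The logarithm of a bumped weight gains at least `log (1 + 1 / q)`. The `2` stands for the two
orders of the pair, and only disagreements with `D` are counted. -/
theorem potential_bumpPair [Fintype V] (G : SimpleGraph V) (D : Setoid V) {q : ℕ} (hq : 0 < q)
    {W : V → V → ℕ} (h1 : ∀ a b, 1 ≤ W a b) {x y : V} (hxy : x ≠ y) :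
    potential G D W + 2 * disagree G D x y * Real.log (1 + 1 / q) ≤
      potential G D (bumpPair q W x y) := by
  have hpos : ∀ a b, (0 : ℝ) < W a b := fun a b => by exact_mod_cast h1 a b
  have hq' : (0 : ℝ) < q := by exact_mod_cast hq
  have h2 : ∀ a b, (disagree G D a b : ℝ) * Real.log (W a b) +
      (if (a = x ∧ b = y) ∨ (a = y ∧ b = x) then disagree G D a b * Real.log (1 + 1 / q) else 0) ≤
      disagree G D a b * Real.log (bumpPair q W x y a b) := by
    intro a b
    unfold bumpPair
    split_ifs with h
    · rw [← mul_add, ← Real.log_mul (hpos a b).ne' (by positivity)]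
      refine mul_le_mul_of_nonneg_left (Real.log_le_log (mul_pos (hpos a b) (by positivity)) ?_)
        (Nat.cast_nonneg _)
      exact bump_ge hq _
    · simp
  have h3 := Finset.sum_le_sum fun a (_ : a ∈ Finset.univ) =>
    Finset.sum_le_sum fun b (_ : b ∈ Finset.univ) => h2 a b
  simp only [Finset.sum_add_distrib] at h3
  rw [sum_pair_ite hxy (fun a b => (disagree G D a b : ℝ) * Real.log (1 + 1 / q)),
    disagree_comm G D y x] at h3
  unfold potential
  linarith

/-- The weights `W'` arise from `W` by increasing weights of bad triples of weight below `T`. -/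
structure Progress [Fintype V] (G : SimpleGraph V) (q T : ℕ) (W W' : V → V → ℕ) : Prop where
  symm : ∀ a b, W' a b = W' b a
  le : ∀ a b, W a b ≤ W' a b
  bound : ∀ a b, W' a b ≤ max (W a b) (2 * T)
  pot : ∀ D, (∑ a : V, ∑ b : V, (W' a b : ℝ) - ∑ a : V, ∑ b : V, (W a b : ℝ)) *
    Real.log (1 + 1 / q) ≤ (T / q + 3) * (potential G D W' - potential G D W)

theorem Progress.refl [Fintype V] (G : SimpleGraph V) (q T : ℕ) {W : V → V → ℕ}
    (hW : ∀ a b, W a b = W b a) : Progress G q T W W :=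
  ⟨hW, fun _ _ => le_rfl, fun _ _ => le_max_left _ _, by simp⟩

theorem Progress.trans [Fintype V] {G : SimpleGraph V} {q T : ℕ} {W W' W'' : V → V → ℕ}
    (h : Progress G q T W W') (h' : Progress G q T W' W'') : Progress G q T W W'' := by
  refine ⟨h'.symm, fun a b => (h.le a b).trans (h'.le a b), fun a b => ?_, fun D => ?_⟩
  · exact (h'.bound a b).trans (max_le (h.bound a b) (le_max_right _ _))
  · linarith [h.pot D, h'.pot D]

noncomputable def augment (q : ℕ) (W : V → V → ℕ) (u v w : V) : V → V → ℕ :=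
  bumpPair q (bumpPair q (bumpPair q W u v) u w) v w

theorem Bad.ne {G : SimpleGraph V} {u v w : V} (h : Bad G u v w) : u ≠ v ∧ u ≠ w ∧ v ≠ w := by
  rw [bad_iff] at h
  rcases h with ⟨a, b, c, _⟩ | ⟨a, b, c, _⟩ | ⟨a, b, c, _⟩
  · exact ⟨a.ne, b.ne, c⟩
  · exact ⟨a.ne, c, b.ne⟩
  · exact ⟨c, a.ne, b.ne⟩

/-- The three weights sum to less than `T` and each increment is rounded up by at most one, so the
total over ordered pairs grows by at most `2 * (T / q + 3)`. Every `D` disagrees with one of the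
three pairs, so its potential gains at least `2 * log (1 + 1 / q)`. Comparing the two gives the
field `pot`. Only weights below `T` are raised, hence not beyond `2 * T`. -/
theorem augment_progress [Fintype V] {G : SimpleGraph V} {q T : ℕ} (hq : 0 < q) {W : V → V → ℕ}
    (hW : ∀ a b, W a b = W b a) (h1 : ∀ a b, 1 ≤ W a b) {u v w : V} (hbad : Bad G u v w)
    (hT : W u v + W u w + W v w < T) : Progress G q T W (augment q W u v w) := by
  obtain ⟨huv, huw, hvw⟩ := hbad.ne
  set W1 := bumpPair q W u v with hW1
  set W2 := bumpPair q W1 u w with hW2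
  have s1 : ∀ a b, W1 a b = W1 b a := bumpPair_comm hW u v
  have s2 : ∀ a b, W2 a b = W2 b a := bumpPair_comm s1 u w
  have p1 : ∀ a b, 1 ≤ W1 a b := fun a b => (h1 a b).trans (le_bumpPair q W u v a b)
  have p2 : ∀ a b, 1 ≤ W2 a b := fun a b => (p1 a b).trans (le_bumpPair q W1 u w a b)
  have e1 : W1 u w = W u w := by
    rw [hW1, bumpPair, if_neg]; rintro (⟨_, h⟩ | ⟨h, _⟩)
    · exact hvw h.symm
    · exact huv h
  have e2 : W2 v w = W v w := by
    rw [hW2, bumpPair, if_neg, hW1, bumpPair, if_neg]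
    · rintro (⟨h, _⟩ | ⟨_, h⟩)
      · exact huv h.symm
      · exact huw h.symm
    · rintro (⟨h, _⟩ | ⟨h, _⟩)
      · exact huv h.symm
      · exact hvw h
  have hsum : ∑ a : V, ∑ b : V, (augment q W u v w a b : ℝ) = ∑ a : V, ∑ b : V, (W a b : ℝ) +
      2 * ((W u v / q + 1 : ℕ) + (W u w / q + 1 : ℕ) + (W v w / q + 1 : ℕ)) := by
    rw [augment, sum_bumpPair s2 hvw, sum_bumpPair s1 huw, sum_bumpPair hW huv, e2, e1]
    ring
  refine ⟨bumpPair_comm s2 v w, fun a b => ?_, fun a b => ?_, fun D => ?_⟩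
  · exact ((le_bumpPair q W u v a b).trans (le_bumpPair q W1 u w a b)).trans
      (le_bumpPair q W2 v w a b)
  · have hb : ∀ k, k < T → bump q k ≤ 2 * T := by
      intro k hk
      have := Nat.div_le_self k q
      unfold bump; omega
    have key : ∀ (X : V → V → ℕ) (x y : V), (∀ a b, X a b = X b a) → X x y < T →
        bumpPair q X x y a b ≤ max (X a b) (2 * T) := by
      intro X x y hX hxy
      unfold bumpPair
      split_ifs with h
      · refine le_max_of_le_right (hb _ ?_)
        rcases h with ⟨rfl, rfl⟩ | ⟨rfl, rfl⟩
        · exact hxy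
        · rwa [hX]
      · exact le_max_left _ _
    have k1 := key W u v hW (by omega)
    have k2 := key W1 u w s1 (by omega)
    have k3 := key W2 v w s2 (by omega)
    exact k3.trans (max_le (k2.trans (max_le k1 (le_max_right _ _))) (le_max_right _ _))
  · have f1 := potential_bumpPair G D hq h1 huv
    have f2 := potential_bumpPair G D hq p1 huw
    have f3 := potential_bumpPair G D hq p2 hvw
    have hq' : (0 : ℝ) < q := by exact_mod_cast hq
    have hl : 0 ≤ Real.log (1 + 1 / q) := Real.log_nonneg (by
      have : (0 : ℝ) ≤ 1 / q := by positivity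
      linarith)
    have hh : (1 : ℝ) ≤ disagree G D u v + disagree G D u w + disagree G D v w := by
      exact_mod_cast hbad.hit D
    have hpot : 2 * Real.log (1 + 1 / q) ≤ potential G D (augment q W u v w) - potential G D W := by
      have : augment q W u v w = bumpPair q W2 v w := rfl
      rw [this]
      nlinarith
    have hfl : (((W u v / q + 1 : ℕ) + (W u w / q + 1 : ℕ) + (W v w / q + 1 : ℕ) : ℝ)) ≤
        T / q + 3 := by
      have hd : ∀ k : ℕ, ((k / q : ℕ) : ℝ) ≤ (k : ℝ) / q := fun k => Nat.cast_div_le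
      have hT' : (W u v + W u w + W v w : ℝ) ≤ T := by exact_mod_cast hT.le
      have : (W u v : ℝ) / q + W u w / q + W v w / q ≤ T / q := by
        rw [← add_div, ← add_div]; exact div_le_div_of_nonneg_right hT' hq'.le
      push_cast
      linarith [hd (W u v), hd (W u w), hd (W v w)]
    rw [hsum]
    have hnn : (0 : ℝ) ≤ T / q + 3 := by positivity
    nlinarith [mul_le_mul_of_nonneg_right hfl hl, mul_le_mul_of_nonneg_left hpot hnn]

/-- One augmentation is enough in each phase. -/
theorem augment_ge {G : SimpleGraph V} {q T : ℕ} (hq : 0 < q) {W : V → V → ℕ} {u v w : V}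
    (hbad : Bad G u v w) (hT : T ≤ W u v + W u w + W v w) :
    T + T / q + 1 ≤ augment q W u v w u v + augment q W u v w u w + augment q W u v w v w := by
  obtain ⟨huv, huw, hvw⟩ := hbad.ne
  have e1 : augment q W u v w u v = bump q (W u v) := by
    simp [augment, bumpPair, huv, huw, hvw, Ne.symm huv]
  have e2 : augment q W u v w u w = bump q (W u w) := by
    simp [augment, bumpPair, huv, huw, Ne.symm hvw]
  have e3 : augment q W u v w v w = bump q (W v w) := by
    simp [augment, bumpPair, hvw, Ne.symm huv, Ne.symm huw]
  rw [e1, e2, e3]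
  unfold bump
  have h1 : T / q ≤ (W u v + W u w + W v w) / q := Nat.div_le_div_right hT
  -- Rounding three quotients instead of one loses at most `2`. The three `+ 1` of `bump` cover this
  -- and leave the `+ 1` of the new threshold.
  have h2 : (W u v + W u w + W v w) / q ≤ W u v / q + W u w / q + W v w / q + 2 := by
    rw [Nat.div_le_iff_le_mul_add_pred hq]
    have a1 := Nat.div_add_mod (W u v) q
    have a2 := Nat.div_add_mod (W u w) q
    have a3 := Nat.div_add_mod (W v w) q
    have b1 := Nat.mod_lt (W u v) hq
    have b2 := Nat.mod_lt (W u w) hq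
    have b3 := Nat.mod_lt (W v w) hq
    have : q * (W u v / q + W u w / q + W v w / q + 2) =
      q * (W u v / q) + q * (W u w / q) + q * (W v w / q) + 2 * q := by ring
    omega
  omega

/-- The approximation factor of the multiplicative weights method. -/
noncomputable def growth (q : ℕ) : ℝ := (1 + 2 / q) * (1 + 1 / q)

/-- The slack `1 + 1 / q` over `growth` makes `growth q / factor q = q / (q + 1)` smaller than one;
the logarithmic inequality at the end depends on this. -/
noncomputable def factor (q : ℕ) : ℝ := growth q * (1 + 1 / q)

/-- The weights `W` are symmetric and feasible for the threshold `T`. -/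
structure Feasible (G : SimpleGraph V) (W : V → V → ℕ) (T : ℕ) : Prop where
  symm : ∀ a b, W a b = W b a
  cover : ∀ u v w, Bad G u v w → T ≤ W u v + W u w + W v w

/-- Invariant between phases: current weights `W` with threshold `T`, best weights `B` with
threshold `Tb`. -/
structure PhaseInv {n : ℕ} (G : SimpleGraph (Fin n)) (q : ℕ) (W : Fin n → Fin n → ℕ) (T : ℕ)
    (B : Fin n → Fin n → ℕ) (Tb : ℕ) : Prop where
  feas : Feasible G W T
  feasB : Feasible G B Tb
  start : ∀ a b, 4 * q ^ 2 ≤ W a b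
  startT : 4 * q ^ 2 ≤ T
  top : ∀ a b, W a b ≤ 2 * T
  posB : 0 < Tb
  best : (∑ a, ∑ b, B a b) * T ≤ (∑ a, ∑ b, W a b) * Tb
  pot : ∀ D, 0 < cost G D →
    factor q * (2 * cost G D) * Tb < (∑ a, ∑ b, (B a b : ℝ)) →
    Real.log (∑ a, ∑ b, (W a b : ℝ)) ≤ Real.log (n ^ 2 * (4 * q ^ 2)) +
      growth q / (factor q * (2 * cost G D)) *
        (potential G D W - 2 * cost G D * Real.log (4 * q ^ 2))

/-! ### Analysis of the phases -/

theorem cast_two_mul_cost [Fintype V] (G : SimpleGraph V) (D : Setoid V) :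
    (2 * cost G D : ℝ) = ∑ a : V, ∑ b : V, (disagree G D a b : ℝ) := by
  exact_mod_cast two_mul_cost G D

theorem PhaseInv.init {n : ℕ} (G : SimpleGraph (Fin n)) {q : ℕ} (hq : 0 < q) :
    PhaseInv G q (fun _ _ => 4 * q ^ 2) (4 * q ^ 2) (fun _ _ => 4 * q ^ 2) (4 * q ^ 2) := by
  have hf : Feasible G (fun _ _ => 4 * q ^ 2) (4 * q ^ 2) :=
    ⟨fun _ _ => rfl, fun _ _ _ _ => by omega⟩
  refine ⟨hf, hf, fun _ _ => le_rfl, le_rfl, fun _ _ => by omega, by positivity, le_rfl, ?_⟩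
  intro D _ _
  have : potential G D (fun _ _ => 4 * q ^ 2) = 2 * cost G D * Real.log (4 * q ^ 2) := by
    rw [cast_two_mul_cost, Finset.sum_mul]
    refine Finset.sum_congr rfl fun a _ => ?_
    rw [Finset.sum_mul]
    push_cast
    rfl
  rw [this]
  simp [← mul_assoc, sq]

theorem growth_pos {q : ℕ} : 0 < growth q := by unfold growth; positivity

theorem factor_pos {q : ℕ} : 0 < factor q := by unfold factor growth; positivity

theorem one_le_factor {q : ℕ} : 1 ≤ factor q := by
  unfold factor growth
  have h1 : (0 : ℝ) ≤ 2 / q := by positivity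
  have h2 : (0 : ℝ) ≤ 1 / q := by positivity
  nlinarith [mul_nonneg h1 h2, mul_nonneg h2 h2, mul_nonneg (mul_nonneg h1 h2) h2]

theorem inv_log_le {q : ℕ} (hq : 0 < q) :
    (1 : ℝ) ≤ Real.log (1 + 1 / q) * (q * (1 + 1 / q)) := by
  have hq' : (0 : ℝ) < q := by exact_mod_cast hq
  have h := Real.one_sub_inv_le_log_of_pos (x := 1 + 1 / (q : ℝ)) (by positivity)
  have h2 : (1 - (1 + 1 / (q : ℝ))⁻¹) * (q * (1 + 1 / q)) = 1 := by
    field_simp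
    ring
  exact h2.ge.trans (mul_le_mul_of_nonneg_right h (by positivity))

/-- The left side is at most `T / q + T / q ^ 2 + 1 / q + 3`. The start value `4 * q ^ 2` is chosen
so that `1 / q + 3 ≤ T / q ^ 2`, which leaves `T / q * (1 + 2 / q)`. The remaining factor comes from
`log (1 + 1 / q) ≥ 1 / (q + 1)`. -/
theorem rate_le {q T : ℕ} (hq : 0 < q) (hT : 4 * q ^ 2 ≤ T) :
    (((T + T / q + 1 : ℕ) : ℝ) / q + 3) ≤ growth q * T * Real.log (1 + 1 / q) := by
  have hq' : (0 : ℝ) < q := by exact_mod_cast hq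
  have hq1 : (1 : ℝ) ≤ q := by exact_mod_cast hq
  have hT' : (4 : ℝ) * q ^ 2 ≤ T := by exact_mod_cast hT
  have hd : ((T / q : ℕ) : ℝ) ≤ (T : ℝ) / q := Nat.cast_div_le
  have h1 : (((T + T / q + 1 : ℕ) : ℝ) / q + 3) ≤ T / q * (1 + 2 / q) := by
    push_cast
    have h2 : ((T : ℝ) + (T / q : ℕ) + 1) / q ≤ (T + T / q + 1) / q :=
      div_le_div_of_nonneg_right (by linarith) hq'.le
    refine (add_le_add_left h2 3).trans ?_
    have h4 : (1 : ℝ) / q ≤ 1 := by rw [div_le_one hq']; exact hq1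
    have h5 : (4 : ℝ) ≤ T / q / q := by
      rw [le_div_iff₀ hq', le_div_iff₀ hq']; nlinarith
    have h6 : ((T : ℝ) + T / q + 1) / q = T / q + T / q / q + 1 / q := by ring
    have h7 : (T : ℝ) / q * (1 + 2 / q) = T / q + 2 * (T / q / q) := by ring
    rw [h6, h7]; linarith
  refine h1.trans ?_
  have h3 := inv_log_le hq
  have h8 : (0 : ℝ) ≤ T / q * (1 + 2 / q) := by positivity
  calc (T : ℝ) / q * (1 + 2 / q) ≤ T / q * (1 + 2 / q) *
        (Real.log (1 + 1 / q) * (q * (1 + 1 / q))) := le_mul_of_one_le_right h8 h3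
    _ = growth q * T * Real.log (1 + 1 / q) := by
      unfold growth; field_simp

/-- If the best weights miss the factor, so do the current ones: their total exceeds `factor q * (2
* cost G D) * T`. The total grows by at most `growth q * T` times the gain `Δ` in potential. In the
relative growth `T` cancels and `κ * Δ` remains; `1 + x ≤ exp x` turns this into the additive bound
on logarithms. -/
theorem PhaseInv.next {n : ℕ} {G : SimpleGraph (Fin n)} {q : ℕ} (hq : 0 < q)
    {W W' B B' : Fin n → Fin n → ℕ} {T Tb Tb' : ℕ} (h : PhaseInv G q W T B Tb)
    (hp : Progress G q (T + T / q + 1) W W')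
    (hc : ∀ u v w, Bad G u v w → T + T / q + 1 ≤ W' u v + W' u w + W' v w)
    (hB : (∑ a, ∑ b, W' a b) * Tb < (∑ a, ∑ b, B a b) * (T + T / q + 1) ∧ B' = W' ∧
        Tb' = T + T / q + 1 ∨
      (∑ a, ∑ b, B a b) * (T + T / q + 1) ≤ (∑ a, ∑ b, W' a b) * Tb ∧ B' = B ∧ Tb' = Tb) :
    PhaseInv G q W' (T + T / q + 1) B' Tb' := by
  have hf : Feasible G W' (T + T / q + 1) := ⟨hp.symm, hc⟩
  have hTpos : 0 < T := lt_of_lt_of_le (by positivity) h.startT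
  have hTT : T < T + T / q + 1 := Nat.lt_succ_of_le (Nat.le_add_right _ _)
  have hbetter : (∑ a, ∑ b, B' a b) * Tb ≤ (∑ a, ∑ b, B a b) * Tb' := by
    rcases hB with ⟨h1, rfl, rfl⟩ | ⟨_, rfl, rfl⟩
    · exact h1.le
    · exact le_rfl
  refine ⟨hf, ?_, fun a b => (h.start a b).trans (hp.le a b), h.startT.trans hTT.le,
    fun a b => (hp.bound a b).trans ?_, ?_, ?_, ?_⟩
  · rcases hB with ⟨_, rfl, rfl⟩ | ⟨_, rfl, rfl⟩
    · exact hf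
    · exact h.feasB
  · exact max_le ((h.top a b).trans (Nat.mul_le_mul_left 2 hTT.le)) le_rfl
  · rcases hB with ⟨_, _, rfl⟩ | ⟨_, _, rfl⟩
    · exact hTpos.trans hTT
    · exact h.posB
  · rcases hB with ⟨_, rfl, rfl⟩ | ⟨h1, rfl, rfl⟩
    · exact le_rfl
    · exact h1
  · intro D hD hbig
    have hposB' : 0 < Tb' := by
      rcases hB with ⟨_, _, rfl⟩ | ⟨_, _, rfl⟩
      · exact hTpos.trans hTT
      · exact h.posB
    have hb1 : (∑ a, ∑ b, (B' a b : ℝ)) * Tb ≤ (∑ a, ∑ b, (B a b : ℝ)) * Tb' := by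
      exact_mod_cast hbetter
    have hb2 : (∑ a, ∑ b, (B a b : ℝ)) * T ≤ (∑ a, ∑ b, (W a b : ℝ)) * Tb := by
      exact_mod_cast h.best
    have r1 : (0 : ℝ) < Tb' := by exact_mod_cast hposB'
    have r2 : (0 : ℝ) < Tb := by exact_mod_cast h.posB
    have r3 : (0 : ℝ) < T := by exact_mod_cast hTpos
    have hz : (0 : ℝ) < cost G D := by exact_mod_cast hD
    -- The best ratio never deteriorates, so a bad ratio after the phase was bad before it.
    have hold : factor q * (2 * cost G D) * Tb < ∑ a, ∑ b, (B a b : ℝ) := by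
      by_contra! hcon
      have := mul_le_mul_of_nonneg_right hcon r1.le
      have := mul_lt_mul_of_pos_right hbig r2
      nlinarith
    have hbigW : factor q * (2 * cost G D) * T < ∑ a, ∑ b, (W a b : ℝ) := by
      by_contra! hcon
      have := mul_le_mul_of_nonneg_right hcon r2.le
      have := mul_lt_mul_of_pos_right hold r3
      nlinarith
    have hz2 : 0 < factor q * (2 * cost G D) := mul_pos factor_pos (by positivity)
    have hWpos : 0 < ∑ a, ∑ b, (W a b : ℝ) := lt_trans (mul_pos hz2 r3) hbigW
    have hWW : ∑ a, ∑ b, (W a b : ℝ) ≤ ∑ a, ∑ b, (W' a b : ℝ) :=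
      Finset.sum_le_sum fun a _ => Finset.sum_le_sum fun b _ => by exact_mod_cast hp.le a b
    have hlog : 0 < Real.log (1 + 1 / q) := Real.log_pos (by
      have : (0 : ℝ) < 1 / q := by positivity
      linarith)
    have hpot := hp.pot D
    set Δ := potential G D W' - potential G D W with hΔ
    have hΔ0 : 0 ≤ Δ := by
      have h3 : (0 : ℝ) < ((T + T / q + 1 : ℕ) : ℝ) / q + 3 := by positivity
      have : 0 ≤ (((T + T / q + 1 : ℕ) : ℝ) / q + 3) * Δ :=
        le_trans (mul_nonneg (by linarith) hlog.le) hpot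
      exact nonneg_of_mul_nonneg_right this h3
    have hinc : ∑ a, ∑ b, (W' a b : ℝ) - ∑ a, ∑ b, (W a b : ℝ) ≤ growth q * T * Δ := by
      have h4 := mul_le_mul_of_nonneg_right (rate_le hq h.startT) hΔ0
      have h5 := hpot.trans h4
      have h6 : growth q * T * Real.log (1 + 1 / q) * Δ =
        growth q * T * Δ * Real.log (1 + 1 / q) := by ring
      rw [h6] at h5
      exact le_of_mul_le_mul_right h5 hlog
    set κ := growth q / (factor q * (2 * cost G D)) with hκ
    have hκ0 : 0 ≤ κ := div_nonneg growth_pos.le hz2.le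
    have hinc2 : growth q * T * Δ ≤ (∑ a, ∑ b, (W a b : ℝ)) * (κ * Δ) := by
      have : growth q * T = κ * (factor q * (2 * cost G D) * T) := by
        have := (factor_pos (q := q)).ne'
        rw [hκ]; field_simp
      rw [this]
      have := mul_le_mul_of_nonneg_right hbigW.le (mul_nonneg hκ0 hΔ0)
      linarith
    have hfin : ∑ a, ∑ b, (W' a b : ℝ) ≤ (∑ a, ∑ b, (W a b : ℝ)) * Real.exp (κ * Δ) := by
      have := Real.add_one_le_exp (κ * Δ)
      nlinarith
    have hl := Real.log_le_log (lt_of_lt_of_le hWpos hWW) hfin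
    rw [Real.log_mul hWpos.ne' (Real.exp_pos _).ne', Real.log_exp] at hl
    have h7 := h.pot D hD hold
    have h8 : κ * (potential G D W' - 2 * cost G D * Real.log (4 * q ^ 2)) =
      κ * (potential G D W - 2 * cost G D * Real.log (4 * q ^ 2)) + κ * Δ := by
      rw [hΔ]; ring
    rw [h8]
    linarith

/-- After enough phases the best weights are nearly optimal. -/
theorem PhaseInv.near_optimal {n : ℕ} {G : SimpleGraph (Fin n)} {q : ℕ} (hq : 0 < q)
    {W B : Fin n → Fin n → ℕ} {T Tb : ℕ} (h : PhaseInv G q W T B Tb)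
    (hT : 4 * q ^ 2 * (n + 2) ^ (3 * (q + 1)) ≤ T) {D : Setoid (Fin n)} (hD : 0 < cost G D) :
    (∑ a, ∑ b, (B a b : ℝ)) ≤ factor q * (2 * cost G D) * Tb := by
  -- Put `x = log (T / S)` with `S = 4 * q ^ 2`. The total weight is at least `T`, and weights are
  -- at most `2 * T`, so the invariant gives `x ≤ 2 * log (n + 2) + q / (q + 1) * (log 2 + x)`. As
  -- the coefficient of `x` is below one, `x < 3 * (q + 1) * log (n + 2)`, contrary to the size of
  -- `T`.
  by_contra! hcon
  have hp := h.pot D hD hcon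
  have hq' : (0 : ℝ) < q := by exact_mod_cast hq
  have hz : (1 : ℝ) ≤ cost G D := by exact_mod_cast hD
  have hTpos : 0 < T := lt_of_lt_of_le (by positivity) h.startT
  have r2 : (0 : ℝ) < Tb := by exact_mod_cast h.posB
  have r3 : (0 : ℝ) < T := by exact_mod_cast hTpos
  have hb2 : (∑ a, ∑ b, (B a b : ℝ)) * T ≤ (∑ a, ∑ b, (W a b : ℝ)) * Tb := by
    exact_mod_cast h.best
  have hbigW : factor q * (2 * cost G D) * T < ∑ a, ∑ b, (W a b : ℝ) := by
    by_contra! hcon2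
    have := mul_le_mul_of_nonneg_right hcon2 r2.le
    have := mul_lt_mul_of_pos_right hcon r3
    nlinarith
  have hbig : (T : ℝ) ≤ ∑ a, ∑ b, (W a b : ℝ) := by
    have := one_le_factor (q := q)
    have : 1 ≤ factor q * (2 * cost G D) := by nlinarith
    nlinarith
  have hl1 := Real.log_le_log r3 hbig
  set S : ℝ := 4 * q ^ 2 with hS
  have hS1 : 1 ≤ S := by
    have : (1 : ℝ) ≤ q := by exact_mod_cast hq
    rw [hS]; nlinarith
  have hS0 : 0 < S := by linarith
  have hl2 : potential G D W ≤ 2 * cost G D * Real.log (2 * T) := by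
    rw [cast_two_mul_cost, Finset.sum_mul]
    refine Finset.sum_le_sum fun a _ => ?_
    rw [Finset.sum_mul]
    refine Finset.sum_le_sum fun b _ => mul_le_mul_of_nonneg_left (Real.log_le_log ?_ ?_)
      (Nat.cast_nonneg _)
    · exact_mod_cast lt_of_lt_of_le (by positivity) (h.start a b)
    · exact_mod_cast h.top a b
  have hg : growth q / (factor q * (2 * cost G D)) * (potential G D W - 2 * cost G D * Real.log S) ≤
      q / (q + 1) * (Real.log (2 * T) - Real.log S) := by
    have e : growth q / (factor q * (2 * cost G D)) = q / (q + 1) * (1 / (2 * cost G D)) := by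
      unfold factor
      have := (growth_pos (q := q)).ne'
      field_simp
    rw [e, mul_assoc]
    refine mul_le_mul_of_nonneg_left ?_ (by positivity)
    rw [one_div, inv_mul_le_iff₀ (by positivity)]
    linarith
  have hn : Real.log (n ^ 2 * S) ≤ 2 * Real.log (n + 2) + Real.log S := by
    rcases Nat.eq_zero_or_pos n with rfl | hn
    · have h1 : (0 : ℝ) ≤ Real.log 2 := Real.log_nonneg (by norm_num)
      have h2 := Real.log_nonneg hS1
      simp; linarith
    · have hn' : (0 : ℝ) < n := by exact_mod_cast hn
      rw [Real.log_mul (by positivity) hS0.ne', Real.log_pow]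
      have := Real.log_le_log hn' (by linarith : (n : ℝ) ≤ n + 2)
      push_cast
      linarith
  have hT' : S * (n + 2) ^ (3 * (q + 1)) ≤ (T : ℝ) := by rw [hS]; exact_mod_cast hT
  have hl3 := Real.log_le_log (by positivity) hT'
  rw [Real.log_mul hS0.ne' (by positivity), Real.log_pow] at hl3
  have hl4 : Real.log (2 * T) = Real.log 2 + Real.log T := Real.log_mul (by norm_num) r3.ne'
  have hl7 : Real.log 2 ≤ Real.log (n + 2) := Real.log_le_log (by norm_num) (by
      have : (0 : ℝ) ≤ n := Nat.cast_nonneg n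
      linarith)
  rw [hl4] at hg
  set x := Real.log T - Real.log S with hx
  have hx1 : x ≤ 2 * Real.log (n + 2) + q / (q + 1) * (Real.log 2 + x) := by
    have : Real.log 2 + Real.log T - Real.log S = Real.log 2 + x := by rw [hx]; ring
    rw [this] at hg
    linarith
  have hx2 : x = q / (q + 1) * x + 1 / (q + 1) * x := by field_simp
  have hx3 : (q : ℝ) / (q + 1) * Real.log 2 < Real.log 2 := by
    have : (q : ℝ) / (q + 1) < 1 := by rw [div_lt_one (by positivity)]; linarith
    have h2 : 0 < Real.log 2 := Real.log_pos (by norm_num)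
    nlinarith
  have hx4 : 1 / ((q : ℝ) + 1) * x < 3 * Real.log (n + 2) := by
    have : (q : ℝ) / (q + 1) * (Real.log 2 + x) = q / (q + 1) * Real.log 2 + q / (q + 1) * x := by
      ring
    linarith
  have hx5 : x < 3 * (q + 1) * Real.log (n + 2) := by
    rw [one_div, inv_mul_lt_iff₀ (by positivity)] at hx4
    linarith
  push_cast at hl3
  linarith

end Weights

end CCC

/-! ### Approximation guarantee of the transformation -/

namespace CCC

section Approx

open Classical

variable {V : Type*} (I : Inst V)

theorem Inst.Hostile.symm {I : Inst V} {U W : I.SN} (h : I.Hostile U W) : I.Hostile W U := by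
  obtain ⟨u, w, h1, h2, h3⟩ := h
  exact ⟨w, u, h2, h1, h3.symm⟩

theorem Inst.IsValid.of_s_eq {I : Inst V} {D : Setoid V} (hD : I.IsValid D) {u v : V}
    (h : I.s u = I.s v) : D u v := by
  obtain ⟨p⟩ := SimpleGraph.ConnectedComponent.exact h
  induction p with
  | nil => exact D.refl _
  | cons hadj _ ih =>
    exact D.trans (hD.1 _ _ hadj) (ih ((SimpleGraph.ConnectedComponent.sound hadj.reachable).symm.trans h))

theorem Inst.IsValid.not_of_hostile {I : Inst V} {D : Setoid V} (hD : I.IsValid D) {u v : V}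
    (h : I.Hostile (I.s u) (I.s v)) : ¬ D u v := by
  obtain ⟨a, b, h1, h2, h3⟩ := h
  intro huv
  exact hD.2 a b h3 (D.trans (hD.of_s_eq h1) (D.trans huv (D.symm (hD.of_s_eq h2))))

theorem Inst.not_valid_of_hostile_self {I : Inst V} (h : ∃ U, I.Hostile U U) :
    ¬ ∃ D, I.IsValid D := by
  rintro ⟨D, hD⟩
  obtain ⟨U, a, b, h1, h2, h3⟩ := h
  exact hD.2 a b h3 (hD.of_s_eq (h1.trans h2.symm))

theorem Inst.E₂_adj {I : Inst V} (hself : ¬ ∃ U, I.Hostile U U) {u v : V} :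
    I.E₂.Adj u v ↔ u ≠ v ∧ (I.s u = I.s v ∨ (I.E.Adj u v ∧ ¬ I.Hostile (I.s u) (I.s v))) := by
  have hsym : I.Hostile (I.s v) (I.s u) ↔ I.Hostile (I.s u) (I.s v) := ⟨.symm, .symm⟩
  simp only [Inst.E₂, Inst.E₁, SimpleGraph.sdiff_adj, SimpleGraph.sup_adj,
    SimpleGraph.fromRel_adj, hsym, or_self, eq_comm (a := I.s v) (b := I.s u)]
  by_cases huv : u = v
  · subst huv; simp
  · by_cases hs : I.s u = I.s v
    · have : ¬ I.Hostile (I.s u) (I.s v) := by rw [hs]; exact fun h => hself ⟨_, h⟩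
      simp [huv, hs] at this ⊢
      exact this
    · simp [huv, hs]

theorem Inst.between_comm (A : SimpleGraph V) (U W : I.SN) :
    I.between A U W = I.between A W U := by
  unfold Inst.between
  congr 1
  ext e
  constructor
  · rintro ⟨h, u, w, hu, hw, rfl⟩; exact ⟨h, w, u, hw, hu, Sym2.eq_swap⟩
  · rintro ⟨h, u, w, hu, hw, rfl⟩; exact ⟨h, w, u, hw, hu, Sym2.eq_swap⟩

/-- The rounding test for the supernodes of `u` and `v`. -/
def Inst.Dense (A : SimpleGraph V) (u v : V) : Prop :=
  (3 - √5) / 2 * (I.s u).supp.ncard * (I.s v).supp.ncard < (I.between A (I.s u) (I.s v) : ℝ)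

theorem Inst.Dense.symm {I : Inst V} {A : SimpleGraph V} {u v : V} (h : I.Dense A u v) :
    I.Dense A v u := by
  unfold Inst.Dense at *
  rw [I.between_comm]
  linarith

theorem Inst.round_adj {I : Inst V} {A : SimpleGraph V} {u v : V} :
    (I.round A).Adj u v ↔ (I.s u = I.s v ∧ A.Adj u v) ∨ (I.s u ≠ I.s v ∧ I.Dense A u v) := by
  simp only [Inst.round, SimpleGraph.fromRel_adj]
  constructor
  · rintro ⟨_, (h | h) | (h | h)⟩
    · exact Or.inl h
    · exact Or.inr h
    · exact Or.inl ⟨h.1.symm, h.2.symm⟩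
    · exact Or.inr ⟨Ne.symm h.1, Inst.Dense.symm h.2⟩
  · rintro (h | h)
    · exact ⟨h.2.ne, Or.inl (Or.inl h)⟩
    · exact ⟨fun e => h.1 (by rw [e]), Or.inl (Or.inr h)⟩

theorem Inst.DropStep.le {I : Inst V} {A B : SimpleGraph V} (h : I.DropStep A B) : B ≤ A := by
  obtain ⟨u₁, u₂, u₃, u₃', _, _, _, _, _, _, _, rfl⟩ := h
  exact SimpleGraph.deleteEdges_le _

theorem Inst.DropStep.adj_of_s_eq {I : Inst V} {A B : SimpleGraph V} (h : I.DropStep A B) {u v : V}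
    (hs : I.s u = I.s v) (hA : A.Adj u v) : B.Adj u v := by
  obtain ⟨u₁, u₂, u₃, u₃', h0, h1, h2, h3, _, _, _, rfl⟩ := h
  rw [SimpleGraph.deleteEdges_adj]
  refine ⟨hA, ?_⟩
  rw [Set.mem_insert_iff, Set.mem_singleton_iff, not_or]
  constructor
  · intro he
    rcases Sym2.eq_iff.1 he with ⟨rfl, rfl⟩ | ⟨rfl, rfl⟩
    · exact h2 hs
    · exact h2 hs.symm
  · intro he
    rcases Sym2.eq_iff.1 he with ⟨rfl, rfl⟩ | ⟨rfl, rfl⟩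
    · exact h3 (hs.trans h0)
    · exact h3 (hs.symm.trans h0)

theorem Inst.IsDropResult.le {I : Inst V} {A : SimpleGraph V} (h : I.IsDropResult A) :
    A ≤ I.E₂ := by
  have := h.1
  clear h
  induction this with
  | refl => exact le_rfl
  | tail _ h ih => exact h.le.trans ih

theorem Inst.IsDropResult.adj_of_s_eq {I : Inst V} {A : SimpleGraph V} (h : I.IsDropResult A)
    (hself : ¬ ∃ U, I.Hostile U U) {u v : V} (hs : I.s u = I.s v) (huv : u ≠ v) : A.Adj u v := by
  have := h.1
  clear h
  induction this with
  | refl => rw [I.E₂_adj hself]; exact ⟨huv, Or.inl hs⟩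
  | tail _ h ih => exact h.adj_of_s_eq hs ih

/-- The threshold is nonnegative and the test is strict, so rounding never links supernodes between
which `A` has no edge. -/
theorem Inst.exists_adj_of_dense {I : Inst V} {A : SimpleGraph V} {u v : V} (h : I.Dense A u v) :
    ∃ a b, I.s a = I.s u ∧ I.s b = I.s v ∧ A.Adj a b := by
  have hpos : 0 < I.between A (I.s u) (I.s v) := by
    have h5 : √5 < 3 := by rw [Real.sqrt_lt' (by norm_num)]; norm_num
    have : (0 : ℝ) ≤ (3 - √5) / 2 * (I.s u).supp.ncard * (I.s v).supp.ncard :=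
      mul_nonneg (mul_nonneg (by linarith) (Nat.cast_nonneg _)) (Nat.cast_nonneg _)
    exact_mod_cast this.trans_lt h
  obtain ⟨e, he, a, b, ha, hb, rfl⟩ := Set.nonempty_of_ncard_ne_zero hpos.ne'
  exact ⟨a, b, ha, hb, he⟩

/-- There are no edges of the transformed graph between hostile supernodes. -/
theorem Inst.IsDropResult.not_adj_of_hostile {I : Inst V} {A : SimpleGraph V}
    (h : I.IsDropResult A) (hself : ¬ ∃ U, I.Hostile U U) {u v : V}
    (hh : I.Hostile (I.s u) (I.s v)) : ¬ (I.round A).Adj u v := by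
  rw [Inst.round_adj]
  rintro (⟨hs, _⟩ | ⟨hs, hd⟩)
  · rw [hs] at hh; exact hself ⟨_, hh⟩
  · obtain ⟨a, b, ha, hb, hab⟩ := Inst.exists_adj_of_dense hd
    have := ((I.E₂_adj hself).1 (h.le hab)).2
    rw [ha, hb] at this
    tauto

/-- Hostile supernodes have no common neighbours in the transformed graph. -/
theorem Inst.IsDropResult.not_common {I : Inst V} {A : SimpleGraph V}
    (h : I.IsDropResult A) (hself : ¬ ∃ U, I.Hostile U U) {u v x : V}
    (hh : I.Hostile (I.s u) (I.s v)) (hu : (I.round A).Adj u x) (hv : (I.round A).Adj v x) :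
    False := by
  have huv : I.s u ≠ I.s v := fun e => hself ⟨_, by rw [← e] at hh; exact hh⟩
  by_cases h1 : I.s u = I.s x
  · exact h.not_adj_of_hostile hself (u := x) (v := v) (by rwa [← h1]) hv.symm
  by_cases h2 : I.s v = I.s x
  · exact h.not_adj_of_hostile hself (u := u) (v := x) (by rwa [← h2]) hu
  rw [Inst.round_adj] at hu hv
  have hu' : I.Dense A u x := by tauto
  have hv' : I.Dense A v x := by tauto
  obtain ⟨a, b, ha, hb, hab⟩ := Inst.exists_adj_of_dense hu'
  obtain ⟨c, d, hc, hd, hcd⟩ := Inst.exists_adj_of_dense hv'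
  -- The two edges found would allow one more iteration of the dropping loop.
  refine h.2 _ ⟨a, c, b, d, hd.trans hb.symm, ?_, ?_, ?_, ?_, hab, hcd, rfl⟩
  · rwa [ha, hc]
  · rwa [ha, hb]
  · rwa [hc, hb]
  · rwa [ha, hc]

theorem PivotRun.closed_nbhd {G : SimpleGraph V} {R : Finset V} {L : List (Finset V)}
    (h : PivotRun G R L) : ∀ K ∈ L, ∃ p, ∀ x ∈ K, x = p ∨ G.Adj p x := by
  induction h with
  | nil => simp
  | cons R u L hu _ ih =>
    intro K hK
    rcases List.mem_cons.1 hK with rfl | hK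
    · exact ⟨u, fun x hx => (Finset.mem_filter.1 hx).2⟩
    · exact ih K hK

/-- A pivot sees a node only through its closed neighbourhood. In a transformed graph the nodes of
one supernode are twins, so they stay together. -/
theorem PivotRun.mem_iff_of_twins {G : SimpleGraph V} {R : Finset V} {L : List (Finset V)}
    (h : PivotRun G R L) {u v : V} (htw : ∀ x, (u = x ∨ G.Adj x u) ↔ (v = x ∨ G.Adj x v))
    (hR : u ∈ R ↔ v ∈ R) : ∀ K ∈ L, (u ∈ K ↔ v ∈ K) := by
  induction h with
  | nil => simp
  | cons R p L hu _ ih =>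
    intro K hK
    rcases List.mem_cons.1 hK with rfl | hK
    · simp only [Finset.mem_filter, hR, htw]
    · exact ih (by simp only [Finset.mem_sdiff, Finset.mem_filter, hR, htw]) K hK

/-- PIVOT clusterings of a transformed graph are valid. -/
theorem Inst.IsDropResult.isValid [Fintype V] {I : Inst V} {A : SimpleGraph V}
    (h : I.IsDropResult A) (hself : ¬ ∃ U, I.Hostile U U) {C : Setoid V}
    (hC : IsPivotClustering (I.round A) C) : I.IsValid C := by
  obtain ⟨L, hL, hCL⟩ := hC
  constructor
  · intro u v huv
    have hs : I.s u = I.s v := SimpleGraph.ConnectedComponent.sound huv.reachable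
    obtain ⟨K, hK, huK⟩ := hL.cover u (Finset.mem_univ _)
    refine (hCL u v).2 ⟨K, hK, huK, (hL.mem_iff_of_twins ?_ (by simp) K hK).1 huK⟩
    have key : ∀ {u v : V}, I.s u = I.s v → ∀ x, (u = x ∨ (I.round A).Adj x u) →
        (v = x ∨ (I.round A).Adj x v) := by
      intro u v hs x hx
      by_cases hvx : v = x
      · exact Or.inl hvx
      right
      rw [Inst.round_adj]
      by_cases hxv : I.s x = I.s v
      · exact Or.inl ⟨hxv, h.adj_of_s_eq hself hxv (Ne.symm hvx)⟩
      · refine Or.inr ⟨hxv, ?_⟩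
        rcases hx with rfl | hx
        · exact absurd hs hxv
        · rw [Inst.round_adj] at hx
          rcases hx with hx | hx
          · exact absurd (hx.1.trans hs) hxv
          · have := hx.2
            unfold Inst.Dense at this ⊢
            rwa [← hs]
    exact fun x => ⟨key hs x, key hs.symm x⟩
  · intro u v huv hCuv
    obtain ⟨K, hK, hu, hv⟩ := (hCL u v).1 hCuv
    obtain ⟨p, hp⟩ := hL.closed_nbhd K hK
    have hh : I.Hostile (I.s u) (I.s v) := ⟨u, v, rfl, rfl, huv⟩
    rcases hp u hu with rfl | hpu
    · rcases hp v hv with rfl | hpv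
      · exact huv.ne rfl
      · exact h.not_adj_of_hostile hself hh hpv
    · rcases hp v hv with rfl | hpv
      · exact h.not_adj_of_hostile hself hh hpu.symm
      · exact h.not_common hself hh hpu.symm hpv.symm

/-! ### Distance between the preferences and the transformed graph -/

section Distance

/-- Sign of a pair: `1` if it is separated by `D`, `-1` otherwise. -/
noncomputable def sepSign (D : Setoid V) (u v : V) : ℝ := if D u v then -1 else 1

theorem sepSign_comm (D : Setoid V) (u v : V) : sepSign D u v = sepSign D v u := by
  unfold sepSign
  congr 1
  exact propext ⟨D.symm, D.symm⟩

variable [Fintype V]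

/-- Since `U ≠ W`, an edge between them has exactly one orientation from `U` to `W`. -/
theorem Inst.between_eq_sum {I : Inst V} {A : SimpleGraph V} {U W : I.SN} (hUW : U ≠ W) :
    I.between A U W = ∑ p : V × V, if (I.s p.1 = U ∧ I.s p.2 = W) ∧ A.Adj p.1 p.2 then 1 else 0 := by
  have : {e | e ∈ A.edgeSet ∧ ∃ u w, I.s u = U ∧ I.s w = W ∧ e = s(u, w)} =
      (fun p : V × V => s(p.1, p.2)) ''
        {p : V × V | (I.s p.1 = U ∧ I.s p.2 = W) ∧ A.Adj p.1 p.2} := by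
    ext e
    constructor
    · rintro ⟨h, u, w, hu, hw, rfl⟩; exact ⟨(u, w), ⟨⟨hu, hw⟩, h⟩, rfl⟩
    · rintro ⟨⟨u, w⟩, ⟨⟨hu, hw⟩, h⟩, rfl⟩; exact ⟨h, u, w, hu, hw, rfl⟩
  rw [Inst.between, this, Set.InjOn.ncard_image, Finset.sum_boole, ← Set.ncard_coe_finset]
  · simp
  · rintro ⟨a, b⟩ ⟨⟨ha, hb⟩, _⟩ ⟨c, d⟩ ⟨⟨hc, hd⟩, _⟩ he
    rcases Sym2.eq_iff.1 he with ⟨rfl, rfl⟩ | ⟨rfl, rfl⟩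
    · rfl
    · exact absurd (ha.symm.trans hd) hUW

theorem Inst.card_block {I : Inst V} (U W : I.SN) :
    U.supp.ncard * W.supp.ncard = ∑ p : V × V, if I.s p.1 = U ∧ I.s p.2 = W then 1 else 0 := by
  rw [← Set.ncard_prod, Finset.sum_boole, ← Set.ncard_coe_finset]
  simp only [Nat.cast_id]
  congr 1
  ext p
  simp [SimpleGraph.ConnectedComponent.mem_supp_iff]

/-- A valid `D` cannot join both `U₁` and `U₂` to `U₃`, since they are hostile. So at least one of
the two deleted edges has sign `1`, and together they contribute at least `0`. -/
theorem Inst.DropStep.sum_le {I : Inst V} {A B : SimpleGraph V} (h : I.DropStep A B)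
    {D : Setoid V} (hD : I.IsValid D) :
    ∑ u : V, ∑ v : V, sepSign D u v * (if B.Adj u v then 1 else 0) ≤
      ∑ u : V, ∑ v : V, sepSign D u v * (if A.Adj u v then 1 else 0) := by
  obtain ⟨u₁, u₂, u₃, u₃', h0, h1, h2, h3, hh, ha, hb, hB⟩ := h
  have e : ∀ u v, sepSign D u v * (if A.Adj u v then 1 else 0) =
      sepSign D u v * (if B.Adj u v then 1 else 0) +
      ((if (u = u₁ ∧ v = u₃) ∨ (u = u₃ ∧ v = u₁) then sepSign D u v else 0) +
      (if (u = u₂ ∧ v = u₃') ∨ (u = u₃' ∧ v = u₂) then sepSign D u v else 0)) := by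
    intro u v
    have hdel : B.Adj u v ↔ A.Adj u v ∧
        ¬ ((u = u₁ ∧ v = u₃) ∨ (u = u₃ ∧ v = u₁)) ∧
        ¬ ((u = u₂ ∧ v = u₃') ∨ (u = u₃' ∧ v = u₂)) := by
      rw [hB, SimpleGraph.deleteEdges_adj]
      simp only [Set.mem_insert_iff, Set.mem_singleton_iff, Sym2.eq_iff, not_or]
    by_cases c1 : (u = u₁ ∧ v = u₃) ∨ (u = u₃ ∧ v = u₁)
    -- The two deleted edges are different because the three supernodes are distinct.
    · have c2 : ¬ ((u = u₂ ∧ v = u₃') ∨ (u = u₃' ∧ v = u₂)) := by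
        rintro (⟨rfl, rfl⟩ | ⟨rfl, rfl⟩)
        · rcases c1 with ⟨e1, _⟩ | ⟨e1, _⟩
          · exact h1 (by rw [e1])
          · exact h3 (by rw [e1])
        · rcases c1 with ⟨e1, _⟩ | ⟨_, e1⟩
          · exact h2 (by rw [← e1, h0])
          · exact h1 (by rw [e1])
      have hA : A.Adj u v := by
        rcases c1 with ⟨rfl, rfl⟩ | ⟨rfl, rfl⟩
        · exact ha
        · exact ha.symm
      rw [if_pos c1, if_neg c2, if_pos hA, if_neg (fun hB' => (hdel.1 hB').2.1 c1)]
      ring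
    · by_cases c2 : (u = u₂ ∧ v = u₃') ∨ (u = u₃' ∧ v = u₂)
      · have hA : A.Adj u v := by
          rcases c2 with ⟨rfl, rfl⟩ | ⟨rfl, rfl⟩
          · exact hb
          · exact hb.symm
        rw [if_neg c1, if_pos c2, if_pos hA, if_neg (fun hB' => (hdel.1 hB').2.2 c2)]
        ring
      · rw [if_neg c1, if_neg c2]
        simp only [hdel, c1, c2, not_false_eq_true, and_true, add_zero]
  simp only [e, Finset.sum_add_distrib]
  rw [sum_pair_ite (fun h => h2 (by rw [h])), sum_pair_ite (fun h => h3 (by rw [← h0, ← h])),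
    sepSign_comm D u₃, sepSign_comm D u₃']
  have : 0 ≤ sepSign D u₁ u₃ + sepSign D u₂ u₃' := by
    unfold sepSign
    split_ifs with k1 k2
    · exfalso
      refine hD.not_of_hostile hh (D.trans k1 (D.trans (hD.of_s_eq h0.symm) (D.symm k2)))
    all_goals norm_num
  linarith

theorem Inst.IsDropResult.sum_le {I : Inst V} {A : SimpleGraph V} (h : I.IsDropResult A)
    {D : Setoid V} (hD : I.IsValid D) :
    ∑ u : V, ∑ v : V, sepSign D u v * (if A.Adj u v then 1 else 0) ≤
      ∑ u : V, ∑ v : V, sepSign D u v * (if I.E₂.Adj u v then 1 else 0) := by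
  have := h.1
  clear h
  induction this with
  | refl => exact le_rfl
  | tail _ h ih => exact (h.sum_le hD).trans ih

/-- The charging inequality for a pair of supernodes. -/
theorem Inst.IsDropResult.block_le {I : Inst V} {A : SimpleGraph V} (h : I.IsDropResult A)
    (hself : ¬ ∃ U, I.Hostile U U) {D : Setoid V} (hD : I.IsValid D) (U W : I.SN) :
    ∑ p : V × V, (if I.s p.1 = U ∧ I.s p.2 = W then
      ((if (I.E.Adj p.1 p.2 ↔ (I.round A).Adj p.1 p.2) then (0 : ℝ) else 1) +
        2 * (sepSign D p.1 p.2 * (if I.E₂.Adj p.1 p.2 then 1 else 0) -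
          sepSign D p.1 p.2 * (if A.Adj p.1 p.2 then 1 else 0))) else 0) ≤
    ∑ p : V × V, (if I.s p.1 = U ∧ I.s p.2 = W then
      3 * (disagree I.E D p.1 p.2 : ℝ) else 0) := by
  -- In all but two cases the inequality already holds for every single pair.
  have hpt : (∀ u v, I.s u = U → I.s v = W →
      ((if (I.E.Adj u v ↔ (I.round A).Adj u v) then (0 : ℝ) else 1) +
        2 * (sepSign D u v * (if I.E₂.Adj u v then 1 else 0) -
          sepSign D u v * (if A.Adj u v then 1 else 0))) ≤ 3 * (disagree I.E D u v : ℝ)) →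
      ∑ p : V × V, (if I.s p.1 = U ∧ I.s p.2 = W then
      ((if (I.E.Adj p.1 p.2 ↔ (I.round A).Adj p.1 p.2) then (0 : ℝ) else 1) +
        2 * (sepSign D p.1 p.2 * (if I.E₂.Adj p.1 p.2 then 1 else 0) -
          sepSign D p.1 p.2 * (if A.Adj p.1 p.2 then 1 else 0))) else 0) ≤
    ∑ p : V × V, (if I.s p.1 = U ∧ I.s p.2 = W then
      3 * (disagree I.E D p.1 p.2 : ℝ) else 0) := by
    intro hle
    refine Finset.sum_le_sum fun p _ => ?_
    by_cases hp : I.s p.1 = U ∧ I.s p.2 = W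
    · rw [if_pos hp, if_pos hp]; exact hle _ _ hp.1 hp.2
    · rw [if_neg hp, if_neg hp]
  by_cases hUW : U = W
  -- Inside a supernode `A`, `E₂` and the rounded graph are complete and `D` joins everything, so
  -- every added edge is a disagreement of `D` as well.
  · apply hpt
    rintro u v rfl hv
    subst hUW
    by_cases huv : u = v
    · subst huv; simp
    · have hDuv := hD.of_s_eq hv.symm
      have h1 : A.Adj u v := h.adj_of_s_eq hself hv.symm huv
      have h2 : I.E₂.Adj u v := h.le h1
      have h3 : (I.round A).Adj u v := Inst.round_adj.2 (Or.inl ⟨hv.symm, h1⟩)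
      simp only [h1, h2, h3, disagree, clusterGraph, hDuv]
      by_cases hE : I.E.Adj u v <;> simp [hE, huv]
  by_cases hh : I.Hostile U W
  · apply hpt
    rintro u v rfl rfl
    have h2 : ¬ I.E₂.Adj u v := by rw [I.E₂_adj hself]; tauto
    have h1 : ¬ A.Adj u v := fun h' => h2 (h.le h')
    have h3 := h.not_adj_of_hostile hself hh
    have h4 := hD.not_of_hostile hh
    simp only [h1, h2, h3, disagree, clusterGraph, h4]
    by_cases hE : I.E.Adj u v <;> simp [hE]
  have hE₂ : ∀ u v, I.s u = U → I.s v = W → (I.E₂.Adj u v ↔ I.E.Adj u v) := by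
    rintro u v rfl rfl
    rw [I.E₂_adj hself]
    refine ⟨by tauto, fun h' => ⟨h'.ne, Or.inr ⟨h', hh⟩⟩⟩
  have hAE : ∀ u v, I.s u = U → I.s v = W → A.Adj u v → I.E.Adj u v := fun u v hu hv h' =>
    (hE₂ u v hu hv).1 (h.le h')
  obtain ⟨a, ha⟩ := U.exists_rep
  obtain ⟨b, hb⟩ := W.exists_rep
  have ha' : I.s a = U := ha
  have hb' : I.s b = W := hb
  have hDc : ∀ u v, I.s u = U → I.s v = W → (D u v ↔ D a b) := by
    intro u v hu hv
    have k1 := hD.of_s_eq (hu.trans ha'.symm)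
    have k2 := hD.of_s_eq (hv.trans hb'.symm)
    exact ⟨fun k => D.trans (D.symm k1) (D.trans k k2), fun k => D.trans k1 (D.trans k (D.symm k2))⟩
  have hGc : ∀ u v, I.s u = U → I.s v = W → ((I.round A).Adj u v ↔ I.Dense A a b) := by
    rintro u v hu hv
    rw [Inst.round_adj]
    unfold Inst.Dense
    rw [hu, hv, ha', hb']
    tauto
  have hne : ∀ u v, I.s u = U → I.s v = W → u ≠ v := by
    rintro u v hu hv rfl; exact hUW (hu.symm.trans hv)
  -- Between distinct supernodes that are not hostile, both `D` and the rounded graph are constant.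
  -- If they agree, the comparison is pairwise; if not, the density of `A` has to be used.
  by_cases hDab : D a b <;> by_cases hGab : I.Dense A a b
  · apply hpt
    intro u v hu hv
    have h1 := hE₂ u v hu hv
    have h2 := hAE u v hu hv
    have h3 := (hDc u v hu hv).2 hDab
    have h4 := (hGc u v hu hv).2 hGab
    have h5 := hne u v hu hv
    simp only [h1, h4, disagree, clusterGraph, h3, sepSign]
    by_cases hE : I.E.Adj u v
    · by_cases hA : A.Adj u v <;> simp [hE, hA, h5]
    · have hA : ¬ A.Adj u v := fun h' => hE (h2 h')
      simp [hE, hA, h5]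
  -- `D` joins and rounding separates. The excess of an edge of `A` is at most `1` and that of any
  -- other pair at most `-1`. The sum is nonpositive because the density is at most `(3 - √5) / 2 ≤
  -- 1 / 2`.
  · have key : ∀ p : V × V, (if I.s p.1 = U ∧ I.s p.2 = W then
      ((if (I.E.Adj p.1 p.2 ↔ (I.round A).Adj p.1 p.2) then (0 : ℝ) else 1) +
        2 * (sepSign D p.1 p.2 * (if I.E₂.Adj p.1 p.2 then 1 else 0) -
          sepSign D p.1 p.2 * (if A.Adj p.1 p.2 then 1 else 0))) else 0) ≤
        (if I.s p.1 = U ∧ I.s p.2 = W then 3 * (disagree I.E D p.1 p.2 : ℝ) else 0) +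
        (2 * (((if (I.s p.1 = U ∧ I.s p.2 = W) ∧ A.Adj p.1 p.2 then 1 else 0) : ℕ) : ℝ) -
          ((if (I.s p.1 = U ∧ I.s p.2 = W) then 1 else 0 : ℕ) : ℝ)) := by
      intro p
      by_cases hp : I.s p.1 = U ∧ I.s p.2 = W
      · have h1 := hE₂ p.1 p.2 hp.1 hp.2
        have h2 := hAE p.1 p.2 hp.1 hp.2
        have h3 := (hDc p.1 p.2 hp.1 hp.2).2 hDab
        have h4 := (not_congr (hGc p.1 p.2 hp.1 hp.2)).2 hGab
        have h5 := hne p.1 p.2 hp.1 hp.2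
        simp only [h1, h4, disagree, clusterGraph, h3, sepSign, hp]
        by_cases hE : I.E.Adj p.1 p.2
        · by_cases hA : A.Adj p.1 p.2 <;> simp [hE, hA, h5] <;> norm_num
        · have hA : ¬ A.Adj p.1 p.2 := fun h' => hE (h2 h')
          simp [hE, hA, h5]; try norm_num
      · simp [hp]
    refine (Finset.sum_le_sum fun p _ => key p).trans ?_
    rw [Finset.sum_add_distrib, Finset.sum_sub_distrib, ← Finset.mul_sum, ← Nat.cast_sum,
      ← Nat.cast_sum, ← Inst.between_eq_sum hUW, ← Inst.card_block]
    unfold Inst.Dense at hGab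
    rw [not_lt, ha', hb'] at hGab
    have h5 : (2 : ℝ) ≤ √5 := Real.le_sqrt_of_sq_le (by norm_num)
    have hN : (0 : ℝ) ≤ (U.supp.ncard : ℝ) * W.supp.ncard := by positivity
    push_cast
    nlinarith
  -- `D` separates and rounding joins. The excess of an edge of `A` is at most `-3` and that of any
  -- other pair at most `1`. The sum is nonpositive because the density exceeds `(3 - √5) / 2 ≥ 1 /
  -- 4`.
  · have key : ∀ p : V × V, (if I.s p.1 = U ∧ I.s p.2 = W then
      ((if (I.E.Adj p.1 p.2 ↔ (I.round A).Adj p.1 p.2) then (0 : ℝ) else 1) +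
        2 * (sepSign D p.1 p.2 * (if I.E₂.Adj p.1 p.2 then 1 else 0) -
          sepSign D p.1 p.2 * (if A.Adj p.1 p.2 then 1 else 0))) else 0) ≤
        (if I.s p.1 = U ∧ I.s p.2 = W then 3 * (disagree I.E D p.1 p.2 : ℝ) else 0) +
        (((if (I.s p.1 = U ∧ I.s p.2 = W) then 1 else 0 : ℕ) : ℝ) -
        4 * (((if (I.s p.1 = U ∧ I.s p.2 = W) ∧ A.Adj p.1 p.2 then 1 else 0) : ℕ) : ℝ)) := by
      intro p
      by_cases hp : I.s p.1 = U ∧ I.s p.2 = W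
      · have h1 := hE₂ p.1 p.2 hp.1 hp.2
        have h2 := hAE p.1 p.2 hp.1 hp.2
        have h3 := (not_congr (hDc p.1 p.2 hp.1 hp.2)).2 hDab
        have h4 := (hGc p.1 p.2 hp.1 hp.2).2 hGab
        simp only [h1, h4, disagree, clusterGraph, h3, sepSign, hp]
        by_cases hE : I.E.Adj p.1 p.2
        · by_cases hA : A.Adj p.1 p.2 <;> simp [hE, hA] <;> norm_num
        · have hA : ¬ A.Adj p.1 p.2 := fun h' => hE (h2 h')
          simp [hE, hA]
      · simp [hp]
    refine (Finset.sum_le_sum fun p _ => key p).trans ?_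
    rw [Finset.sum_add_distrib, Finset.sum_sub_distrib, ← Finset.mul_sum, ← Nat.cast_sum,
      ← Nat.cast_sum, ← Inst.between_eq_sum hUW, ← Inst.card_block]
    unfold Inst.Dense at hGab
    rw [ha', hb'] at hGab
    have h5 : √5 ≤ 5 / 2 := by rw [Real.sqrt_le_left (by norm_num)]; norm_num
    have hN : (0 : ℝ) ≤ (U.supp.ncard : ℝ) * W.supp.ncard := by positivity
    push_cast
    nlinarith
  · apply hpt
    intro u v hu hv
    have h1 := hE₂ u v hu hv
    have h2 := hAE u v hu hv
    have h3 := (not_congr (hDc u v hu hv)).2 hDab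
    have h4 := (not_congr (hGc u v hu hv)).2 hGab
    simp only [h1, h4, disagree, clusterGraph, h3, sepSign]
    by_cases hE : I.E.Adj u v
    · by_cases hA : A.Adj u v <;> simp [hE, hA]; try norm_num
    · have hA : ¬ A.Adj u v := fun h' => hE (h2 h')
      simp [hE, hA]

/-- The transformed graph is close to the preferences, compared with any valid clustering. -/
theorem Inst.IsDropResult.ncard_symmDiff_le {I : Inst V} {A : SimpleGraph V}
    (h : I.IsDropResult A) (hself : ¬ ∃ U, I.Hostile U U) {D : Setoid V} (hD : I.IsValid D) :
    (symmDiff I.E.edgeSet (I.round A).edgeSet).ncard ≤ 3 * cost I.E D := by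
  have : Fintype I.SN := Fintype.ofFinite _
  have hsplit : ∀ f : V → V → ℝ, ∑ u : V, ∑ v : V, f u v =
      ∑ q : I.SN × I.SN, ∑ p : V × V, if I.s p.1 = q.1 ∧ I.s p.2 = q.2 then f p.1 p.2 else 0 := by
    intro f
    rw [← Fintype.sum_prod_type' (f := f)]
    conv_rhs => rw [Finset.sum_comm]
    refine Finset.sum_congr rfl fun p _ => ?_
    rw [Finset.sum_eq_single (I.s p.1, I.s p.2)]
    · simp
    · rintro ⟨a, b⟩ _ hne
      rw [if_neg]
      rintro ⟨h1, h2⟩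
      exact hne (by rw [h1, h2])
    · simp
  have hmain := Finset.sum_le_sum fun (q : I.SN × I.SN) (_ : q ∈ Finset.univ) =>
    h.block_le hself hD q.1 q.2
  rw [← hsplit (fun u v => (if (I.E.Adj u v ↔ (I.round A).Adj u v) then (0 : ℝ) else 1) +
        2 * (sepSign D u v * (if I.E₂.Adj u v then 1 else 0) -
          sepSign D u v * (if A.Adj u v then 1 else 0))),
    ← hsplit (fun u v => 3 * (disagree I.E D u v : ℝ))] at hmain
  simp only [Finset.sum_add_distrib, ← Finset.mul_sum, Finset.sum_sub_distrib] at hmain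
  -- The signed weight of the dropped edges is nonnegative and may be omitted from the left side.
  have h1 := h.sum_le hD
  have h2 := two_mul_ncard_symmDiff I.E (I.round A)
  have h3 := cast_two_mul_cost I.E D
  have h4 : (2 * (symmDiff I.E.edgeSet (I.round A).edgeSet).ncard : ℝ) =
      ∑ u : V, ∑ v : V, if (I.E.Adj u v ↔ (I.round A).Adj u v) then (0 : ℝ) else 1 := by
    exact_mod_cast h2
  have h5 : (2 * (symmDiff I.E.edgeSet (I.round A).edgeSet).ncard : ℝ) ≤ 3 * (2 * cost I.E D) := by
    rw [h3, h4]; linarith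
  have h6 : 2 * (symmDiff I.E.edgeSet (I.round A).edgeSet).ncard ≤ 3 * (2 * cost I.E D) := by
    exact_mod_cast h5
  omega

theorem cost_triangle (G H : SimpleGraph V) (C : Setoid V) :
    cost G C ≤ (symmDiff G.edgeSet H.edgeSet).ncard + cost H C :=
  (Set.ncard_le_ncard (symmDiff_triangle _ H.edgeSet _) (Set.toFinite _)).trans
    (Set.ncard_union_le _ _)

/-- Two triangle inequalities through the transformed graph: with `d` its distance from `E`, the
cost of `C` is at most `d + α * (d + cost I.E D)`, and `d ≤ 3 * cost I.E D`. -/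
theorem Inst.IsTransformPivotAnswer.isApproxAnswer {I : Inst V} {α ρ : ℝ} (hα : 0 ≤ α)
    (hρ : 3 * (α + 1) + α ≤ ρ) {a : Option (Setoid V)} (h : I.IsTransformPivotAnswer α a) :
    I.IsApproxAnswer ρ a := by
  match a, h with
  | none, h => exact Inst.not_valid_of_hostile_self h
  | some C, h =>
    obtain ⟨hself, A, hA, hC, hcost⟩ := h
    refine ⟨hA.isValid hself hC, fun D hD => ?_⟩
    have h1 : (cost I.E C : ℝ) ≤ (symmDiff I.E.edgeSet (I.round A).edgeSet).ncard +
        cost (I.round A) C := by exact_mod_cast cost_triangle I.E (I.round A) C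
    have h2 : (cost (I.round A) D : ℝ) ≤ (symmDiff I.E.edgeSet (I.round A).edgeSet).ncard +
        cost I.E D := by
      rw [symmDiff_comm]
      exact_mod_cast cost_triangle (I.round A) I.E D
    have h3 : ((symmDiff I.E.edgeSet (I.round A).edgeSet).ncard : ℝ) ≤ 3 * cost I.E D := by
      exact_mod_cast hA.ncard_symmDiff_le hself hD
    have h4 : (0 : ℝ) ≤ cost I.E D := Nat.cast_nonneg _
    nlinarith [hcost D, mul_le_mul_of_nonneg_left h2 hα, mul_le_mul_of_nonneg_left h3 hα,
      mul_le_mul_of_nonneg_right hρ h4]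

end Distance

end Approx

end CCC

/-! ### Programs: supernodes, hostility, deletion of hostile edges -/

namespace RamLang

open CCC

infixr:60 " ;; " => Pr.seq

set_option linter.unusedSimpArgs false

section Rules

variable {n M m : ℕ} {Q : St → Prop} {s : St}

@[simp] theorem wp_skip : wp n M m .skip Q s ↔ Q s := Iff.rfl

@[simp] theorem wp_assign {x : ℕ} {e : Ex} :
    wp n M m (.assign x e) Q s ↔ e.ok n M s ∧ Q (s.setV x (e.eval s)) := Iff.rfl

@[simp] theorem wp_set {t : ℕ} {i j e : Ex} : wp n M m (.set t i j e) Q s ↔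
    i.ok n M s ∧ j.ok n M s ∧ e.ok n M s ∧ i.eval s < n ∧ j.eval s < n ∧
      Q (s.setA t (i.eval s) (j.eval s) (e.eval s)) := Iff.rfl

@[simp] theorem wp_seq {p q : Pr} :
    wp n M m (p ;; q) Q s ↔ wp n M m p (wp n M m q Q) s := Iff.rfl

@[simp] theorem wp_ite {b : Bx} {p q : Pr} : wp n M m (.ite b p q) Q s ↔
    b.ok n M s ∧ (b.Holds s → wp n M m p Q s) ∧ (¬ b.Holds s → wp n M m q Q s) := Iff.rfl

@[simp] theorem upd_apply {f : ℕ → ℕ → ℕ} {i j k i' j' : ℕ} :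
    upd f i j k i' j' = if i' = i ∧ j' = j then k else f i' j' := rfl

end Rules

attribute [simp] Ex.eval Ex.ok Bx.Holds Bx.ok WordRAM.Op.eval

@[simp] theorem lim_zero (n m : ℕ) : lim n m 0 = n := rfl

/-- Loop rule for loops over all nodes. -/
theorem wp_loop0 {n M m : ℕ} {x : ℕ} {p : Pr} {Q : St → Prop} {s : St} (Inv : ℕ → St → Prop)
    (hs : s.v 0 = n) (h0 : Inv 0 s)
    (hstep : ∀ i < n, ∀ s', Frame (.loop x 0 p) s s' → Inv i s' →
      wp n M m p (Inv (i + 1)) (s'.setV x i))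
    (hQ : ∀ s', Frame (.loop x 0 p) s s' → Inv n s' → Q (s'.setV x n)) :
    wp n M m (.loop x 0 p) Q s :=
  wp_loop Inv (by simp [hs]) h0 (by rw [hs]; exact hstep) (by rw [hs]; exact hQ)

/-! #### Supernodes -/

/-- Arrays `0`, `1`, `2` hold `E`, `F`, `H`; vectors occupy row `0` of an array. Array `3` names the
supernode of each node, `4` is hostility of names, `5` the current edges, `6` to `8` hold degrees,
counts and sizes, `9` the code of the transformed graph, `10` and `11` the current and the best
weights. -/
def initLabels : Pr := .loop 2 0 (.set 3 (.lit 0) (.var 2) (.var 2))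

def relabel : Pr :=
  .loop 4 0 (.ite (.eq (.get 3 (.lit 0) (.var 4)) (.var 5)) (.set 3 (.lit 0) (.var 4) (.var 6)) .skip)

def mergeRow : Pr :=
  .loop 3 0 (.ite (.eq (.get 1 (.var 2) (.var 3)) (.lit 1))
    (.assign 5 (.get 3 (.lit 0) (.var 3)) ;; .assign 6 (.get 3 (.lit 0) (.var 2)) ;; relabel) .skip)

def components : Pr := initLabels ;; .loop 2 0 mergeRow

theorem wp_initLabels {n M m : ℕ} {s : St} (hs : s.v 0 = n) (hM : 32 ≤ M) :
    wp n M m initLabels (fun s' => ∀ k < n, s'.a 3 0 k = k) s := by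
  refine wp_loop0 (fun i s' => ∀ k < i, s'.a 3 0 k = k) hs (by simp) ?_ ?_
  · intro i hi s' hf hI
    simp only [wp_set, Ex.ok, Ex.eval, setV_v, setA_a, upd_apply, if_true]
    refine ⟨by omega, trivial, trivial, by omega, hi, fun k hk => ?_⟩
    by_cases h : k = i
    · simp [h]
    · simp [h]; exact hI k (by omega)
  · intro s' hf hI
    simpa using hI

theorem wp_relabel {n M m : ℕ} {s : St} (hs : s.v 0 = n) (hM : 32 ≤ M) :
    wp n M m relabel
      (fun s' => ∀ k < n, s'.a 3 0 k = if s.a 3 0 k = s.v 5 then s.v 6 else s.a 3 0 k) s := by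
  refine wp_loop0 (fun i s' => ∀ k < n, s'.a 3 0 k =
    if k < i ∧ s.a 3 0 k = s.v 5 then s.v 6 else s.a 3 0 k) hs (by simp) ?_ ?_
  · intro i hi s' hf hI
    have h5 : s'.v 5 = s.v 5 := hf.1 5 rfl
    have h6 : s'.v 6 = s.v 6 := hf.1 6 rfl
    have hi' := hI i hi
    simp only [lt_irrefl, false_and, if_false] at hi'
    simp only [wp_ite, wp_seq, wp_skip, wp_assign, wp_set, Ex.ok, Ex.eval, Bx.ok, Bx.Holds,
      WordRAM.Op.eval, setV_v, setV_a, setA_v, setA_a, upd_apply, Nat.reduceEqDiff, ↓reduceIte,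
      true_and, and_true,
      h5, h6, hi', show 0 < M by omega, show 0 < n by omega, hi]
    refine ⟨fun h k hk => ?_, fun h k hk => ?_⟩
    · by_cases hki : k = i
      · simp [hki, h]
      · simp only [hki, if_false, hI k hk]
        congr 1
        ext; constructor <;> rintro ⟨a, b⟩ <;> exact ⟨by omega, b⟩
    · rw [hI k hk]
      congr 1
      ext; constructor <;> rintro ⟨a, b⟩
      · exact ⟨by omega, b⟩
      · refine ⟨lt_of_le_of_ne (by omega) ?_, b⟩
        rintro rfl; exact h b
  · intro s' hf hI k hk
    rw [setV_a, hI k hk]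
    simp [hk]

/-- `f` represents the set of pairs `G`. -/
def Rep {n : ℕ} (f : ℕ → ℕ → ℕ) (G : SimpleGraph (Fin n)) : Prop :=
  ∀ u v : Fin n, (G.Adj u v → f u v = 1) ∧ (¬ G.Adj u v → f u v = 0)

theorem Rep.eq_one {n : ℕ} {f : ℕ → ℕ → ℕ} {G : SimpleGraph (Fin n)} (h : Rep f G) (u v : Fin n) :
    f u v = 1 ↔ G.Adj u v := by
  by_cases huv : G.Adj u v
  · simp [(h u v).1 huv, huv]
  · simp [(h u v).2 huv, huv]

/-- `f` assigns names below `n` to the supernodes. -/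
structure Labeling {n : ℕ} (I : Inst (Fin n)) (f : ℕ → ℕ) : Prop where
  iff : ∀ u v : Fin n, f u = f v ↔ I.s u = I.s v
  lt : ∀ u, u < n → f u < n

/-- Invariant of the computation of the supernodes; `P u v` are the pairs already treated. -/
structure Merged {n : ℕ} (I : Inst (Fin n)) (P : ℕ → ℕ → Prop) (f : ℕ → ℕ) : Prop where
  lt : ∀ u, u < n → f u < n
  sound : ∀ u v : Fin n, f u = f v → I.s u = I.s v
  done : ∀ u v : Fin n, P u v → I.F.Adj u v → f u = f v

theorem Merged.mono {n : ℕ} {I : Inst (Fin n)} {P P' : ℕ → ℕ → Prop} {f : ℕ → ℕ}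
    (h : Merged I P f) (hP : ∀ u v : Fin n, P' u v → I.F.Adj u v → P u v ) : Merged I P' f :=
  ⟨h.lt, h.sound, fun u v hp ha => h.done u v (hP u v hp ha) ha⟩

/-- Renaming the class of `b` to the name of `a` keeps all earlier identifications and merges only
classes that a friendly pair connects. -/
theorem Merged.merge {n : ℕ} {I : Inst (Fin n)} {P : ℕ → ℕ → Prop} {f g : ℕ → ℕ}
    (h : Merged I P f) {a b : Fin n} (hab : I.F.Adj a b)
    (hg : ∀ k < n, g k = if f k = f b then f a else f k) :
    Merged I (fun u v => P u v ∨ (u = a ∧ v = b)) g := by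
  have hsab : I.s a = I.s b := SimpleGraph.ConnectedComponent.sound hab.reachable
  refine ⟨fun u hu => ?_, fun u v huv => ?_, fun u v hP hadj => ?_⟩
  · rw [hg u hu]; split_ifs
    · exact h.lt _ a.2
    · exact h.lt _ hu
  · rw [hg u u.2, hg v v.2] at huv
    split_ifs at huv with h1 h2 h2
    · exact h.sound _ _ (h1.trans h2.symm)
    · exact (h.sound _ _ h1).trans (hsab.symm.trans (h.sound _ _ huv))
    · exact (h.sound _ _ huv).trans (hsab.trans (h.sound _ _ h2.symm))
    · exact h.sound _ _ huv
  · rw [hg u u.2, hg v v.2]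
    rcases hP with hP | ⟨hu, hv⟩
    · rw [h.done u v hP hadj]
    · rw [hu, hv]; simp

/-- Names are constant along every path of friendly pairs. -/
theorem Merged.labeling {n : ℕ} {I : Inst (Fin n)} {f : ℕ → ℕ}
    (h : Merged I (fun _ _ => True) f) : Labeling I f := by
  refine ⟨fun u v => ⟨h.sound u v, fun huv => ?_⟩, h.lt⟩
  obtain ⟨p⟩ := SimpleGraph.ConnectedComponent.exact huv
  clear huv
  induction p with
  | nil => rfl
  | cons hadj _ ih => exact (h.done _ _ trivial hadj).trans ih

theorem wp_mergeRow {n M m : ℕ} {s : St} (hs : s.v 0 = n) (hM : 32 ≤ M) {I : Inst (Fin n)}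
    (hF : Rep (s.a 1) I.F) {i : ℕ} (hi : i < n) (h2 : s.v 2 = i)
    (h : Merged I (fun u _ => u < i) (s.a 3 0)) :
    wp n M m mergeRow (fun s' => Merged I (fun u _ => u < i + 1) (s'.a 3 0)) s := by
  refine wp_loop0 (fun j s' => Merged I (fun u v => u < i ∨ (u = i ∧ v < j)) (s'.a 3 0)) hs
    (h.mono fun u v hp _ => by omega) ?_ ?_
  · intro j hj s' hf hI
    have e2 : s'.v 2 = i := (hf.1 2 rfl).trans h2
    have e0 : s'.v 0 = n := (hf.1 0 rfl).trans hs
    have e1 : s'.a 1 = s.a 1 := hf.2 1 rfl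
    have hadj := hF.eq_one ⟨i, hi⟩ ⟨j, hj⟩
    simp only at hadj
    simp only [wp_ite, wp_seq, wp_skip, wp_assign, wp_set, Ex.ok, Ex.eval, Bx.ok, Bx.Holds,
      WordRAM.Op.eval, setV_v, setV_a, setA_v, setA_a, upd_apply, Nat.reduceEqDiff, ↓reduceIte,
      true_and, and_true,
      e1, e2, hadj, show 0 < M by omega, show 1 < M by omega, show 0 < n by omega, hi, hj]
    refine ⟨fun ha => ?_, fun ha => ?_⟩
    · refine wp_conseq (wp_relabel (by simp [e0]) hM) ?_
      intro s'' hf' hr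
      simp only [setV_v, setV_a, show (5 : ℕ) = 6 ↔ False by simp, if_false, if_true] at hr
      refine (hI.merge ha hr).mono fun u v hp _ => ?_
      simp only at hp ⊢
      omega
    · refine hI.mono fun u v hp hadj' => ?_
      rcases hp with hp | ⟨hp1, hp2⟩
      · exact Or.inl hp
      · refine Or.inr ⟨hp1, lt_of_le_of_ne (by omega) ?_⟩
        rintro rfl
        subst hp1
        exact ha hadj'
  · intro s' hf hI
    exact hI.mono fun u v hp _ => by have := v.2; omega

theorem wp_components {n M m : ℕ} {s : St} (hs : s.v 0 = n) (hM : 32 ≤ M) {I : Inst (Fin n)}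
    (hF : Rep (s.a 1) I.F) :
    wp n M m components (fun s' => Labeling I (s'.a 3 0)) s := by
  refine wp_seq.2 (wp_conseq (wp_initLabels hs hM) fun s1 hf1 h1 => ?_)
  have e0 : s1.v 0 = n := (hf1.1 0 rfl).trans hs
  refine wp_loop0 (fun i s' => Merged I (fun u _ => u < i) (s'.a 3 0)) e0 ?_ ?_ ?_
  · refine ⟨fun u hu => by rwa [h1 u hu], fun u v huv => ?_, fun u v hp => absurd hp (by simp)⟩
    rw [h1 u u.2, h1 v v.2] at huv
    rw [Fin.ext huv]
  · intro i hi s' hf hI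
    refine wp_mergeRow (by simp [hf.1 0 rfl, e0]) hM ?_ hi (by simp) hI
    rw [setV_a, hf.2 1 rfl, hf1.2 1 rfl]
    exact hF
  · intro s' hf hI
    exact (hI.mono fun u v _ _ => u.2).labeling

end RamLang

/-! ### Programs: hostility and the dropping loop -/

namespace RamLang

open CCC

set_option linter.unusedSimpArgs false

/-- Pairs treated before iteration `(i, j)` of a double loop. -/
def Before (i j u v : ℕ) : Prop := u < i ∨ (u = i ∧ v < j)

theorem before_succ {i j u v : ℕ} : Before i (j + 1) u v ↔ Before i j u v ∨ (u = i ∧ v = j) := by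
  unfold Before; omega

theorem before_row {n i u v : ℕ} (hv : v < n) : Before (i + 1) 0 u v ↔ Before i n u v := by
  unfold Before; omega

theorem before_zero {u v : ℕ} : ¬ Before 0 0 u v := by unfold Before; omega

theorem before_all {n u v : ℕ} (hu : u < n) : Before n 0 u v := Or.inl hu

/-- Rule for double loops over all nodes. -/
theorem wp_double {n M m : ℕ} {x y : ℕ} {p : Pr} {Q : St → Prop} {s : St} (Inv : ℕ → ℕ → St → Prop)
    (hs : s.v 0 = n) (hx0 : x ≠ 0) (hy0 : y ≠ 0) (hxy : x ≠ y) (hx : p.mv.contains x = false)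
    (hp0 : p.mv.contains 0 = false)
    (hV : ∀ i j s' k z, z = x ∨ z = y → Inv i j s' → Inv i j (s'.setV z k))
    (h0 : Inv 0 0 s)
    (hstep : ∀ i < n, ∀ j < n, ∀ s', Frame (.loop x 0 (.loop y 0 p)) s s' → s'.v x = i → s'.v y = j →
      Inv i j s' → wp n M m p (Inv i (j + 1)) s')
    (hrow : ∀ i < n, ∀ s', Inv i n s' → Inv (i + 1) 0 s')
    (hQ : ∀ s', Frame (.loop x 0 (.loop y 0 p)) s s' → Inv n 0 s' → Q s') :
    wp n M m (.loop x 0 (.loop y 0 p)) Q s := by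
  refine wp_loop0 (fun i s' => Inv i 0 s') hs h0 ?_ ?_
  · intro i hi s' hf hI
    have hf0 : s'.v 0 = n := by
      rw [hf.1 0 ?_, hs]
      simp only [Pr.mv, List.contains_cons, hp0, Bool.or_false, Bool.or_eq_false_iff,
        beq_eq_false_iff_ne]
      exact ⟨hx0.symm, hy0.symm⟩
    refine wp_loop0 (fun j s'' => Inv i j s'') (by simp [hx0.symm, hf0]) (hV _ _ _ _ _ (.inl rfl) hI)
      ?_ ?_
    · intro j hj s'' hf' hI'
      have hfx : s''.v x = i := by
        rw [hf'.1 x ?_]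
        · simp
        · simp only [Pr.mv, List.contains_cons, hx, Bool.or_false, beq_eq_false_iff_ne]
          exact hxy
      have hF : Frame (.loop x 0 (.loop y 0 p)) s (s''.setV y j) := by
        refine hf.trans ((Frame.setV_loop x 0 _ s' i).trans (Frame.body_loop ?_))
        exact hf'.trans (Frame.setV_loop y 0 p s'' j)
      exact hstep i hi j hj _ hF (by simp [hxy, hfx]) (by simp) (hV _ _ _ _ _ (.inr rfl) hI')
    · intro s'' hf' hI'
      exact hrow i hi _ (hV _ _ _ _ _ (.inr rfl) hI')
  · intro s' hf hI
    exact hQ _ (hf.trans (Frame.setV_loop _ _ _ _ _)) (hV _ _ _ _ _ (.inl rfl) hI)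

/-! #### Hostile supernodes -/

/-- A table indexed by supernode names makes hostility a single look-up later on. Variable `10`
records that some supernode is hostile to itself. -/
def hostilityBody : Pr :=
  .ite (.eq (.get 2 (.var 2) (.var 3)) (.lit 1))
    (.set 4 (.get 3 (.lit 0) (.var 2)) (.get 3 (.lit 0) (.var 3)) (.lit 1) ;;
      .ite (.eq (.get 3 (.lit 0) (.var 2)) (.get 3 (.lit 0) (.var 3))) (.assign 10 (.lit 1)) .skip)
    .skip

def hostility : Pr := .assign 10 (.lit 0) ;; .loop 2 0 (.loop 3 0 hostilityBody)

/-- `g` represents hostility of the supernodes with names `f`. -/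
def HosRep {n : ℕ} (I : Inst (Fin n)) (f : ℕ → ℕ) (g : ℕ → ℕ → ℕ) : Prop :=
  ∀ u v : Fin n, g (f u) (f v) = 1 ↔ I.Hostile (I.s u) (I.s v)

theorem wp_hostility {n M m : ℕ} {s : St} (hs : s.v 0 = n) (hM : 32 ≤ M) {I : Inst (Fin n)}
    (hH : Rep (s.a 2) I.H) (hf : Labeling I (s.a 3 0)) (h4 : ∀ i < n, ∀ j < n, s.a 4 i j = 0) :
    wp n M m hostility (fun s' => HosRep I (s.a 3 0) (s'.a 4) ∧
      (s'.v 10 = 0 ↔ ¬ ∃ U, I.Hostile U U)) s := by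
  unfold hostility
  simp only [wp_ite, wp_seq, wp_skip, wp_assign, wp_set, Ex.ok, Ex.eval, Bx.ok, Bx.Holds,
    WordRAM.Op.eval, setV_v, setV_a, setA_v, setA_a, upd_apply, Nat.reduceEqDiff, ↓reduceIte,
    true_and, and_true,
    show 0 < M by omega]
  set f := s.a 3 0 with hfdef
  refine wp_double (fun i j s' => (∀ l < n, ∀ l' < n, s'.a 4 l l' = 1 ↔
      ∃ u v : Fin n, Before i j u v ∧ f u = l ∧ f v = l' ∧ I.H.Adj u v) ∧
      (s'.v 10 = 0 ↔ ¬ ∃ u v : Fin n, Before i j u v ∧ f u = f v ∧ I.H.Adj u v))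
    (by simp [hs]) (by decide) (by decide) (by decide) rfl rfl ?_ ?_ ?_ ?_ ?_
  · rintro i j s' k z (rfl | rfl) h <;> exact h
  · simp only [before_zero, false_and, exists_false, iff_false, setV_a, not_false_eq_true, iff_true]
    exact ⟨fun l hl l' hl' => by simp [h4 l hl l' hl'], rfl⟩
  · intro i hi j hj s' hfr hx hy ⟨hI1, hI2⟩
    have e2 : s'.a 2 = s.a 2 := hfr.2 2 rfl
    have e3 : s'.a 3 = s.a 3 := hfr.2 3 rfl
    have hadj := hH.eq_one ⟨i, hi⟩ ⟨j, hj⟩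
    have hfi := hf.lt i hi
    have hfj := hf.lt j hj
    simp only at hadj
    unfold hostilityBody
    simp only [wp_ite, wp_seq, wp_skip, wp_assign, wp_set, Ex.ok, Ex.eval, Bx.ok, Bx.Holds,
      WordRAM.Op.eval, setV_v, setV_a, setA_v, setA_a, upd_apply, Nat.reduceEqDiff, ↓reduceIte,
      true_and, and_true,
      hx, hy, e2, e3, ← hfdef, hadj, show 0 < M by omega, show 1 < M by omega, show 0 < n by omega,
      hi, hj, hfi, hfj]
    have key1 : I.H.Adj ⟨i, hi⟩ ⟨j, hj⟩ → ∀ l < n, ∀ l' < n,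
        ((if l = f i ∧ l' = f j then 1 else s'.a 4 l l') = 1 ↔ ∃ u v : Fin n,
          Before i (j + 1) u v ∧ f u = l ∧ f v = l' ∧ I.H.Adj u v) := by
      intro ha l hl l' hl'
      split_ifs with h
      · simp only [true_iff]
        exact ⟨⟨i, hi⟩, ⟨j, hj⟩, before_succ.2 (.inr ⟨rfl, rfl⟩), h.1.symm, h.2.symm, ha⟩
      · rw [hI1 l hl l' hl']
        constructor
        · rintro ⟨u, v, hb, h'⟩; exact ⟨u, v, before_succ.2 (.inl hb), h'⟩
        · rintro ⟨u, v, hb, h1, h2, h3⟩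
          rcases before_succ.1 hb with hb | ⟨hu, hv⟩
          · exact ⟨u, v, hb, h1, h2, h3⟩
          · rw [hu] at h1; rw [hv] at h2
            exact absurd ⟨h1.symm, h2.symm⟩ h
    refine ⟨fun ha => ⟨fun hl => ⟨key1 ha, ?_⟩, fun hl => ⟨key1 ha, ?_⟩⟩, fun ha => ⟨?_, ?_⟩⟩
    · simp only [one_ne_zero, false_iff, not_not]
      exact ⟨⟨i, hi⟩, ⟨j, hj⟩, before_succ.2 (.inr ⟨rfl, rfl⟩), hl, ha⟩
    · rw [hI2, not_iff_not]
      constructor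
      · rintro ⟨u, v, hb, h'⟩; exact ⟨u, v, before_succ.2 (.inl hb), h'⟩
      · rintro ⟨u, v, hb, h1, h3⟩
        rcases before_succ.1 hb with hb | ⟨hu, hv⟩
        · exact ⟨u, v, hb, h1, h3⟩
        · rw [hu, hv] at h1; exact absurd h1 hl
    · intro l hl l' hl'
      rw [hI1 l hl l' hl']
      constructor
      · rintro ⟨u, v, hb, h'⟩; exact ⟨u, v, before_succ.2 (.inl hb), h'⟩
      · rintro ⟨u, v, hb, h1, h2, h3⟩
        rcases before_succ.1 hb with hb | ⟨rfl, rfl⟩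
        · exact ⟨u, v, hb, h1, h2, h3⟩
        · exact absurd h3 ha
    · rw [hI2, not_iff_not]
      constructor
      · rintro ⟨u, v, hb, h'⟩; exact ⟨u, v, before_succ.2 (.inl hb), h'⟩
      · rintro ⟨u, v, hb, h1, h3⟩
        rcases before_succ.1 hb with hb | ⟨rfl, rfl⟩
        · exact ⟨u, v, hb, h1, h3⟩
        · exact absurd h3 ha
  · intro i hi s' hI
    simpa only [before_row (Fin.is_lt _)] using hI
  · rintro s' hfr ⟨hI1, hI2⟩
    simp only [before_all (Fin.is_lt _), true_and] at hI1 hI2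
    refine ⟨fun u v => ?_, ?_⟩
    · rw [hI1 _ (hf.lt u u.2) _ (hf.lt v v.2)]
      simp only [hf.iff]
      rfl
    · rw [hI2, not_iff_not]
      constructor
      · rintro ⟨u, v, h1, h2⟩; exact ⟨I.s u, u, v, rfl, ((hf.iff u v).1 h1).symm, h2⟩
      · rintro ⟨U, u, v, h1, h2, h3⟩; exact ⟨u, v, (hf.iff u v).2 (h1.trans h2.symm), h3⟩

/-! #### Deleting edges between hostile supernodes -/

def cleanBody : Pr :=
  .ite (.eq (.get 3 (.lit 0) (.var 2)) (.get 3 (.lit 0) (.var 3)))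
    (.ite (.eq (.var 2) (.var 3)) (.set 5 (.var 2) (.var 3) (.lit 0))
      (.set 5 (.var 2) (.var 3) (.lit 1)))
    (.ite (.eq (.get 4 (.get 3 (.lit 0) (.var 2)) (.get 3 (.lit 0) (.var 3))) (.lit 1))
      (.set 5 (.var 2) (.var 3) (.lit 0))
      (.set 5 (.var 2) (.var 3) (.get 0 (.var 2) (.var 3))))

def clean : Pr := .loop 2 0 (.loop 3 0 cleanBody)

theorem wp_clean {n M m : ℕ} {s : St} (hs : s.v 0 = n) (hM : 32 ≤ M) {I : Inst (Fin n)}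
    (hE : Rep (s.a 0) I.E) (hf : Labeling I (s.a 3 0)) (hH : HosRep I (s.a 3 0) (s.a 4))
    (hself : ¬ ∃ U, I.Hostile U U) :
    wp n M m clean (fun s' => Rep (s'.a 5) I.E₂) s := by
  refine wp_double (fun i j s' => ∀ u v : Fin n, Before i j u v →
      (I.E₂.Adj u v → s'.a 5 u v = 1) ∧ (¬ I.E₂.Adj u v → s'.a 5 u v = 0))
    hs (by decide) (by decide) (by decide) rfl rfl ?_ ?_ ?_ ?_ ?_
  · rintro i j s' k z (rfl | rfl) h <;> exact h
  · intro u v hb; exact absurd hb before_zero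
  · intro i hi j hj s' hfr hx hy hI
    have e0 : s'.a 0 = s.a 0 := hfr.2 0 rfl
    have e3 : s'.a 3 = s.a 3 := hfr.2 3 rfl
    have e4 : s'.a 4 = s.a 4 := hfr.2 4 rfl
    have hfi := hf.lt i hi
    have hfj := hf.lt j hj
    have hadj := Inst.E₂_adj hself (u := ⟨i, hi⟩) (v := ⟨j, hj⟩)
    rw [← hf.iff, ← hH] at hadj
    simp only [ne_eq, Fin.mk.injEq] at hadj
    have hEij := hE ⟨i, hi⟩ ⟨j, hj⟩
    simp only at hEij
    have key : ∀ k, (I.E₂.Adj ⟨i, hi⟩ ⟨j, hj⟩ → k = 1) ∧ (¬ I.E₂.Adj ⟨i, hi⟩ ⟨j, hj⟩ → k = 0) →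
        ∀ u v : Fin n, Before i (j + 1) u v →
        (I.E₂.Adj u v → (if (u : ℕ) = i ∧ (v : ℕ) = j then k else s'.a 5 u v) = 1) ∧
        (¬ I.E₂.Adj u v → (if (u : ℕ) = i ∧ (v : ℕ) = j then k else s'.a 5 u v) = 0) := by
      intro k hk u v hb
      split_ifs with h
      · have hu : u = ⟨i, hi⟩ := Fin.ext h.1
        have hv : v = ⟨j, hj⟩ := Fin.ext h.2
        rw [hu, hv]; exact hk
      · exact hI u v ((before_succ.1 hb).resolve_right h)
    unfold cleanBody
    simp only [wp_ite, wp_seq, wp_skip, wp_assign, wp_set, Ex.ok, Ex.eval, Bx.ok, Bx.Holds,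
      WordRAM.Op.eval, setV_v, setV_a, setA_v, setA_a, upd_apply, Nat.reduceEqDiff, ↓reduceIte,
      true_and, and_true,
      hx, hy, e0, e3, e4, show 0 < M by omega, show 1 < M by omega, show 0 < n by omega,
      hi, hj, hfi, hfj]
    refine ⟨fun h1 => ⟨fun h2 => key _ ?_, fun h2 => key _ ?_⟩,
      fun h1 => ⟨fun h2 => key _ ?_, fun h2 => key _ ?_⟩⟩
    · rw [hadj]; simp [h2]
    · rw [hadj]; simp [h2, h1]
    · rw [hadj]; simp [h2, h1]
    · have hne : i ≠ j := by rintro rfl; exact h1 rfl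
      rw [hadj]; simpa [h2, h1, hne] using hEij
  · intro i hi s' hI
    simpa only [before_row (Fin.is_lt _)] using hI
  · intro s' hfr hI u v
    exact hI u v (before_all u.2)

/-! #### Degrees into supernodes -/

/-- Rule for loops that accumulate a sum in the variable `c`. -/
theorem wp_sum {n M m : ℕ} {x c : ℕ} {p : Pr} {Q : St → Prop} {s : St} (g : ℕ → ℕ)
    (hs : s.v 0 = n) (hxc : c ≠ x) (h0 : s.v c = 0)
    (hstep : ∀ i < n, ∀ s', Frame (.loop x 0 p) s s' → s'.v x = i →
      s'.v c = ∑ j ∈ Finset.range i, g j → wp n M m p (fun s'' => s''.v c = s'.v c + g i) s')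
    (hQ : ∀ s', Frame (.loop x 0 p) s s' → s'.v c = ∑ j ∈ Finset.range n, g j → Q s') :
    wp n M m (.loop x 0 p) Q s := by
  refine wp_loop0 (fun i s' => s'.v c = ∑ j ∈ Finset.range i, g j) hs (by simp [h0]) ?_ ?_
  · intro i hi s' hf hI
    refine wp_mono _ _ _ ?_ _ (hstep i hi (s'.setV x i) (hf.trans (Frame.setV_loop _ _ _ _ _))
      (by simp) (by simpa [hxc] using hI))
    intro s'' h
    rw [h, Finset.sum_range_succ]
    simp [hxc, hI]
  · intro s' hf hI
    exact hQ _ (hf.trans (Frame.setV_loop _ _ _ _ _)) (by simpa [hxc] using hI)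

theorem sum_range_lt {n i : ℕ} {g : ℕ → ℕ} {b M : ℕ} (hg : ∀ j < n, g j ≤ b) (hi : i < n)
    (hM : n * b < M) : ∑ j ∈ Finset.range i, g j + g i < M := by
  rw [← Finset.sum_range_succ]
  refine lt_of_le_of_lt (Finset.sum_le_card_nsmul _ _ b fun j hj => hg j ?_) (lt_of_le_of_lt ?_ hM)
  · have := Finset.mem_range.1 hj; omega
  · rw [Finset.card_range, smul_eq_mul]
    exact Nat.mul_le_mul_right _ hi

/-- These numbers keep the dropping loop cubic: one look-up tells whether a node has an edge into a
given supernode. -/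
def degree (f : ℕ → ℕ) (A : ℕ → ℕ → ℕ) (n u l : ℕ) : ℕ :=
  ∑ x ∈ Finset.range n, if f x = l then A u x else 0

/-- `g u l` is the number of neighbours of `u` in the supernode with name `l`. -/
def DegRep (n : ℕ) (f : ℕ → ℕ) (A g : ℕ → ℕ → ℕ) : Prop :=
  ∀ u < n, ∀ l < n, g u l = degree f A n u l

def degreesBody : Pr :=
  .assign 5 (.lit 0) ;; .loop 4 0 (.ite (.eq (.get 3 (.lit 0) (.var 4)) (.var 3))
    (.assign 5 (.bin .add (.var 5) (.get 5 (.var 2) (.var 4)))) .skip) ;;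
    .set 6 (.var 2) (.var 3) (.var 5)

def degrees : Pr := .loop 2 0 (.loop 3 0 degreesBody)

theorem Rep.le_one {n : ℕ} {f : ℕ → ℕ → ℕ} {G : SimpleGraph (Fin n)} (h : Rep f G) {u v : ℕ}
    (hu : u < n) (hv : v < n) : f u v ≤ 1 := by
  by_cases huv : G.Adj ⟨u, hu⟩ ⟨v, hv⟩
  · exact ((h _ _).1 huv).le
  · exact ((h _ _).2 huv).le.trans zero_le_one

theorem wp_degrees {n M m : ℕ} {s : St} (hs : s.v 0 = n) (hM : 32 * (n + 1) * (n + 1) ≤ M)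
    {G : SimpleGraph (Fin n)} (hA : Rep (s.a 5) G) :
    wp n M m degrees (fun s' => DegRep n (s.a 3 0) (s.a 5) (s'.a 6)) s := by
  have hM' : n < M ∧ 32 ≤ M := ⟨by nlinarith, by nlinarith⟩
  refine wp_double (fun i j s' => ∀ u < n, ∀ l < n, Before i j u l →
      s'.a 6 u l = degree (s.a 3 0) (s.a 5) n u l)
    hs (by decide) (by decide) (by decide) rfl rfl ?_ ?_ ?_ ?_ ?_
  · rintro i j s' k z (rfl | rfl) h <;> exact h
  · intro u _ v _ hb; exact absurd hb before_zero
  · intro i hi j hj s' hfr hx hy hI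
    have e0 : s'.v 0 = n := (hfr.1 0 rfl).trans hs
    have e5 : s'.a 5 = s.a 5 := hfr.2 5 rfl
    have e3 : s'.a 3 = s.a 3 := hfr.2 3 rfl
    unfold degreesBody
    refine wp_seq.2 ?_
    simp only [wp_ite, wp_seq, wp_skip, wp_assign, wp_set, Ex.ok, Ex.eval, Bx.ok, Bx.Holds,
      WordRAM.Op.eval, setV_v, setV_a, setA_v, setA_a, upd_apply, Nat.reduceEqDiff, ↓reduceIte,
      true_and, and_true,
      show 0 < M by omega]
    refine wp_sum (c := 5) (fun x => if s.a 3 0 x = j then s.a 5 i x else 0) (by simp [e0])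
      (by decide) (by simp) ?_ ?_
    · intro k hk s1 hf1 hx1 hc1
      have f5 : s1.a 5 = s.a 5 := (hf1.2 5 rfl).trans e5
      have f3 : s1.a 3 = s.a 3 := (hf1.2 3 rfl).trans e3
      have f2 : s1.v 2 = i := (hf1.1 2 rfl).trans hx
      have g3 : s1.v 3 = j := (hf1.1 3 rfl).trans hy
      have hb := sum_range_lt (g := fun x => if s.a 3 0 x = j then s.a 5 i x else 0) (b := 1)
        (M := M) (fun x hx => by
          split_ifs
          · exact hA.le_one hi hx
          · exact zero_le_one) hk (by omega)
      rw [← hc1] at hb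
      simp only [wp_ite, wp_seq, wp_skip, wp_assign, wp_set, Ex.ok, Ex.eval, Bx.ok, Bx.Holds,
        WordRAM.Op.eval, setV_v, setV_a, setA_v, setA_a, upd_apply, Nat.reduceEqDiff, ↓reduceIte,
        true_and, and_true,
        hx1, f5, f3, f2, g3, show 0 < M by omega, show 0 < n by omega, hi, hk]
      refine ⟨fun h => ⟨by simpa [h] using hb, by simp [h]⟩, fun h => by simp [h]⟩
    · intro s1 hf1 hc1
      have f2 : s1.v 2 = i := (hf1.1 2 rfl).trans hx
      have g3 : s1.v 3 = j := (hf1.1 3 rfl).trans hy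
      have f6 : s1.a 6 = s'.a 6 := hf1.2 6 rfl
      simp only [wp_ite, wp_seq, wp_skip, wp_assign, wp_set, Ex.ok, Ex.eval, Bx.ok, Bx.Holds,
        WordRAM.Op.eval, setV_v, setV_a, setA_v, setA_a, upd_apply, Nat.reduceEqDiff, ↓reduceIte,
        true_and, and_true,
        f2, g3, hi, hj, f6]
      intro u hu l hl hb
      split_ifs with h
      · rw [hc1, h.1, h.2]; rfl
      · exact hI u hu l hl ((before_succ.1 hb).resolve_right h)
  · intro i hi s' hI u hu l hl hb
    exact hI u hu l hl ((before_row hl).1 hb)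
  · intro s' hfr hI u hu l hl
    exact hI u hu l hl (before_all hu)

/-! #### The dropping loop -/

/-- Delete the edge between the nodes in the variables `x`, `y`. -/
def delEdge (x y : ℕ) : Pr :=
  .set 5 (.var x) (.var y) (.lit 0) ;; .set 5 (.var y) (.var x) (.lit 0) ;;
  .set 6 (.var x) (.get 3 (.lit 0) (.var y))
    (.bin .sub (.get 6 (.var x) (.get 3 (.lit 0) (.var y))) (.lit 1)) ;;
  .set 6 (.var y) (.get 3 (.lit 0) (.var x))
    (.bin .sub (.get 6 (.var y) (.get 3 (.lit 0) (.var x))) (.lit 1))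

/-- Outside row `b`, deleting the edge affects only the entry of `a` at the supernode of `b`. Row
`b` is obtained by exchanging the roles with `upd_comm`. -/
theorem degree_update {f : ℕ → ℕ} {A : ℕ → ℕ → ℕ} {n a b : ℕ} (hb : b < n)
    (hab : a ≠ b) (h1 : A a b = 1) (u l : ℕ) (hu : u ≠ b) :
    degree f (upd (upd A a b 0) b a 0) n u l =
      if u = a ∧ l = f b then degree f A n u l - 1 else degree f A n u l := by
  unfold degree
  have e : ∀ x, upd (upd A a b 0) b a 0 u x = if u = a ∧ x = b then 0 else A u x := by
    intro x; simp [hu]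
  simp only [e]
  split_ifs with h
  · obtain ⟨rfl, rfl⟩ := h
    rw [← Finset.add_sum_erase _ _ (Finset.mem_range.2 hb),
      ← Finset.add_sum_erase (Finset.range n) (fun x => if f x = f b then A u x else 0)
        (Finset.mem_range.2 hb)]
    simp only [true_and, if_true, h1, zero_add, Nat.add_sub_cancel_left]
    refine Finset.sum_congr rfl fun x hx => ?_
    rw [if_neg (Finset.ne_of_mem_erase hx)]
  · refine Finset.sum_congr rfl fun x _ => ?_
    by_cases hx : f x = l
    · rw [if_pos hx, if_pos hx, if_neg]
      rintro ⟨rfl, rfl⟩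
      exact h ⟨rfl, hx.symm⟩
    · rw [if_neg hx, if_neg hx]

theorem upd_comm {A : ℕ → ℕ → ℕ} {a b k : ℕ} :
    upd (upd A a b k) b a k = upd (upd A b a k) a b k := by
  funext i j
  simp only [upd_apply]
  split_ifs <;> rfl

theorem Rep.delete {n : ℕ} {A : ℕ → ℕ → ℕ} {G : SimpleGraph (Fin n)} (hA : Rep A G)
    (a b : Fin n) : Rep (upd (upd A a b 0) b a 0) (G.deleteEdges {s(a, b)}) := by
  intro u v
  simp only [upd_apply, SimpleGraph.deleteEdges_adj, Set.mem_singleton_iff, Sym2.eq_iff,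
    ← Fin.ext_iff]
  have h := hA u v
  by_cases h1 : u = b ∧ v = a <;> by_cases h2 : u = a ∧ v = b <;> simp [h1, h2] <;> tauto

theorem wp_delEdge {n M m : ℕ} {x y : ℕ} {Q : St → Prop} {s : St} (hM : 32 ≤ M)
    {I : Inst (Fin n)} (hf : Labeling I (s.a 3 0)) {G : SimpleGraph (Fin n)} (hA : Rep (s.a 5) G)
    (hd : DegRep n (s.a 3 0) (s.a 5) (s.a 6)) {a b : Fin n} (hx : s.v x = a) (hy : s.v y = b)
    (hab : G.Adj a b)
    (hQ : ∀ s', s'.v = s.v → (∀ t, t ≠ 5 → t ≠ 6 → s'.a t = s.a t) →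
      Rep (s'.a 5) (G.deleteEdges {s(a, b)}) → DegRep n (s'.a 3 0) (s'.a 5) (s'.a 6) → Q s') :
    wp n M m (delEdge x y) Q s := by
  have ha := a.2
  have hb := b.2
  have hfa := hf.lt a ha
  have hfb := hf.lt b hb
  unfold delEdge
  simp only [wp_ite, wp_seq, wp_skip, wp_assign, wp_set, Ex.ok, Ex.eval, Bx.ok, Bx.Holds,
    WordRAM.Op.eval, setV_v, setV_a, setA_v, setA_a, upd_apply, Nat.reduceEqDiff, ↓reduceIte,
    true_and, and_true,
    hx, hy, ha, hb, hfa, hfb, show 0 < M by omega, show 1 < M by omega, show 0 < n by omega]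
  apply hQ
  · rfl
  · intro t h5 h6; simp [h5, h6]
  · simpa using hA.delete a b
  · intro u hu l hl
    have hne : (a : ℕ) ≠ b := fun h => hab.ne (Fin.ext h)
    simp only [setA_a, Nat.reduceEqDiff, ↓reduceIte, upd_apply]
    by_cases hub : u = b
    · have hua : u ≠ a := by omega
      rw [upd_comm, degree_update ha hne.symm ((hA b a).1 hab.symm) u l hua]
      simp only [hub, true_and, hne.symm, false_and, if_false]
      by_cases hl' : l = s.a 3 0 a
      · simp [hl', hd b hb _ hfa]
      · simp [hl', hd b hb _ hl]
    · rw [degree_update hb hne ((hA a b).1 hab) u l hub]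
      simp only [hub, false_and, if_false]
      by_cases hc : u = a ∧ l = s.a 3 0 b
      · simp [hc, hd a ha _ hfb]
      · simp [hc, hd u hu _ hl]

end RamLang

/-! ### One pass of the dropping loop -/

namespace RamLang

open CCC

set_option linter.unusedSimpArgs false

/-- Rule for loops that search for an index with the property `P` and store it in `r`. -/
theorem wp_search {n M m : ℕ} {x r : ℕ} {p : Pr} {Q : St → Prop} {s : St} (P : ℕ → Prop)
    (hs : s.v 0 = n) (hrx : r ≠ x) (h0 : s.v r = n)
    (hstep : ∀ i < n, ∀ s', Frame (.loop x 0 p) s s' → s'.v x = i →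
      wp n M m p (fun s'' => (P i ∧ s''.v r = i) ∨ (¬ P i ∧ s''.v r = s'.v r)) s')
    (hQ : ∀ s', Frame (.loop x 0 p) s s' →
      (s'.v r < n ∧ P (s'.v r)) ∨ (s'.v r = n ∧ ∀ i < n, ¬ P i) → Q s') :
    wp n M m (.loop x 0 p) Q s := by
  refine wp_loop0 (fun i s' => (s'.v r < n ∧ P (s'.v r)) ∨ (s'.v r = n ∧ ∀ j < i, ¬ P j)) hs
    (.inr ⟨h0, by simp⟩) ?_ ?_
  · intro i hi s' hf hI
    refine wp_mono _ _ _ ?_ _ (hstep i hi (s'.setV x i) (hf.trans (Frame.setV_loop _ _ _ _ _))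
      (by simp))
    rintro s'' (⟨h1, h2⟩ | ⟨h1, h2⟩)
    · left; rw [h2]; exact ⟨hi, h1⟩
    · simp only [setV_v, hrx, if_false] at h2
      rw [h2]
      rcases hI with hI | ⟨hI1, hI2⟩
      · exact .inl hI
      · refine .inr ⟨hI1, fun j hj => ?_⟩
        rcases Nat.lt_succ_iff_lt_or_eq.1 hj with hj | rfl
        · exact hI2 j hj
        · exact h1
  · intro s' hf hI
    exact hQ _ (hf.trans (Frame.setV_loop _ _ _ _ _)) (by simpa [hrx] using hI)

/-- Variables `7` and `8` name the supernodes of `u₁` and `u₃`. A candidate `u₂` is recognised by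
its degree, so `u₃'` is sought only after `u₂` is fixed and both searches are linear. The result `n`
means that nothing was found. -/
def searchHostile : Pr :=
  .loop 4 0 (.ite (.eq (.get 4 (.var 7) (.get 3 (.lit 0) (.var 4))) (.lit 1))
    (.ite (.eq (.get 3 (.lit 0) (.var 4)) (.var 8)) .skip
      (.ite (.lt (.lit 0) (.get 6 (.var 4) (.var 8))) (.assign 5 (.var 4)) .skip)) .skip)

def searchNeighbour : Pr :=
  .loop 4 0 (.ite (.eq (.get 3 (.lit 0) (.var 4)) (.var 8))
    (.ite (.eq (.get 5 (.var 5) (.var 4)) (.lit 1)) (.assign 6 (.var 4)) .skip) .skip)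

def dropBody : Pr :=
  .ite (.eq (.get 5 (.var 2) (.var 3)) (.lit 1))
    (.assign 5 (.var 0) ;; .assign 6 (.var 0) ;; .assign 7 (.get 3 (.lit 0) (.var 2)) ;;
      .assign 8 (.get 3 (.lit 0) (.var 3)) ;;
      .ite (.eq (.var 7) (.var 8)) .skip
        (searchHostile ;; .ite (.lt (.var 5) (.var 0))
          (searchNeighbour ;; delEdge 2 3 ;; delEdge 5 6) .skip))
    .skip

def dropLoop : Pr := .loop 2 0 (.loop 3 0 dropBody)

theorem wp_searchHostile {n M m : ℕ} {s : St} (hs : s.v 0 = n) (hM : 32 ≤ M)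
    (hf : ∀ u < n, s.a 3 0 u < n) (h5 : s.v 5 = n) (h7 : s.v 7 < n) (h8 : s.v 8 < n)
    {Q : St → Prop}
    (hQ : ∀ s', Frame searchHostile s s' →
      (s'.v 5 < n ∧ (s.a 4 (s.v 7) (s.a 3 0 (s'.v 5)) = 1 ∧ s.a 3 0 (s'.v 5) ≠ s.v 8 ∧
        0 < s.a 6 (s'.v 5) (s.v 8))) ∨
      (s'.v 5 = n ∧ ∀ i < n, ¬ (s.a 4 (s.v 7) (s.a 3 0 i) = 1 ∧ s.a 3 0 i ≠ s.v 8 ∧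
        0 < s.a 6 i (s.v 8))) → Q s') :
    wp n M m searchHostile Q s := by
  refine wp_search (r := 5) (fun i => s.a 4 (s.v 7) (s.a 3 0 i) = 1 ∧ s.a 3 0 i ≠ s.v 8 ∧
        0 < s.a 6 i (s.v 8)) hs (by decide) h5 ?_ hQ
  intro i hi s' hfr hx
  have e4 : s'.a 4 = s.a 4 := hfr.2 4 rfl
  have e3 : s'.a 3 = s.a 3 := hfr.2 3 rfl
  have e6 : s'.a 6 = s.a 6 := hfr.2 6 rfl
  have e7 : s'.v 7 = s.v 7 := hfr.1 7 rfl
  have e8 : s'.v 8 = s.v 8 := hfr.1 8 rfl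
  simp only [wp_ite, wp_seq, wp_skip, wp_assign, wp_set, Ex.ok, Ex.eval, Bx.ok, Bx.Holds,
    WordRAM.Op.eval, setV_v, setV_a, setA_v, setA_a, upd_apply, Nat.reduceEqDiff, ↓reduceIte,
    true_and, and_true,
    hx, e4, e3, e6, e7, e8, hi, hf i hi, h7, h8, show 0 < M by omega, show 1 < M by omega,
    show 0 < n by omega]
  refine ⟨fun h1 => ⟨fun h2 => ?_, fun h2 => ⟨fun h3 => ?_, fun h3 => ?_⟩⟩, fun h1 => ?_⟩ <;> tauto

theorem wp_searchNeighbour {n M m : ℕ} {s : St} (hs : s.v 0 = n) (hM : 32 ≤ M)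
    (h6 : s.v 6 = n) (h5 : s.v 5 < n) {Q : St → Prop}
    (hQ : ∀ s', Frame searchNeighbour s s' →
      (s'.v 6 < n ∧ (s.a 3 0 (s'.v 6) = s.v 8 ∧ s.a 5 (s.v 5) (s'.v 6) = 1)) ∨
      (s'.v 6 = n ∧ ∀ i < n, ¬ (s.a 3 0 i = s.v 8 ∧ s.a 5 (s.v 5) i = 1)) → Q s') :
    wp n M m searchNeighbour Q s := by
  refine wp_search (r := 6) (fun i => s.a 3 0 i = s.v 8 ∧ s.a 5 (s.v 5) i = 1) hs (by decide) h6
    ?_ hQ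
  intro i hi s' hfr hx
  have e3 : s'.a 3 = s.a 3 := hfr.2 3 rfl
  have e5 : s'.a 5 = s.a 5 := hfr.2 5 rfl
  have e8 : s'.v 8 = s.v 8 := hfr.1 8 rfl
  have f5 : s'.v 5 = s.v 5 := hfr.1 5 rfl
  simp only [wp_ite, wp_seq, wp_skip, wp_assign, wp_set, Ex.ok, Ex.eval, Bx.ok, Bx.Holds,
    WordRAM.Op.eval, setV_v, setV_a, setA_v, setA_a, upd_apply, Nat.reduceEqDiff, ↓reduceIte,
    true_and, and_true,
    hx, e3, e5, e8, f5, hi, h5, show 0 < M by omega, show 1 < M by omega,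
    show 0 < n by omega]
  refine ⟨fun h1 => ⟨fun h2 => ?_, fun h2 => ?_⟩, fun h1 => ?_⟩ <;> tauto

/-- The edge `u₁ u₃` can be dropped together with another edge. -/
def Droppable {n : ℕ} (I : Inst (Fin n)) (X : SimpleGraph (Fin n)) (u₁ u₃ : Fin n) : Prop :=
  ∃ u₂ u₃' : Fin n, I.s u₃' = I.s u₃ ∧ I.s u₁ ≠ I.s u₃ ∧ I.s u₂ ≠ I.s u₃ ∧
    I.Hostile (I.s u₁) (I.s u₂) ∧ X.Adj u₂ u₃'

/-- Deleting edges creates no new opportunity to drop. A pair that has been treated stays settled,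
so one pass over all pairs `u₁`, `u₃` completes the loop. -/
theorem Droppable.mono {n : ℕ} {I : Inst (Fin n)} {X Y : SimpleGraph (Fin n)} (hXY : X ≤ Y)
    {u₁ u₃ : Fin n} (h : Droppable I X u₁ u₃) : Droppable I Y u₁ u₃ := by
  obtain ⟨a, b, h1, h2, h3, h4, h5⟩ := h
  exact ⟨a, b, h1, h2, h3, h4, hXY h5⟩

theorem degree_pos {n : ℕ} {f : ℕ → ℕ} {A : ℕ → ℕ → ℕ} {G : SimpleGraph (Fin n)} (hA : Rep A G)
    (u : Fin n) (l : ℕ) : 0 < degree f A n u l ↔ ∃ x : Fin n, f x = l ∧ G.Adj u x := by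
  unfold degree
  constructor
  · intro h
    obtain ⟨x, hx, hne⟩ := Finset.exists_ne_zero_of_sum_ne_zero h.ne'
    have hx' := Finset.mem_range.1 hx
    have h1 : f x = l := by
      by_contra h1; simp [h1] at hne
    simp only [h1, if_true] at hne
    refine ⟨⟨x, hx'⟩, h1, ?_⟩
    by_contra h2
    exact hne ((hA u ⟨x, hx'⟩).2 h2)
  · rintro ⟨x, h1, h2⟩
    refine Finset.sum_pos' (fun _ _ => Nat.zero_le _) ⟨x, Finset.mem_range.2 x.2, ?_⟩
    simp [h1, (hA u x).1 h2]

theorem wp_dropLoop {n M m : ℕ} {s : St} (hs : s.v 0 = n) (hM : 32 ≤ M) {I : Inst (Fin n)}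
    (hf : Labeling I (s.a 3 0)) (hH : HosRep I (s.a 3 0) (s.a 4))
    (hself : ¬ ∃ U, I.Hostile U U) (hA : Rep (s.a 5) I.E₂)
    (hd : DegRep n (s.a 3 0) (s.a 5) (s.a 6)) :
    wp n M m dropLoop (fun s' => ∃ X, I.IsDropResult X ∧ Rep (s'.a 5) X ∧
      DegRep n (s'.a 3 0) (s'.a 5) (s'.a 6)) s := by
  refine wp_double (fun i j s' => ∃ X, Relation.ReflTransGen I.DropStep I.E₂ X ∧ Rep (s'.a 5) X ∧
      DegRep n (s'.a 3 0) (s'.a 5) (s'.a 6) ∧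
      ∀ u₁ u₃ : Fin n, Before i j u₁ u₃ → X.Adj u₁ u₃ → ¬ Droppable I X u₁ u₃)
    hs (by decide) (by decide) (by decide) rfl rfl ?_ ?_ ?_ ?_ ?_
  · rintro i j s' k z (rfl | rfl) h <;> exact h
  · exact ⟨_, .refl, hA, hd, fun u v hb => absurd hb before_zero⟩
  · intro i hi j hj s' hfr hx hy ⟨X, hX, hAX, hdX, hI⟩
    have e0 : s'.v 0 = n := (hfr.1 0 rfl).trans hs
    have e3 : s'.a 3 = s.a 3 := hfr.2 3 rfl
    have e4 : s'.a 4 = s.a 4 := hfr.2 4 rfl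
    have hfi := hf.lt i hi
    have hfj := hf.lt j hj
    have hadj := hAX.eq_one ⟨i, hi⟩ ⟨j, hj⟩
    simp only at hadj
    have keep : (X.Adj ⟨i, hi⟩ ⟨j, hj⟩ → ¬ Droppable I X ⟨i, hi⟩ ⟨j, hj⟩) →
        ∀ u₁ u₃ : Fin n, Before i (j + 1) u₁ u₃ → X.Adj u₁ u₃ → ¬ Droppable I X u₁ u₃ := by
      intro h u₁ u₃ hb
      rcases before_succ.1 hb with hb | ⟨h1, h3⟩
      · exact hI u₁ u₃ hb
      · rw [show u₁ = ⟨i, hi⟩ from Fin.ext h1, show u₃ = ⟨j, hj⟩ from Fin.ext h3]; exact h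
    unfold dropBody
    simp only [wp_ite, wp_seq, wp_skip, wp_assign, wp_set, Ex.ok, Ex.eval, Bx.ok, Bx.Holds,
      WordRAM.Op.eval, setV_v, setV_a, setA_v, setA_a, upd_apply, Nat.reduceEqDiff, ↓reduceIte,
      true_and, and_true,
      hx, hy, e0, e3, hadj, show 0 < M by omega, show 1 < M by omega, show 0 < n by omega,
      hi, hj, hfi, hfj]
    refine ⟨fun ha => ⟨fun hl => ?_, fun hl => ?_⟩, fun ha => ?_⟩
    · refine ⟨X, hX, hAX, by rw [← e3]; exact hdX, keep fun _ => ?_⟩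
      rintro ⟨_, _, _, hne, _⟩
      exact hne ((hf.iff _ _).1 hl)
    · refine wp_searchHostile (by simp [e0]) hM (by simpa [e3] using hf.lt) (by simp)
        (by simpa using hfi) (by simpa using hfj) ?_
      intro s1 hf1 hsr
      simp only [setV_v, setV_a, Nat.reduceEqDiff, ↓reduceIte, e3, e4] at hsr
      have g0 : s1.v 0 = n := (hf1.1 0 rfl).trans e0
      have g2 : s1.v 2 = i := (hf1.1 2 rfl).trans hx
      have g3 : s1.v 3 = j := (hf1.1 3 rfl).trans hy
      have g6 : s1.v 6 = n := hf1.1 6 rfl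
      have g8 : s1.v 8 = s.a 3 0 j := hf1.1 8 rfl
      have k3 : s1.a 3 = s.a 3 := (hf1.2 3 rfl).trans e3
      have k5 : s1.a 5 = s'.a 5 := hf1.2 5 rfl
      have k6 : s1.a 6 = s'.a 6 := hf1.2 6 rfl
      simp only [wp_ite, wp_seq, wp_skip, wp_assign, wp_set, Ex.ok, Ex.eval, Bx.ok, Bx.Holds,
        WordRAM.Op.eval, setV_v, setV_a, setA_v, setA_a, upd_apply, Nat.reduceEqDiff, ↓reduceIte,
        true_and, and_true,
        g0]
      refine ⟨fun hlt => ?_, fun hge => ?_⟩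
      · obtain ⟨_, hh, hne, hdeg⟩ := hsr.resolve_right (by omega)
        set u₂ : Fin n := ⟨s1.v 5, hlt⟩ with hu₂
        have hh' := (hH ⟨i, hi⟩ u₂).1 hh
        rw [hdX _ hlt _ hfj, e3] at hdeg
        obtain ⟨x, hx1, hx2⟩ := (degree_pos hAX u₂ _).1 hdeg
        refine wp_searchNeighbour g0 hM g6 hlt ?_
        intro s2 hf2 hsr2
        rw [k3, k5, g8] at hsr2
        have l2 : s2.v 2 = i := (hf2.1 2 rfl).trans g2
        have l3 : s2.v 3 = j := (hf2.1 3 rfl).trans g3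
        have l5 : s2.v 5 = u₂ := hf2.1 5 rfl
        have m3 : s2.a 3 = s.a 3 := (hf2.2 3 rfl).trans k3
        have m5 : s2.a 5 = s'.a 5 := (hf2.2 5 rfl).trans k5
        have m6 : s2.a 6 = s'.a 6 := (hf2.2 6 rfl).trans k6
        obtain ⟨hlt6, hl6, ha6⟩ := hsr2.resolve_right fun hno =>
          hno.2 x x.2 ⟨hx1, (hAX u₂ x).1 hx2⟩
        set u₃' : Fin n := ⟨s2.v 6, hlt6⟩ with hu₃'
        have hadj2 : X.Adj u₂ u₃' := (hAX.eq_one u₂ u₃').1 ha6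
        have hs13 : I.s ⟨i, hi⟩ ≠ I.s ⟨j, hj⟩ := fun h => hl ((hf.iff _ _).2 h)
        have hs23 : I.s u₂ ≠ I.s ⟨j, hj⟩ := fun h => hne ((hf.iff u₂ ⟨j, hj⟩).2 h)
        have hs33 : I.s u₃' = I.s ⟨j, hj⟩ := (hf.iff u₃' ⟨j, hj⟩).1 hl6
        have hs12 : I.s ⟨i, hi⟩ ≠ I.s u₂ := fun h => hself ⟨_, by rw [← h] at hh'; exact hh'⟩
        refine wp_delEdge (I := I) (a := ⟨i, hi⟩) (b := ⟨j, hj⟩) hM (by rw [m3]; exact hf)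
          (by rw [m5]; exact hAX) (by rw [m3, m5, m6, ← e3]; exact hdX) l2 l3 ha ?_
        intro s3 hv3 ha3 hr3 hd3
        refine wp_delEdge (I := I) (a := u₂) (b := u₃') hM (by rw [ha3 3 (by decide) (by decide), m3]; exact hf)
          hr3 hd3 (by rw [hv3, l5]) (by rw [hv3]) ?_ ?_
        · rw [SimpleGraph.deleteEdges_adj, Set.mem_singleton_iff, Sym2.eq_iff]
          refine ⟨hadj2, ?_⟩
          rintro (⟨h1, _⟩ | ⟨h1, _⟩)
          · exact hs12 (by rw [h1])
          · exact hs23 (by rw [h1])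
        · intro s4 hv4 ha4 hr4 hd4
          rw [SimpleGraph.deleteEdges_deleteEdges] at hr4
          set Y := X.deleteEdges ({s(⟨i, hi⟩, ⟨j, hj⟩)} ∪ {s(u₂, u₃')}) with hY
          have hYX : Y ≤ X := SimpleGraph.deleteEdges_le _
          refine ⟨Y, hX.tail ⟨⟨i, hi⟩, u₂, ⟨j, hj⟩, u₃', hs33, hs12, hs13, hs23, hh', ha, hadj2, rfl⟩,
            hr4, hd4, ?_⟩
          -- Earlier pairs remain settled by monotonicity; the edge at the current pair has just
          -- been deleted.
          intro u₁ u₃ hb had hdr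
          rcases before_succ.1 hb with hb | ⟨h1, h3⟩
          · exact hI u₁ u₃ hb (hYX had) (hdr.mono hYX)
          · rw [show u₁ = ⟨i, hi⟩ from Fin.ext h1, show u₃ = ⟨j, hj⟩ from Fin.ext h3, hY,
              SimpleGraph.deleteEdges_adj] at had
            exact had.2 (.inl rfl)
      · obtain ⟨_, hno⟩ := hsr.resolve_left (fun h => hge h.1)
        refine ⟨X, hX, by rw [k5]; exact hAX, by rw [k3, k5, k6, ← e3]; exact hdX,
          keep fun _ => ?_⟩
        rintro ⟨u₂, u₃', h1, h2, h3, h4, h5⟩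
        refine hno u₂ u₂.2 ⟨(hH ⟨i, hi⟩ u₂).2 h4, fun h => h3 ((hf.iff u₂ ⟨j, hj⟩).1 h), ?_⟩
        rw [hdX _ u₂.2 _ hfj, e3]
        exact (degree_pos hAX u₂ _).2 ⟨u₃', (hf.iff u₃' ⟨j, hj⟩).2 h1, h5⟩
    · exact ⟨X, hX, hAX, by rw [← e3]; exact hdX, keep fun h => absurd h ha⟩
  · rintro i hi s' ⟨X, h1, h2, h3, h4⟩
    exact ⟨X, h1, h2, h3, fun u₁ u₃ hb => h4 u₁ u₃ ((before_row u₃.2).1 hb)⟩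
  · rintro s' hfr ⟨X, h1, h2, h3, h4⟩
    refine ⟨X, ⟨h1, ?_⟩, h2, h3⟩
    rintro B ⟨u₁, u₂, u₃, u₃', c1, c2, c3, c4, c5, c6, c7, -⟩
    exact h4 u₁ u₃ (before_all u₁.2) c6 ⟨u₂, u₃', c1, c3, c4, c5, c7⟩

/-! #### Rounding -/

def sizesBody : Pr :=
  .assign 5 (.lit 0) ;; .loop 4 0 (.ite (.eq (.get 3 (.lit 0) (.var 4)) (.var 2))
    (.assign 5 (.bin .add (.var 5) (.lit 1))) .skip) ;;
    .set 8 (.lit 0) (.var 2) (.var 5)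

def sizes : Pr := .loop 2 0 sizesBody

def countsBody : Pr :=
  .assign 5 (.lit 0) ;; .loop 4 0 (.ite (.eq (.get 3 (.lit 0) (.var 4)) (.var 2))
    (.assign 5 (.bin .add (.var 5) (.get 6 (.var 4) (.var 3)))) .skip) ;;
    .set 7 (.var 2) (.var 3) (.var 5)

def counts : Pr := .loop 2 0 (.loop 3 0 countsBody)

theorem wp_sizes {n M m : ℕ} {s : St} (hs : s.v 0 = n) (hM : 32 * (n + 1) * (n + 1) ≤ M) :
    wp n M m sizes (fun s' => ∀ l < n, s'.a 8 0 l =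
      ∑ x ∈ Finset.range n, if s.a 3 0 x = l then 1 else 0) s := by
  have hM' : n < M ∧ 32 ≤ M := ⟨by nlinarith, by nlinarith⟩
  refine wp_loop0 (fun i s' => ∀ l < i, s'.a 8 0 l =
      ∑ x ∈ Finset.range n, if s.a 3 0 x = l then 1 else 0) hs (by simp) ?_ ?_
  · intro i hi s' hfr hI
    have e0 : s'.v 0 = n := (hfr.1 0 rfl).trans hs
    have e3 : s'.a 3 = s.a 3 := hfr.2 3 rfl
    unfold sizesBody
    refine wp_seq.2 ?_
    simp only [wp_ite, wp_seq, wp_skip, wp_assign, wp_set, Ex.ok, Ex.eval, Bx.ok, Bx.Holds,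
      WordRAM.Op.eval, setV_v, setV_a, setA_v, setA_a, upd_apply, Nat.reduceEqDiff, ↓reduceIte,
      true_and, and_true,
      show 0 < M by omega]
    refine wp_sum (c := 5) (fun x => if s.a 3 0 x = i then 1 else 0) (by simp [e0])
      (by decide) (by simp) ?_ ?_
    · intro k hk s1 hf1 hx1 hc1
      have f3 : s1.a 3 = s.a 3 := (hf1.2 3 rfl).trans e3
      have f2 : s1.v 2 = i := hf1.1 2 rfl
      have hb := sum_range_lt (g := fun x => if s.a 3 0 x = i then 1 else 0) (b := 1)
        (M := M) (fun x hx => by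
          split_ifs
          · exact le_rfl
          · exact zero_le_one) hk (by omega)
      rw [← hc1] at hb
      simp only [wp_ite, wp_seq, wp_skip, wp_assign, wp_set, Ex.ok, Ex.eval, Bx.ok, Bx.Holds,
        WordRAM.Op.eval, setV_v, setV_a, setA_v, setA_a, upd_apply, Nat.reduceEqDiff, ↓reduceIte,
        true_and, and_true,
        hx1, f3, f2, show 0 < M by omega, show 1 < M by omega, show 0 < n by omega, hi, hk]
      refine ⟨fun h => ⟨by simpa [h] using hb, by simp [h]⟩, fun h => by simp [h]⟩
    · intro s1 hf1 hc1
      have f2 : s1.v 2 = i := hf1.1 2 rfl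
      have f8 : s1.a 8 = s'.a 8 := hf1.2 8 rfl
      simp only [wp_ite, wp_seq, wp_skip, wp_assign, wp_set, Ex.ok, Ex.eval, Bx.ok, Bx.Holds,
        WordRAM.Op.eval, setV_v, setV_a, setA_v, setA_a, upd_apply, Nat.reduceEqDiff, ↓reduceIte,
        true_and, and_true,
        f2, hi, f8, show 0 < M by omega, show 0 < n by omega]
      intro l hl
      split_ifs with h
      · rw [hc1, h]
      · exact hI l (by omega)
  · intro s' hfr hI
    exact hI

theorem wp_counts {n M m : ℕ} {s : St} (hs : s.v 0 = n) (hM : 32 * (n + 1) * (n + 1) ≤ M)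
    (hb : ∀ u < n, ∀ l < n, s.a 6 u l ≤ n) :
    wp n M m counts (fun s' => ∀ l < n, ∀ l' < n, s'.a 7 l l' =
      ∑ x ∈ Finset.range n, if s.a 3 0 x = l then s.a 6 x l' else 0) s := by
  have hM' : n * n < M ∧ 32 ≤ M := ⟨by nlinarith, by nlinarith⟩
  refine wp_double (fun i j s' => ∀ u < n, ∀ l < n, Before i j u l →
      s'.a 7 u l = ∑ x ∈ Finset.range n, if s.a 3 0 x = u then s.a 6 x l else 0)
    hs (by decide) (by decide) (by decide) rfl rfl ?_ ?_ ?_ ?_ ?_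
  · rintro i j s' k z (rfl | rfl) h <;> exact h
  · intro u _ v _ hb; exact absurd hb before_zero
  · intro i hi j hj s' hfr hx hy hI
    have e0 : s'.v 0 = n := (hfr.1 0 rfl).trans hs
    have e6 : s'.a 6 = s.a 6 := hfr.2 6 rfl
    have e3 : s'.a 3 = s.a 3 := hfr.2 3 rfl
    unfold countsBody
    refine wp_seq.2 ?_
    simp only [wp_ite, wp_seq, wp_skip, wp_assign, wp_set, Ex.ok, Ex.eval, Bx.ok, Bx.Holds,
      WordRAM.Op.eval, setV_v, setV_a, setA_v, setA_a, upd_apply, Nat.reduceEqDiff, ↓reduceIte,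
      true_and, and_true,
      show 0 < M by omega]
    refine wp_sum (c := 5) (fun x => if s.a 3 0 x = i then s.a 6 x j else 0) (by simp [e0])
      (by decide) (by simp) ?_ ?_
    · intro k hk s1 hf1 hx1 hc1
      have f5 : s1.a 6 = s.a 6 := (hf1.2 6 rfl).trans e6
      have f3 : s1.a 3 = s.a 3 := (hf1.2 3 rfl).trans e3
      have f2 : s1.v 2 = i := (hf1.1 2 rfl).trans hx
      have g3 : s1.v 3 = j := (hf1.1 3 rfl).trans hy
      have hb := sum_range_lt (g := fun x => if s.a 3 0 x = i then s.a 6 x j else 0) (b := n)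
        (M := M) (fun x hx => by
          split_ifs
          · exact hb x hx j hj
          · exact Nat.zero_le _) hk hM'.1
      rw [← hc1] at hb
      simp only [wp_ite, wp_seq, wp_skip, wp_assign, wp_set, Ex.ok, Ex.eval, Bx.ok, Bx.Holds,
        WordRAM.Op.eval, setV_v, setV_a, setA_v, setA_a, upd_apply, Nat.reduceEqDiff, ↓reduceIte,
        true_and, and_true,
        hx1, f5, f3, f2, g3, show 0 < M by omega, show 0 < n by omega, hi, hk, hj]
      refine ⟨fun h => ⟨by simpa [h] using hb, by simp [h]⟩, fun h => by simp [h]⟩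
    · intro s1 hf1 hc1
      have f2 : s1.v 2 = i := (hf1.1 2 rfl).trans hx
      have g3 : s1.v 3 = j := (hf1.1 3 rfl).trans hy
      have f6 : s1.a 7 = s'.a 7 := hf1.2 7 rfl
      simp only [wp_ite, wp_seq, wp_skip, wp_assign, wp_set, Ex.ok, Ex.eval, Bx.ok, Bx.Holds,
        WordRAM.Op.eval, setV_v, setV_a, setA_v, setA_a, upd_apply, Nat.reduceEqDiff, ↓reduceIte,
        true_and, and_true,
        f2, g3, hi, hj, f6]
      intro u hu l hl hb
      split_ifs with h
      · rw [hc1, h.1, h.2]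
      · exact hI u hu l hl ((before_succ.1 hb).resolve_right h)
  · intro i hi s' hI u hu l hl hb
    exact hI u hu l hl ((before_row hl).1 hb)
  · intro s' hfr hI u hu l hl
    exact hI u hu l hl (before_all hu)

end RamLang

/-! ### Programs: the transformed graph -/

namespace RamLang

open CCC

set_option linter.unusedSimpArgs false

/-- The inequality says `3 * N - 2 * c < √5 * N`. Because `c ≤ N`, the truncated difference is exact
and both sides are nonnegative; squaring gives an exact integer test. -/
theorem lt_golden_iff {N c : ℕ} (h : c ≤ N) :
    (3 - √5) / 2 * (N : ℝ) < c ↔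
      (3 * N - 2 * c) * (3 * N - 2 * c) < 5 * (N * N) := by
  obtain ⟨d, hd⟩ : ∃ d, 3 * N = 2 * c + d := ⟨3 * N - 2 * c, by omega⟩
  have e : 3 * N - 2 * c = d := by omega
  have hd' : (3 * N : ℝ) = 2 * c + d := by exact_mod_cast hd
  have h5 : √5 * N = √(5 * (N * N)) := by
    rw [Real.sqrt_mul (by norm_num), Real.sqrt_mul_self (Nat.cast_nonneg _)]
  have h1 : (3 - √5) / 2 * (N : ℝ) < c ↔ (d : ℝ) < √5 * N := by
    constructor <;> intro h <;> nlinarith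
  rw [h1, e, h5, Real.lt_sqrt (Nat.cast_nonneg _), sq]
  norm_cast

theorem between_le {n : ℕ} {I : Inst (Fin n)} {A : SimpleGraph (Fin n)} {U W : I.SN}
    (hUW : U ≠ W) : I.between A U W ≤ U.supp.ncard * W.supp.ncard := by
  rw [Inst.between_eq_sum hUW, Inst.card_block]
  refine Finset.sum_le_sum fun p _ => ?_
  split_ifs <;> simp_all

theorem ncard_le {n : ℕ} {I : Inst (Fin n)} (U : I.SN) : U.supp.ncard ≤ n := by
  simpa using Set.ncard_le_ncard (Set.subset_univ U.supp)

theorem Labeling.size_eq {n : ℕ} {I : Inst (Fin n)} {f : ℕ → ℕ} (hf : Labeling I f) (u : Fin n) :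
    (∑ x ∈ Finset.range n, if f x = f u then 1 else 0) = (I.s u).supp.ncard := by
  rw [Finset.sum_range fun x => if f x = f u then 1 else 0, Finset.sum_boole,
    ← Set.ncard_coe_finset]
  simp only [hf.iff, Nat.cast_id]
  congr 1
  ext x
  simp [SimpleGraph.ConnectedComponent.mem_supp_iff, hf.iff]

theorem Labeling.count_eq {n : ℕ} {I : Inst (Fin n)} {f : ℕ → ℕ} (hf : Labeling I f)
    {X : SimpleGraph (Fin n)} {A g : ℕ → ℕ → ℕ} (hA : Rep A X) (hg : DegRep n f A g) {u v : Fin n}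
    (huv : I.s u ≠ I.s v) :
    (∑ x ∈ Finset.range n, if f x = f u then g x (f v) else 0) =
      I.between X (I.s u) (I.s v) := by
  classical
  rw [Inst.between_eq_sum huv, Finset.sum_range fun x => if f x = f u then g x (f v) else 0,
    Fintype.sum_prod_type]
  refine Finset.sum_congr rfl fun x _ => ?_
  rw [hg x x.2 _ (hf.lt _ v.2), degree, Finset.sum_range fun y => if f y = f v then A x y else 0]
  simp only [hf.iff]
  split_ifs with h
  · refine Finset.sum_congr rfl fun y _ => ?_
    by_cases hy : I.s y = I.s v
    · by_cases hxy : X.Adj x y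
      · simp [h, hy, hxy, (hA x y).1 hxy]
      · simp [hy, hxy, (hA x y).2 hxy]
    · simp [hy]
  · simp [h]

/-- Everything that occurs in the squared test is at most `9 * N ^ 2` or linear in `N`, and `N ≤ n ^
2`. -/
theorem round_bounds {n M N c : ℕ} (hM : 32 * (n + 1) * (n + 1) ≤ M)
    (hM4 : 9 * (n * n) * (n * n) < M) (hN : N ≤ n * n) (hc : c ≤ N) :
    N < M ∧ 3 * N < M ∧ 2 * c < M ∧ (3 * N - 2 * c) * (3 * N - 2 * c) < M ∧ N * N < M ∧
      5 * (N * N) < M := by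
  have hk3 : 3 * (n * n) < M := by nlinarith
  have hd : 3 * N - 2 * c ≤ 3 * N := Nat.sub_le _ _
  have hd2 := Nat.mul_le_mul hd hd
  have hN2 := Nat.mul_le_mul hN hN
  have e : 9 * (n * n) * (n * n) = 9 * ((n * n) * (n * n)) := by ring
  have e' : 3 * N * (3 * N) = 9 * (N * N) := by ring
  rw [e] at hM4
  rw [e'] at hd2
  generalize (n * n) * (n * n) = K at *
  generalize n * n = k at *
  generalize N * N = K' at *
  generalize (3 * N - 2 * c) * (3 * N - 2 * c) = z at *
  refine ⟨?_, ?_, ?_, ?_, ?_, ?_⟩ <;> omega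

def roundBody : Pr :=
  .ite (.eq (.var 2) (.var 3)) (.set 9 (.var 2) (.var 3) (.lit 3))
    (.ite (.eq (.get 3 (.lit 0) (.var 2)) (.get 3 (.lit 0) (.var 3)))
      (.set 9 (.var 2) (.var 3) (.lit 1))
      (.assign 4 (.bin .mul (.get 8 (.lit 0) (.get 3 (.lit 0) (.var 2)))
          (.get 8 (.lit 0) (.get 3 (.lit 0) (.var 3)))) ;;
        .assign 5 (.bin .sub (.bin .mul (.lit 3) (.var 4)) (.bin .mul (.lit 2)
          (.get 7 (.get 3 (.lit 0) (.var 2)) (.get 3 (.lit 0) (.var 3))))) ;;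
        .ite (.lt (.bin .mul (.var 5) (.var 5)) (.bin .mul (.lit 5) (.bin .mul (.var 4) (.var 4))))
          (.set 9 (.var 2) (.var 3) (.lit 1)) (.set 9 (.var 2) (.var 3) (.lit 0))))

def rounding : Pr := .loop 2 0 (.loop 3 0 roundBody)

/-- `g` is the matrix encoding of the graph `G`. -/
def CodeRep {n : ℕ} (g : ℕ → ℕ → ℕ) (G : SimpleGraph (Fin n)) : Prop :=
  ∀ u v : Fin n, g u v = code G u v

theorem wp_rounding {n M m : ℕ} {s : St} (hs : s.v 0 = n) (hM : 32 * (n + 1) * (n + 1) ≤ M)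
    (hM4 : 9 * (n * n) * (n * n) < M)
    {I : Inst (Fin n)} (hf : Labeling I (s.a 3 0)) {X : SimpleGraph (Fin n)}
    (hX : ∀ u v, I.s u = I.s v → u ≠ v → X.Adj u v)
    (h8 : ∀ u : Fin n, s.a 8 0 (s.a 3 0 u) = (I.s u).supp.ncard)
    (h7 : ∀ u v : Fin n, I.s u ≠ I.s v →
      s.a 7 (s.a 3 0 u) (s.a 3 0 v) = I.between X (I.s u) (I.s v)) :
    wp n M m rounding (fun s' => CodeRep (s'.a 9) (I.round X)) s := by
  have hM' : 32 ≤ M := by nlinarith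
  refine wp_double (fun i j s' => ∀ u v : Fin n, Before i j u v →
      s'.a 9 u v = code (I.round X) u v)
    hs (by decide) (by decide) (by decide) rfl rfl ?_ ?_ ?_ ?_ ?_
  · rintro i j s' k z (rfl | rfl) h <;> exact h
  · intro u v hb; exact absurd hb before_zero
  · intro i hi j hj s' hfr hx hy hI
    have e3 : s'.a 3 = s.a 3 := hfr.2 3 rfl
    have e7 : s'.a 7 = s.a 7 := hfr.2 7 rfl
    have e8 : s'.a 8 = s.a 8 := hfr.2 8 rfl
    have hfi := hf.lt i hi
    have hfj := hf.lt j hj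
    have key : ∀ k, k = code (I.round X) ⟨i, hi⟩ ⟨j, hj⟩ →
        ∀ u v : Fin n, Before i (j + 1) u v →
        (if (u : ℕ) = i ∧ (v : ℕ) = j then k else s'.a 9 u v) = code (I.round X) u v := by
      intro k hk u v hb
      split_ifs with h
      · have hu : u = ⟨i, hi⟩ := Fin.ext h.1
        have hv : v = ⟨j, hj⟩ := Fin.ext h.2
        rw [hu, hv]; exact hk
      · exact hI u v ((before_succ.1 hb).resolve_right h)
    have b8i := h8 ⟨i, hi⟩
    have b8j := h8 ⟨j, hj⟩
    have b7 := h7 ⟨i, hi⟩ ⟨j, hj⟩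
    have hls := hf.iff ⟨i, hi⟩ ⟨j, hj⟩
    simp only at b8i b8j b7 hls
    have c1 := ncard_le (I.s ⟨i, hi⟩)
    have c2 := ncard_le (I.s ⟨j, hj⟩)
    have hle := between_le (A := X) (U := I.s ⟨i, hi⟩) (W := I.s ⟨j, hj⟩)
    have hgold := lt_golden_iff (N := (I.s ⟨i, hi⟩).supp.ncard * (I.s ⟨j, hj⟩).supp.ncard)
      (c := I.between X (I.s ⟨i, hi⟩) (I.s ⟨j, hj⟩))
    have hcode := code_eq_one (G := I.round X) (u := ⟨i, hi⟩) (v := ⟨j, hj⟩)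
    have hcode0 := code_eq_zero (G := I.round X) (u := ⟨i, hi⟩) (v := ⟨j, hj⟩)
    rw [Inst.round_adj, Inst.Dense, mul_assoc, ← Nat.cast_mul] at hcode hcode0
    simp only [ne_eq, ← hls] at b7 hcode hcode0 hle
    have hN := Nat.mul_le_mul c1 c2
    have hb8 : s.a 8 0 (s.a 3 0 i) * s.a 8 0 (s.a 3 0 j) =
        (I.s ⟨i, hi⟩).supp.ncard * (I.s ⟨j, hj⟩).supp.ncard := by rw [b8i, b8j]
    unfold roundBody
    generalize (I.s ⟨i, hi⟩).supp.ncard * (I.s ⟨j, hj⟩).supp.ncard = N at *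
    simp only [wp_ite, wp_seq, wp_skip, wp_assign, wp_set, Ex.ok, Ex.eval, Bx.ok, Bx.Holds,
      WordRAM.Op.eval, setV_v, setV_a, setA_v, setA_a, upd_apply, Nat.reduceEqDiff, ↓reduceIte,
      true_and, and_true,
      hx, hy, e3, e7, e8, show 0 < M by omega, show 1 < M by omega, show 0 < n by omega,
      show 2 < M by omega, show 3 < M by omega, show 5 < M by omega, hi, hj, hfi, hfj, hb8]
    refine ⟨fun h => key _ (by simp [h, code]), fun h => ⟨fun hl => key _ ?_, fun hl => ?_⟩⟩
    · exact (hcode.2 (.inl ⟨hl, hX _ _ (hls.1 hl) (by simpa using h)⟩)).symm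
    · simp only [b7 hl]
      have hc := hle hl
      have hg := hgold hc
      set c := I.between X (I.s ⟨i, hi⟩) (I.s ⟨j, hj⟩) with hcdef
      obtain ⟨b1, b2, b3, b4, b5, b6⟩ := round_bounds hM hM4 hN hc
      refine ⟨b1, ⟨b2, b3⟩, ⟨b4, b5, b6⟩, fun ht => key _ ?_, fun ht => key _ ?_⟩
      · exact (hcode.2 (.inr ⟨hl, hg.2 ht⟩)).symm
      · refine (hcode0.2 ⟨by simpa using h, ?_⟩).symm
        rintro (⟨h1, _⟩ | ⟨_, h2⟩)
        · exact hl h1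
        · exact ht (hg.1 h2)
  · intro i hi s' hI u v hb
    exact hI u v ((before_row v.2).1 hb)
  · intro s' hfr hI u v
    exact hI u v (before_all u.2)

/-- From the representation of the result of the dropping loop to the code of the transformed
graph. -/
def transform : Pr := sizes ;; counts ;; rounding

theorem wp_transform {n M m : ℕ} {s : St} (hs : s.v 0 = n) (hM : 32 * (n + 1) * (n + 1) ≤ M)
    (hM4 : 9 * (n * n) * (n * n) < M)
    {I : Inst (Fin n)} (hself : ¬ ∃ U, I.Hostile U U) (hf : Labeling I (s.a 3 0))
    {X : SimpleGraph (Fin n)} (hX : I.IsDropResult X) (hA : Rep (s.a 5) X)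
    (hg : DegRep n (s.a 3 0) (s.a 5) (s.a 6)) :
    wp n M m transform (fun s' => CodeRep (s'.a 9) (I.round X)) s := by
  refine wp_seq.2 (wp_conseq (wp_sizes hs hM) fun s1 hf1 h1 => wp_seq.2 ?_)
  have e0 : s1.v 0 = n := (hf1.1 0 rfl).trans hs
  have e3 : s1.a 3 = s.a 3 := hf1.2 3 rfl
  have e6 : s1.a 6 = s.a 6 := hf1.2 6 rfl
  refine wp_conseq (wp_counts e0 hM ?_) fun s2 hf2 h2 => ?_
  · intro u hu l hl
    rw [e6, hg u hu l hl, degree]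
    refine (Finset.sum_le_card_nsmul _ _ 1 fun x hx => ?_).trans (by simp)
    split_ifs
    · exact hA.le_one hu (Finset.mem_range.1 hx)
    · exact zero_le_one
  have k0 : s2.v 0 = n := (hf2.1 0 rfl).trans e0
  have k3 : s2.a 3 = s.a 3 := (hf2.2 3 rfl).trans e3
  have k8 : s2.a 8 = s1.a 8 := hf2.2 8 rfl
  refine wp_rounding k0 hM hM4 (by rwa [k3]) (fun u v h h' => hX.adj_of_s_eq hself h h') ?_ ?_
  · intro u
    rw [k3, k8, h1 _ (hf.lt u u.2), hf.size_eq]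
  · intro u v huv
    rw [k3, h2 _ (hf.lt u u.2) _ (hf.lt v v.2), e3, e6, hf.count_eq hA hg huv]

end RamLang

/-! ### Programs: the weights of the pairs -/

namespace RamLang

open CCC

set_option linter.unusedSimpArgs false

/-- Rule for double loops that accumulate a sum in the variable `c`. -/
theorem wp_sum2 {n M m : ℕ} {x y c : ℕ} {p : Pr} {Q : St → Prop} {s : St} (g : ℕ → ℕ → ℕ)
    (hs : s.v 0 = n) (hx0 : x ≠ 0) (hy0 : y ≠ 0) (hxy : x ≠ y) (hcx : c ≠ x) (hcy : c ≠ y)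
    (hx : p.mv.contains x = false) (hp0 : p.mv.contains 0 = false) (h0 : s.v c = 0)
    (hstep : ∀ i < n, ∀ j < n, ∀ s', Frame (.loop x 0 (.loop y 0 p)) s s' → s'.v x = i → s'.v y = j →
      s'.v c + g i j ≤ ∑ i ∈ Finset.range n, ∑ j ∈ Finset.range n, g i j →
      wp n M m p (fun s'' => s''.v c = s'.v c + g i j) s')
    (hQ : ∀ s', Frame (.loop x 0 (.loop y 0 p)) s s' →
      s'.v c = ∑ i ∈ Finset.range n, ∑ j ∈ Finset.range n, g i j → Q s') :
    wp n M m (.loop x 0 (.loop y 0 p)) Q s := by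
  refine wp_double (fun i j s' => s'.v c = ∑ i' ∈ Finset.range i, ∑ j' ∈ Finset.range n, g i' j' +
      ∑ j' ∈ Finset.range j, g i j') hs hx0 hy0 hxy hx hp0 ?_ (by simp [h0]) ?_ ?_ ?_
  · rintro i j s' k z (rfl | rfl) h <;> simpa [hcx, hcy] using h
  · intro i hi j hj s' hf hx hy hI
    refine wp_mono _ _ _ ?_ _ (hstep i hi j hj s' hf hx hy ?_)
    · intro s'' h
      rw [h, hI, Finset.sum_range_succ, add_assoc]
    · rw [hI, add_assoc, ← Finset.sum_range_succ]
      calc _ ≤ ∑ i' ∈ Finset.range i, ∑ j' ∈ Finset.range n, g i' j' +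
            ∑ j' ∈ Finset.range n, g i j' :=
            Nat.add_le_add_left (Finset.sum_le_sum_of_subset
              (Finset.range_subset_range.2 (by omega))) _
        _ = ∑ i' ∈ Finset.range (i + 1), ∑ j' ∈ Finset.range n, g i' j' :=
            (Finset.sum_range_succ _ _).symm
        _ ≤ _ := Finset.sum_le_sum_of_subset (Finset.range_subset_range.2 (by omega))
  · intro i hi s' h
    rw [h, Finset.sum_range_succ]; simp
  · intro s' hf h
    exact hQ s' hf (by simpa using h)

/-- Rule for triple loops over all nodes. -/
theorem wp_triple {n M m : ℕ} {x y z : ℕ} {p : Pr} {Q : St → Prop} {s : St}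
    (Inv : ℕ → ℕ → ℕ → St → Prop)
    (hs : s.v 0 = n) (hx0 : x ≠ 0) (hy0 : y ≠ 0) (hz0 : z ≠ 0) (hxy : x ≠ y) (hxz : x ≠ z)
    (hyz : y ≠ z) (hx : p.mv.contains x = false) (hy : p.mv.contains y = false)
    (hp0 : p.mv.contains 0 = false)
    (hV : ∀ i j k s' r w, w = x ∨ w = y ∨ w = z → Inv i j k s' → Inv i j k (s'.setV w r))
    (h0 : Inv 0 0 0 s)
    (hstep : ∀ i < n, ∀ j < n, ∀ k < n, ∀ s',
      Frame (.loop x 0 (.loop y 0 (.loop z 0 p))) s s' → s'.v x = i → s'.v y = j → s'.v z = k →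
      Inv i j k s' → wp n M m p (Inv i j (k + 1)) s')
    (hcol : ∀ i j s', Inv i j n s' → Inv i (j + 1) 0 s')
    (hrow : ∀ i s', Inv i n 0 s' → Inv (i + 1) 0 0 s')
    (hQ : ∀ s', Frame (.loop x 0 (.loop y 0 (.loop z 0 p))) s s' → Inv n 0 0 s' → Q s') :
    wp n M m (.loop x 0 (.loop y 0 (.loop z 0 p))) Q s := by
  have cons_false : ∀ {a : ℕ} (l : List ℕ), a ≠ z → l.contains a = false →
      (z :: l).contains a = false := by
    intro a l h h'
    rw [List.contains_cons, h', Bool.or_false, beq_eq_false_iff_ne]; exact h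
  refine wp_double (fun i j s' => Inv i j 0 s') hs hx0 hy0 hxy (cons_false _ hxz hx)
    (cons_false _ hz0.symm hp0) ?_ h0 ?_ (fun i _ => hrow i) hQ
  · rintro i j s' k w (rfl | rfl) h
    · exact hV _ _ _ _ _ _ (.inl rfl) h
    · exact hV _ _ _ _ _ _ (.inr (.inl rfl)) h
  · intro i hi j hj s' hf h2 h3 hI
    have e0 : s'.v 0 = n := by
      rw [hf.1 0 ?_, hs]
      simp only [Pr.mv, List.contains_cons, hp0, Bool.or_false, Bool.or_eq_false_iff,
        beq_eq_false_iff_ne]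
      exact ⟨hx0.symm, hy0.symm, hz0.symm⟩
    refine wp_loop0 (fun k s'' => Inv i j k s'') e0 hI ?_ ?_
    · intro k hk s'' hf' hI'
      refine hstep i hi j hj k hk _ ?_ ?_ ?_ (by simp) (hV _ _ _ _ _ _ (.inr (.inr rfl)) hI')
      · exact hf.trans (Frame.body_loop (Frame.body_loop (hf'.trans (Frame.setV_loop _ _ _ _ _))))
      · rw [setV_v, if_neg hxz, hf'.1 x (cons_false _ hxz hx), h2]
      · rw [setV_v, if_neg hyz, hf'.1 y (cons_false _ hyz hy), h3]
    · intro s'' _ hI'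
      exact hV _ _ _ _ _ _ (.inr (.inr rfl)) (hcol i j s'' hI')

/-! #### The number of phases -/

/-- Number of phases divided by the binary logarithm. -/
def rate (q : ℕ) : ℕ := q * (3 * (q + 1))

/-- Variable `17` is `2` to the power of variable `16` and doubles until it exceeds `n`; `n`
iterations are enough as `n < 2 ^ n`. Variable `1` becomes the number of phases, the only loop bound
besides `n`. -/
def phases (q : ℕ) : Pr :=
  .assign 17 (.lit 1) ;; .assign 16 (.lit 0) ;;
  .loop 2 0 (.ite (.lt (.var 17) (.bin .add (.var 0) (.lit 1)))
    (.assign 17 (.bin .add (.var 17) (.var 17)) ;; .assign 16 (.bin .add (.var 16) (.lit 1)))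
    .skip) ;;
  .assign 1 (.bin .mul (.lit (rate q)) (.bin .add (.var 16) (.lit 2)))

theorem wp_phases {n M m q : ℕ} {s : St} (hs : s.v 0 = n) (hM : 32 * (n + 1) * (n + 1) ≤ M)
    (hq : rate q * (n + 2) < M) :
    wp n M m (phases q) (fun s' => ∃ l, n < 2 ^ l ∧ 2 ^ l ≤ 2 * n + 1 ∧
      s'.v 1 = rate q * (l + 2)) s := by
  have hM' : 2 * n + 32 ≤ M := by nlinarith
  have hq0 : rate q < M := lt_of_le_of_lt (Nat.le_mul_of_pos_right _ (by omega)) hq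
  unfold phases
  simp only [wp_ite, wp_seq, wp_skip, wp_assign, wp_set, Ex.ok, Ex.eval, Bx.ok, Bx.Holds,
    WordRAM.Op.eval, setV_v, setV_a, setA_v, setA_a, upd_apply, Nat.reduceEqDiff, ↓reduceIte,
    true_and, and_true,
    show 0 < M by omega, show 1 < M by omega]
  refine wp_loop0 (fun i s' => s'.v 17 = 2 ^ s'.v 16 ∧ (s'.v 16 = i ∨ s'.v 16 ≤ i ∧ n < 2 ^ s'.v 16) ∧
    2 ^ s'.v 16 ≤ 2 * n + 1) (by simp [hs]) (by simp) ?_ ?_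
  · intro i hi s' hf ⟨h1, h2, h3⟩
    have e0 : s'.v 0 = n := (hf.1 0 rfl).trans (by simp [hs])
    simp only [wp_ite, wp_seq, wp_skip, wp_assign, wp_set, Ex.ok, Ex.eval, Bx.ok, Bx.Holds,
      WordRAM.Op.eval, setV_v, setV_a, setA_v, setA_a, upd_apply, Nat.reduceEqDiff, ↓reduceIte,
      true_and, and_true,
      e0, h1, show 1 < M by omega]
    refine ⟨by omega, fun hlt => ⟨by omega, by omega, by rw [pow_succ]; omega, ?_, ?_⟩,
      fun hge => ⟨?_, h3⟩⟩
    · omega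
    · omega
    · omega
  · intro s' hf ⟨h1, h2, h3⟩
    have hl : s'.v 16 ≤ n := by omega
    have hr : rate q * (s'.v 16 + 2) ≤ rate q * (n + 2) := Nat.mul_le_mul_left _ (by omega)
    simp only [wp_ite, wp_seq, wp_skip, wp_assign, wp_set, Ex.ok, Ex.eval, Bx.ok, Bx.Holds,
      WordRAM.Op.eval, setV_v, setV_a, setA_v, setA_a, upd_apply, Nat.reduceEqDiff, ↓reduceIte,
      true_and, and_true,
      show 2 < M by omega]
    refine ⟨⟨hq0, by omega, by omega⟩, s'.v 16, ?_, h3, rfl⟩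
    rcases h2 with h2 | h2
    · rw [h2]; exact Nat.lt_two_pow_self
    · exact h2.2

/-! #### Increasing weights -/

def mat (n : ℕ) (A : ℕ → ℕ → ℕ) : Fin n → Fin n → ℕ := fun u v => A u v

def bumpVars (q x y : ℕ) : Pr :=
  .assign 5 (.bin .add (.get 10 (.var x) (.var y))
    (.bin .add (.bin .div (.get 10 (.var x) (.var y)) (.lit q)) (.lit 1))) ;;
  .set 10 (.var x) (.var y) (.var 5) ;; .set 10 (.var y) (.var x) (.var 5)

theorem wp_bumpVars {n M m q x y : ℕ} {Q : St → Prop} {s : St} (hq : q < M) (hM : 1 < M) {a b : Fin n}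
    (hx : s.v x = a) (hy : s.v y = b) (hx5 : x ≠ 5) (hy5 : y ≠ 5)
    (hsymm : ∀ u v, mat n (s.a 10) u v = mat n (s.a 10) v u)
    (hb : bump q (mat n (s.a 10) a b) < M)
    (hQ : ∀ s', (∀ z, z ≠ 5 → s'.v z = s.v z) → (∀ t, t ≠ 10 → s'.a t = s.a t) →
      mat n (s'.a 10) = bumpPair q (mat n (s.a 10)) a b → Q s') :
    wp n M m (bumpVars q x y) Q s := by
  have ha := a.2
  have hb' := b.2
  have hab := hsymm a b
  unfold bump mat at hb
  unfold mat at hab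
  unfold bumpVars
  simp only [wp_ite, wp_seq, wp_skip, wp_assign, wp_set, Ex.ok, Ex.eval, Bx.ok, Bx.Holds,
    WordRAM.Op.eval, setV_v, setV_a, setA_v, setA_a, upd_apply, Nat.reduceEqDiff, ↓reduceIte,
    true_and, and_true,
    hx, hy, ha, hb', hq, hM, hb, hx5, hy5]
  refine ⟨by omega, hQ _ ?_ ?_ ?_⟩
  · intro z hz; simp [hz]
  · intro t ht; simp [ht]
  · funext u v
    simp only [mat, setA_a, setV_a, if_true, upd_apply, bumpPair, bump, Fin.ext_iff]
    by_cases h1 : (u : ℕ) = a ∧ (v : ℕ) = b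
    · simp [h1]
    · by_cases h2 : (u : ℕ) = b ∧ (v : ℕ) = a
      · simp [h2, hab]
      · simp [h1, h2]

def tripleBody (q : ℕ) : Pr :=
  .ite (.eq (.bin .add (.bin .add (.get 9 (.var 2) (.var 3)) (.get 9 (.var 2) (.var 4)))
      (.get 9 (.var 3) (.var 4))) (.lit 2))
    (.ite (.lt (.bin .add (.bin .add (.get 10 (.var 2) (.var 3)) (.get 10 (.var 2) (.var 4)))
      (.get 10 (.var 3) (.var 4))) (.var 11))
      (bumpVars q 2 3 ;; bumpVars q 2 4 ;; bumpVars q 3 4) .skip) .skip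

def triples (q : ℕ) : Pr := .loop 2 0 (.loop 3 0 (.loop 4 0 (tripleBody q)))

theorem code_le {V : Type*} (G : SimpleGraph V) (u v : V) : code G u v ≤ 3 := by
  unfold code; split_ifs <;> omega

/-- Weights never decrease, so a triple that has been treated stays covered. A triple whose turn
comes was covered for `T` when the phase began, so a single augmentation lifts it to the new
threshold (`augment_ge`). Hence one scan of all triples is a complete phase. -/
theorem wp_triples {n M m q X T : ℕ} {s : St} (hs : s.v 0 = n) (hq : 0 < q) (hqM : q < M)
    (hM : 32 ≤ M) (hX : T + T / q + 1 ≤ X) (hXM : 32 * X ≤ M)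
    {G : SimpleGraph (Fin n)} (hg : CodeRep (s.a 9) G) (hT : s.v 11 = T + T / q + 1)
    (hF : Feasible G (mat n (s.a 10)) T) (h1 : ∀ a b, 1 ≤ mat n (s.a 10) a b)
    (htop : ∀ a b, mat n (s.a 10) a b ≤ 2 * T) :
    wp n M m (triples q) (fun s' =>
      Progress G q (T + T / q + 1) (mat n (s.a 10)) (mat n (s'.a 10)) ∧
      ∀ u v w, Bad G u v w → T + T / q + 1 ≤
        mat n (s'.a 10) u v + mat n (s'.a 10) u w + mat n (s'.a 10) v w) s := by
  set W := mat n (s.a 10) with hW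
  set T' := T + T / q + 1 with hT'
  have hTT' : 2 * T ≤ 2 * T' := by
    have := Nat.zero_le (T / q)
    omega
  refine wp_triple (fun i j k s' => Progress G q T' W (mat n (s'.a 10)) ∧
    ∀ u v w : Fin n, Before i j u v ∨ ((u : ℕ) = i ∧ (v : ℕ) = j ∧ (w : ℕ) < k) → Bad G u v w →
      T' ≤ mat n (s'.a 10) u v + mat n (s'.a 10) u w + mat n (s'.a 10) v w) hs (by decide)
    (by decide) (by decide) (by decide) (by decide) (by decide) rfl rfl rfl ?_ ?_ ?_ ?_ ?_ ?_
  · rintro i j k s' r w (rfl | rfl | rfl) h <;> exact h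
  · refine ⟨.refl _ _ _ hF.symm, fun u v w h => ?_⟩
    rcases h with h | h
    · exact absurd h before_zero
    · omega
  · intro i hi j hj k hk s' hf h2 h3 h4 ⟨hp, hI⟩
    have e9 : s'.a 9 = s.a 9 := hf.2 9 rfl
    have e11 : s'.v 11 = T' := (hf.1 11 rfl).trans hT
    set u : Fin n := ⟨i, hi⟩ with hu
    set v : Fin n := ⟨j, hj⟩ with hv
    set w : Fin n := ⟨k, hk⟩ with hw
    have g1 : s.a 9 i j = code G u v := hg u v
    have g2 : s.a 9 i k = code G u w := hg u w
    have g3 : s.a 9 j k = code G v w := hg v w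
    have w1 : s'.a 10 i j = mat n (s'.a 10) u v := rfl
    have w2 : s'.a 10 i k = mat n (s'.a 10) u w := rfl
    have w3 : s'.a 10 j k = mat n (s'.a 10) v w := rfl
    have c1 := code_le G u v
    have c2 := code_le G u w
    have c3 := code_le G v w
    have hbd : ∀ a b, mat n (s'.a 10) a b ≤ 2 * T' := fun a b =>
      (hp.bound a b).trans (max_le ((htop a b).trans hTT') le_rfl)
    have hge : ∀ a b, W a b ≤ mat n (s'.a 10) a b := hp.le
    have b1 := hbd u v
    have b2 := hbd u w
    have b3 := hbd v w
    unfold tripleBody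
    simp only [wp_ite, wp_seq, wp_skip, wp_assign, wp_set, Ex.ok, Ex.eval, Bx.ok, Bx.Holds,
      WordRAM.Op.eval, setV_v, setV_a, setA_v, setA_a, upd_apply, Nat.reduceEqDiff, ↓reduceIte,
      true_and, and_true,
      h2, h3, h4, e9, e11, g1, g2, g3, w1, w2, w3, hi, hj, hk, show 2 < M by omega]
    refine ⟨⟨by omega, by omega⟩, fun hbad => ⟨⟨by omega, by omega⟩, fun hlt => ?_, fun hnl => ?_⟩,
      fun hnb => ?_⟩
    · have hbump : ∀ k, k ≤ 2 * T' → bump q k < M := by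
        intro k hk
        have := Nat.div_le_self k q
        unfold bump; omega
      have hne := Bad.ne hbad
      set A := mat n (s'.a 10) with hA
      refine wp_bumpVars (a := u) (b := v) hqM (by omega) h2 h3 (by decide) (by decide) hp.symm
        (hbump _ b1) ?_
      intro s1 hv1 ha1 hm1
      refine wp_bumpVars (a := u) (b := w) hqM (by omega) ((hv1 2 (by decide)).trans h2)
        ((hv1 4 (by decide)).trans h4) (by decide) (by decide) ?_ ?_ ?_
      · rw [hm1]; exact bumpPair_comm hp.symm u v
      · rw [hm1, bumpPair, if_neg]
        · exact hbump _ b2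
        · rintro (h | h)
          · exact hne.2.2 h.2.symm
          · exact hne.1 h.1
      intro s2 hv2 ha2 hm2
      refine wp_bumpVars (a := v) (b := w) hqM (by omega)
        ((hv2 3 (by decide)).trans ((hv1 3 (by decide)).trans h3))
        ((hv2 4 (by decide)).trans ((hv1 4 (by decide)).trans h4)) (by decide) (by decide) ?_ ?_ ?_
      · rw [hm2, hm1]; exact bumpPair_comm (bumpPair_comm hp.symm u v) u w
      · rw [hm2, hm1, bumpPair, if_neg, bumpPair, if_neg]
        · exact hbump _ b3
        · rintro (h | h)
          · exact hne.1 h.1.symm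
          · exact hne.2.1 h.2.symm
        · rintro (h | h)
          · exact hne.1 h.1.symm
          · exact hne.2.2 h.1
      intro s3 hv3 ha3 hm3
      have hm : mat n (s3.a 10) = augment q A u v w := by rw [hm3, hm2, hm1]; rfl
      have hA1 : ∀ a b, 1 ≤ A a b := fun a b => (h1 a b).trans (hge a b)
      have hp' := augment_progress hq hp.symm hA1 hbad hlt
      rw [hm]
      refine ⟨hp.trans hp', fun u' v' w' hb hbad' => ?_⟩
      have l1 := hp'.le u' v'
      have l2 := hp'.le u' w'
      have l3 := hp'.le v' w'
      by_cases hc : Before i j u' v' ∨ ((u' : ℕ) = i ∧ (v' : ℕ) = j ∧ (w' : ℕ) < k)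
      · have := hI u' v' w' hc hbad'
        omega
      · have hu' : u' = u := Fin.ext (by unfold Before at *; simp only [hu]; omega)
        have hv' : v' = v := Fin.ext (by unfold Before at *; simp only [hv]; omega)
        have hw' : w' = w := Fin.ext (by unfold Before at *; simp only [hw]; omega)
        rw [hu', hv', hw']
        refine augment_ge hq hbad ((hF.cover u v w hbad).trans ?_)
        have := hge u v
        have := hge u w
        have := hge v w
        omega
    · refine ⟨hp, fun u' v' w' hb hbad' => ?_⟩
      by_cases hc : Before i j u' v' ∨ ((u' : ℕ) = i ∧ (v' : ℕ) = j ∧ (w' : ℕ) < k)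
      · exact hI u' v' w' hc hbad'
      · have hu' : u' = u := Fin.ext (by unfold Before at *; simp only [hu]; omega)
        have hv' : v' = v := Fin.ext (by unfold Before at *; simp only [hv]; omega)
        have hw' : w' = w := Fin.ext (by unfold Before at *; simp only [hw]; omega)
        rw [hu', hv', hw']
        omega
    · refine ⟨hp, fun u' v' w' hb hbad' => ?_⟩
      by_cases hc : Before i j u' v' ∨ ((u' : ℕ) = i ∧ (v' : ℕ) = j ∧ (w' : ℕ) < k)
      · exact hI u' v' w' hc hbad'
      · have hu' : u' = u := Fin.ext (by unfold Before at *; simp only [hu]; omega)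
        have hv' : v' = v := Fin.ext (by unfold Before at *; simp only [hv]; omega)
        have hw' : w' = w := Fin.ext (by unfold Before at *; simp only [hw]; omega)
        rw [hu', hv', hw'] at hbad'
        exact absurd hbad' hnb
  · intro i j s' ⟨hp, hI⟩
    refine ⟨hp, fun u v w hb => hI u v w ?_⟩
    have := w.2
    unfold Before at *; omega
  · intro i s' ⟨hp, hI⟩
    refine ⟨hp, fun u v w hb => hI u v w ?_⟩
    have := v.2
    unfold Before at *; omega
  · intro s' hf ⟨hp, hI⟩
    exact ⟨hp, fun u v w => hI u v w (.inl (before_all u.2))⟩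

end RamLang

/-! ### Programs: the phases of the weight computation -/

namespace RamLang

open CCC

set_option linter.unusedSimpArgs false

def copyWeights : Pr := .loop 2 0 (.loop 3 0 (.set 11 (.var 2) (.var 3) (.get 10 (.var 2) (.var 3))))

theorem wp_copyWeights {n M m : ℕ} {s : St} (hs : s.v 0 = n) :
    wp n M m copyWeights (fun s' => mat n (s'.a 11) = mat n (s.a 10)) s := by
  refine wp_double (fun i j s' => ∀ u v : Fin n, Before i j u v → s'.a 11 u v = s.a 10 u v)
    hs (by decide) (by decide) (by decide) rfl rfl ?_ ?_ ?_ ?_ ?_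
  · rintro i j s' k z (rfl | rfl) h <;> exact h
  · intro u v hb; exact absurd hb before_zero
  · intro i hi j hj s' hfr hx hy hI
    have e10 : s'.a 10 = s.a 10 := hfr.2 10 rfl
    simp only [wp_ite, wp_seq, wp_skip, wp_assign, wp_set, Ex.ok, Ex.eval, Bx.ok, Bx.Holds,
      WordRAM.Op.eval, setV_v, setV_a, setA_v, setA_a, upd_apply, Nat.reduceEqDiff, ↓reduceIte,
      true_and, and_true,
      hx, hy, hi, hj, e10]
    intro u v hb
    split_ifs with h
    · rw [h.1, h.2]
    · exact hI u v ((before_succ.1 hb).resolve_right h)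
  · intro i hi s' hI u v hb
    exact hI u v ((before_row v.2).1 hb)
  · intro s' hfr hI
    funext u v
    exact hI u v (before_all u.2)

theorem sum_mat (n : ℕ) (A : ℕ → ℕ → ℕ) :
    ∑ i ∈ Finset.range n, ∑ j ∈ Finset.range n, A i j = ∑ a, ∑ b, mat n A a b := by
  rw [Finset.sum_range]
  exact Finset.sum_congr rfl fun a _ => Finset.sum_range _

theorem sum_mat_le {n k : ℕ} {W : Fin n → Fin n → ℕ} (h : ∀ a b, W a b ≤ k) :
    ∑ a, ∑ b, W a b ≤ n * n * k := by
  refine (Finset.sum_le_card_nsmul _ _ (n * k) fun a _ =>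
    (Finset.sum_le_card_nsmul _ _ k fun b _ => h a b).trans (by simp)).trans ?_
  simp [mul_assoc]

def totalWeight : Pr :=
  .assign 12 (.lit 0) ;;
  .loop 2 0 (.loop 3 0 (.assign 12 (.bin .add (.var 12) (.get 10 (.var 2) (.var 3)))))

theorem wp_totalWeight {n M m : ℕ} {s : St} (hs : s.v 0 = n) (hM : 0 < M)
    (hb : ∑ a, ∑ b, mat n (s.a 10) a b < M) :
    wp n M m totalWeight (fun s' => s'.v 12 = ∑ a, ∑ b, mat n (s.a 10) a b) s := by
  unfold totalWeight
  simp only [wp_ite, wp_seq, wp_skip, wp_assign, wp_set, Ex.ok, Ex.eval, Bx.ok, Bx.Holds,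
    WordRAM.Op.eval, setV_v, setV_a, setA_v, setA_a, upd_apply, Nat.reduceEqDiff, ↓reduceIte,
    true_and, and_true,
    hM]
  refine wp_sum2 (c := 12) (fun i j => s.a 10 i j) (by simp [hs]) (by decide) (by decide) (by decide)
    (by decide) (by decide) rfl rfl (by simp) ?_ ?_
  · intro i hi j hj s' hf h2 h3 hle
    have e10 : s'.a 10 = s.a 10 := hf.2 10 rfl
    rw [sum_mat] at hle
    simp only [wp_ite, wp_seq, wp_skip, wp_assign, wp_set, Ex.ok, Ex.eval, Bx.ok, Bx.Holds,
      WordRAM.Op.eval, setV_v, setV_a, setA_v, setA_a, upd_apply, Nat.reduceEqDiff, ↓reduceIte,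
      true_and, and_true,
      h2, h3, e10, hi, hj]
    omega
  · intro s' hf h
    rw [h, sum_mat]

/-- The ratios of total weight to threshold are compared by cross multiplication; variables `14` and
`13` belong to the best weights, `12` and `11` to the current ones. -/
def selectBest : Pr :=
  .ite (.lt (.bin .mul (.var 12) (.var 13)) (.bin .mul (.var 14) (.var 11)))
    (.assign 14 (.var 12) ;; .assign 13 (.var 11) ;; copyWeights) .skip

def phase (q : ℕ) : Pr :=
  .assign 11 (.bin .add (.bin .add (.var 11) (.bin .div (.var 11) (.lit q))) (.lit 1)) ;;
  triples q ;; totalWeight ;; selectBest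

/-- Invariant after `k` phases. -/
structure WeightInv {n : ℕ} (G : SimpleGraph (Fin n)) (q X k : ℕ) (s : St) : Prop where
  inv : PhaseInv G q (mat n (s.a 10)) (s.v 11) (mat n (s.a 11)) (s.v 13)
  total : s.v 14 = ∑ a, ∑ b, mat n (s.a 11) a b
  topB : ∀ a b, mat n (s.a 11) a b ≤ 2 * X
  topTb : s.v 13 ≤ X
  upper : s.v 11 ≤ 4 * q ^ 2 * 4 ^ k
  lower : 4 * q ^ 2 * (q + 1) ^ k ≤ s.v 11 * q ^ k

/-- Crude bound from `T / q ≤ T` and `1 ≤ T`. It only has to keep the threshold polynomial in `n`.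
-/
theorem threshold_upper {q T k : ℕ} (hq : 0 < q) (hT : 4 * q ^ 2 ≤ T)
    (h : T ≤ 4 * q ^ 2 * 4 ^ k) : T + T / q + 1 ≤ 4 * q ^ 2 * 4 ^ (k + 1) := by
  have := Nat.div_le_self T q
  have h1 : 1 ≤ T := le_trans (by nlinarith) hT
  rw [pow_succ 4 k, ← mul_assoc]
  omega

/-- Rounding up gives a growth of at least `(q + 1) / q`; the factor `q ^ k` keeps the statement
within the natural numbers. -/
theorem threshold_lower {q T k : ℕ} (hq : 0 < q)
    (h : 4 * q ^ 2 * (q + 1) ^ k ≤ T * q ^ k) :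
    4 * q ^ 2 * (q + 1) ^ (k + 1) ≤ (T + T / q + 1) * q ^ (k + 1) := by
  have h1 : T * (q + 1) ≤ (T + T / q + 1) * q := by
    have := Nat.div_add_mod T q
    have := Nat.mod_lt T hq
    nlinarith
  calc 4 * q ^ 2 * (q + 1) ^ (k + 1) = 4 * q ^ 2 * (q + 1) ^ k * (q + 1) := by ring
    _ ≤ T * q ^ k * (q + 1) := Nat.mul_le_mul_right _ h
    _ = T * (q + 1) * q ^ k := by ring
    _ ≤ (T + T / q + 1) * q * q ^ k := Nat.mul_le_mul_right _ h1
    _ = _ := by ring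

theorem wp_phase {n M m q X k : ℕ} {s : St} (hs : s.v 0 = n) (hq : 0 < q)
    (hM : 32 * (n + 1) * (n + 1) * (X * X) ≤ M) (hX : 4 * q ^ 2 * 4 ^ (k + 1) ≤ X)
    {G : SimpleGraph (Fin n)} (hg : CodeRep (s.a 9) G) (h : WeightInv G q X k s) :
    wp n M m (phase q) (fun s' => WeightInv G q X (k + 1) s') s := by
  obtain ⟨T, hT⟩ : ∃ T, s.v 11 = T := ⟨_, rfl⟩
  have hI := h.inv
  rw [hT] at hI
  have hup := threshold_upper hq hI.startT (by have := h.upper; rwa [hT] at this)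
  have hlo := threshold_lower (k := k) hq (by have := h.lower; rwa [hT] at this)
  have hTX : T + T / q + 1 ≤ X := hup.trans hX
  have hTT' : T ≤ T + T / q + 1 := by rw [add_assoc]; exact Nat.le_add_right _ _
  have hqX : q ≤ X := by
    refine le_trans ?_ ((hI.startT.trans hTT').trans hTX)
    nlinarith
  have hX1 : 1 ≤ X := by omega
  have hTX' : 2 * T ≤ 2 * X := by omega
  have hTX2 : 2 * (T + T / q + 1) ≤ 2 * X := by omega
  have hXX : X ≤ X * X := Nat.le_mul_of_pos_left _ hX1
  have hb1 : 32 * (X * X) ≤ M := le_trans (by nlinarith [Nat.zero_le (n * n * (X * X)), Nat.zero_le (n * (X * X))]) hM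
  have hb2 : n * n * (2 * X) * X < M := lt_of_lt_of_le (by nlinarith [Nat.zero_le (n * n * (X * X)), Nat.zero_le (n * (X * X))]) hM
  have hb3 : n * n * (2 * X) ≤ n * n * (2 * X) * X := Nat.le_mul_of_pos_right _ hX1
  unfold phase
  simp only [wp_ite, wp_seq, wp_skip, wp_assign, wp_set, Ex.ok, Ex.eval, Bx.ok, Bx.Holds,
    WordRAM.Op.eval, setV_v, setV_a, setA_v, setA_a, upd_apply, Nat.reduceEqDiff, ↓reduceIte,
    true_and, and_true,
    hT, show q < M by omega, show 1 < M by omega]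
  refine ⟨⟨by omega, by omega⟩, wp_conseq (wp_triples (T := T) (by simp [hs]) hq (by omega) (by omega)
    hTX (by omega) hg (by simp) hI.feas (fun a b => ?_) hI.top) ?_⟩
  · exact le_trans (by nlinarith) (hI.start a b)
  intro s1 hf1 ⟨hp, hc⟩
  simp only [setV_a] at hp
  have a0 : s1.v 0 = n := (hf1.1 0 rfl).trans (by simp [hs])
  have a11 : s1.v 11 = T + T / q + 1 := hf1.1 11 rfl
  have a13 : s1.v 13 = s.v 13 := hf1.1 13 rfl
  have a14 : s1.v 14 = s.v 14 := hf1.1 14 rfl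
  have aB : s1.a 11 = s.a 11 := hf1.2 11 rfl
  have htop : ∀ a b, mat n (s1.a 10) a b ≤ 2 * X := fun a b =>
    (hp.bound a b).trans (max_le ((hI.top a b).trans hTX') hTX2)
  have hsum := sum_mat_le htop
  have hsumB := sum_mat_le h.topB
  have hTb := h.topTb
  have htot := h.total
  have hWM := (hsum.trans hb3).trans_lt hb2
  refine wp_seq.2 <| wp_conseq (wp_totalWeight a0 (by omega) hWM) fun s2 hf2 h12 => ?_
  have b0 : s2.v 0 = n := (hf2.1 0 rfl).trans a0
  have b11 : s2.v 11 = T + T / q + 1 := (hf2.1 11 rfl).trans a11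
  have b13 : s2.v 13 = s.v 13 := (hf2.1 13 rfl).trans a13
  have b14 : s2.v 14 = s.v 14 := (hf2.1 14 rfl).trans a14
  have bW : s2.a 10 = s1.a 10 := hf2.2 10 rfl
  have bB : s2.a 11 = s.a 11 := (hf2.2 11 rfl).trans aB
  unfold selectBest
  simp only [wp_ite, wp_seq, wp_skip, wp_assign, wp_set, Ex.ok, Ex.eval, Bx.ok, Bx.Holds,
    WordRAM.Op.eval, setV_v, setV_a, setA_v, setA_a, upd_apply, Nat.reduceEqDiff, ↓reduceIte,
    true_and, and_true,
    h12, b11, b13, b14, htot]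
  refine ⟨⟨lt_of_le_of_lt (Nat.mul_le_mul hsum hTb) hb2, lt_of_le_of_lt (Nat.mul_le_mul hsumB hTX) hb2⟩,
    fun hlt => ?_, fun hge => ?_⟩
  · refine wp_conseq (wp_copyWeights (by simp [b0])) fun s3 hf3 hB => ?_
    have d10 : s3.a 10 = s1.a 10 := (hf3.2 10 rfl).trans bW
    have d11 : s3.v 11 = T + T / q + 1 := (hf3.1 11 rfl).trans b11
    have d13 : s3.v 13 = T + T / q + 1 := (hf3.1 13 rfl).trans (by simp [b11])
    have d14 : s3.v 14 = ∑ a, ∑ b, mat n (s1.a 10) a b := (hf3.1 14 rfl).trans (by simp [h12])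
    simp only [setV_a, bW] at hB
    refine ⟨?_, ?_, ?_, ?_, ?_, ?_⟩
    · rw [d10, d11, d13, hB]
      exact hI.next hq hp hc (.inl ⟨hlt, rfl, rfl⟩)
    · rw [d14, hB]
    · rw [hB]; exact htop
    · rw [d13]; exact hTX
    · rw [d11]; exact hup
    · rw [d11]; exact hlo
  · refine ⟨?_, ?_, ?_, ?_, ?_, ?_⟩
    · rw [b11, b13, bB, bW]
      exact hI.next hq hp hc (.inr ⟨not_lt.1 hge, rfl, rfl⟩)
    · rw [b14, bB, htot]
    · rw [bB]; exact h.topB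
    · rw [b13]; exact hTb
    · rw [b11]; exact hup
    · rw [b11]; exact hlo

def initWeights (q : ℕ) : Pr :=
  .loop 2 0 (.loop 3 0 (.set 10 (.var 2) (.var 3) (.lit (4 * q ^ 2)) ;;
    .set 11 (.var 2) (.var 3) (.lit (4 * q ^ 2)))) ;;
  .assign 11 (.lit (4 * q ^ 2)) ;; .assign 13 (.lit (4 * q ^ 2)) ;;
  .assign 14 (.bin .mul (.bin .mul (.var 0) (.var 0)) (.lit (4 * q ^ 2)))

theorem wp_initWeights {n M m q X : ℕ} {s : St} (hs : s.v 0 = n) (hq : 0 < q)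
    (hM : 32 * (n + 1) * (n + 1) * (X * X) ≤ M) (hX : 4 * q ^ 2 ≤ X) {G : SimpleGraph (Fin n)} :
    wp n M m (initWeights q) (fun s' => WeightInv G q X 0 s') s := by
  have hq1 : 1 ≤ q ^ 2 := Nat.one_le_pow _ _ hq
  have hX1 : 1 ≤ X := by omega
  have hXX : X ≤ X * X := Nat.le_mul_of_pos_left _ hX1
  have hb1 : 32 * (X * X) ≤ M := le_trans (by nlinarith [Nat.zero_le (n * n * (X * X)), Nat.zero_le (n * (X * X))]) hM
  have hb2 : n * n * (X * X) < M := lt_of_lt_of_le (by nlinarith [Nat.zero_le (n * n * (X * X)), Nat.zero_le (n * (X * X))]) hM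
  have hb3 : n * n * (4 * q ^ 2) ≤ n * n * (X * X) := Nat.mul_le_mul_left _ (by omega)
  have hb4 : n * n * 1 ≤ n * n * (X * X) := Nat.mul_le_mul_left _ (by omega)
  have hlit : 4 * q ^ 2 < M := by omega
  refine wp_seq.2 ?_
  refine wp_double (fun i j s' => ∀ u v : Fin n, Before i j u v →
    s'.a 10 u v = 4 * q ^ 2 ∧ s'.a 11 u v = 4 * q ^ 2)
    hs (by decide) (by decide) (by decide) rfl rfl ?_ ?_ ?_ ?_ ?_
  · rintro i j s' k z (rfl | rfl) h <;> exact h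
  · intro u v hb; exact absurd hb before_zero
  · intro i hi j hj s' hfr hx hy hI
    simp only [wp_ite, wp_seq, wp_skip, wp_assign, wp_set, Ex.ok, Ex.eval, Bx.ok, Bx.Holds,
      WordRAM.Op.eval, setV_v, setV_a, setA_v, setA_a, upd_apply, Nat.reduceEqDiff, ↓reduceIte,
      true_and, and_true,
      hx, hy, hi, hj, hlit]
    intro u v hb
    split_ifs with h
    · exact ⟨rfl, rfl⟩
    · exact hI u v ((before_succ.1 hb).resolve_right h)
  · intro i hi s' hI u v hb
    exact hI u v ((before_row v.2).1 hb)
  · intro s' hf hI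
    have e0 : s'.v 0 = n := (hf.1 0 rfl).trans hs
    have h10 : mat n (s'.a 10) = fun _ _ => 4 * q ^ 2 := by
      funext u v; exact (hI u v (before_all u.2)).1
    have h11 : mat n (s'.a 11) = fun _ _ => 4 * q ^ 2 := by
      funext u v; exact (hI u v (before_all u.2)).2
    simp only [wp_ite, wp_seq, wp_skip, wp_assign, wp_set, Ex.ok, Ex.eval, Bx.ok, Bx.Holds,
      WordRAM.Op.eval, setV_v, setV_a, setA_v, setA_a, upd_apply, Nat.reduceEqDiff, ↓reduceIte,
      true_and, and_true,
      e0, hlit]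
    refine ⟨⟨by omega, by omega⟩, ?_, ?_, ?_, ?_, ?_, ?_⟩
    · simp only [setV_v, setV_a, Nat.reduceEqDiff, ↓reduceIte]
      rw [h10, h11]; exact PhaseInv.init G hq
    · simp only [setV_v, setV_a, Nat.reduceEqDiff, ↓reduceIte]
      rw [h11]; simp [mul_assoc]
    · simp only [setV_v, setV_a, Nat.reduceEqDiff, ↓reduceIte]
      rw [h11]; intro _ _; change 4 * q ^ 2 ≤ 2 * X; omega
    · simp only [setV_v, setV_a, Nat.reduceEqDiff, ↓reduceIte]; exact hX
    · simp
    · simp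

def weights (q : ℕ) : Pr := initWeights q ;; .loop 15 1 (phase q)

theorem wp_weights {n M m q X : ℕ} {s : St} (hs : s.v 0 = n) (hq : 0 < q) (hm : s.v 1 ≤ m)
    (hM : 32 * (n + 1) * (n + 1) * (X * X) ≤ M) (hX : 4 * q ^ 2 * 4 ^ s.v 1 ≤ X)
    {G : SimpleGraph (Fin n)} (hg : CodeRep (s.a 9) G) :
    wp n M m (weights q) (fun s' => WeightInv G q X (s.v 1) s') s := by
  have hX0 : 4 * q ^ 2 ≤ X := (Nat.le_mul_of_pos_right _ (by positivity)).trans hX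
  refine wp_seq.2 (wp_conseq (wp_initWeights (G := G) hs hq hM hX0) fun s1 hf1 h1 => ?_)
  have e0 : s1.v 0 = n := (hf1.1 0 rfl).trans hs
  have e1 : s1.v 1 = s.v 1 := hf1.1 1 rfl
  have e9 : s1.a 9 = s.a 9 := hf1.2 9 rfl
  refine wp_loop (fun k s' => WeightInv G q X k s') (by simpa [lim, e1] using hm) h1 ?_ ?_
  · intro k hk s' hf hI
    refine wp_phase ?_ hq hM ?_ ?_ ?_
    · rw [setV_v, if_neg (by decide), hf.1 0 rfl, e0]
    · refine le_trans (Nat.mul_le_mul_left _ (Nat.pow_le_pow_right (by norm_num) ?_)) hX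
      omega
    · rw [setV_a, hf.2 9 rfl, e9]; exact hg
    · exact ⟨hI.1, hI.2, hI.3, hI.4, hI.5, hI.6⟩
  · intro s' hf hI
    rw [← e1]
    exact ⟨hI.1, hI.2, hI.3, hI.4, hI.5, hI.6⟩

/-- Bernoulli's inequality for `(1 + 1 / q) ^ q`: in `q` phases the threshold at least doubles. -/
theorem two_mul_pow_le {q : ℕ} (hq : 0 < q) : 2 * q ^ q ≤ (q + 1) ^ q := by
  have h0 : (0 : ℚ) ≤ 1 / q := by positivity
  have h := one_add_mul_le_pow (a := (1 / q : ℚ)) (by linarith) q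
  have hq' : (0 : ℚ) < q := by exact_mod_cast hq
  have e : ((1 : ℚ) + 1 / q) = (q + 1) / q := by field_simp
  rw [mul_one_div_cancel hq'.ne', e, div_pow, le_div_iff₀ (by positivity)] at h
  exact_mod_cast (by linarith : (2 : ℚ) * q ^ q ≤ (q + 1) ^ q)

/-- The phases form `3 * (q + 1) * (l + 2)` groups of `q`, each of which doubles the threshold. As
`n + 2 ≤ 2 ^ (l + 2)`, the threshold gains the factor `(n + 2) ^ (3 * (q + 1))` that
`PhaseInv.near_optimal` requires. -/
theorem WeightInv.near_optimal {n : ℕ} {G : SimpleGraph (Fin n)} {q X l : ℕ} {s : St} (hq : 0 < q)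
    (hl : n < 2 ^ l) (h : WeightInv G q X (rate q * (l + 2)) s) {D : Setoid (Fin n)}
    (hD : 0 < cost G D) :
    (∑ a, ∑ b, (mat n (s.a 11) a b : ℝ)) ≤ factor q * (2 * cost G D) * s.v 13 := by
  refine h.inv.near_optimal hq ?_ hD
  have h2 : n + 2 ≤ 2 ^ (l + 2) := by rw [pow_add]; omega
  set r := 3 * (q + 1) with hr
  have hk : rate q * (l + 2) = q * (r * (l + 2)) := by unfold rate; ring
  have h3 := Nat.pow_le_pow_left (two_mul_pow_le hq) (r * (l + 2))
  rw [mul_pow, ← pow_mul, ← pow_mul, ← hk] at h3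
  have hlow := h.lower
  have h4 : (n + 2) ^ r ≤ 2 ^ (r * (l + 2)) := by
    rw [mul_comm r, pow_mul 2]; exact Nat.pow_le_pow_left h2 _
  refine Nat.le_of_mul_le_mul_right (c := q ^ (rate q * (l + 2))) ?_ (by positivity)
  calc 4 * q ^ 2 * (n + 2) ^ r * q ^ (rate q * (l + 2))
      ≤ 4 * q ^ 2 * 2 ^ (r * (l + 2)) * q ^ (rate q * (l + 2)) := by gcongr
    _ = 4 * q ^ 2 * (2 ^ (r * (l + 2)) * q ^ (rate q * (l + 2))) := by ring
    _ ≤ 4 * q ^ 2 * (q + 1) ^ (rate q * (l + 2)) := by gcongr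
    _ ≤ _ := hlow

end RamLang

/-! ### Bookkeeping for PIVOT -/

namespace CCC

open Classical

variable {V : Type*}

theorem sum_sum_erase {R : Finset V} {z : V} (hz : z ∈ R) {F : V → V → ℕ}
    (hF : ∀ a b, F a b = F b a) (h0 : F z z = 0) :
    ∑ a ∈ R, ∑ b ∈ R, F a b = ∑ a ∈ R.erase z, ∑ b ∈ R.erase z, F a b + 2 * ∑ b ∈ R, F z b := by
  have h1 : ∀ a, ∑ b ∈ R, F a b = ∑ b ∈ R.erase z, F a b + F a z := fun a =>
    (Finset.sum_erase_add _ _ hz).symm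
  have h2 : ∑ b ∈ R, F z b = ∑ a ∈ R.erase z, F a z := by
    rw [h1, h0, add_zero]
    exact Finset.sum_congr rfl fun a _ => hF z a
  rw [← Finset.sum_erase_add _ _ hz, h2]
  simp only [h1 _]
  rw [Finset.sum_add_distrib]
  ring

theorem Bad.swap_left {G : SimpleGraph V} {u v w : V} : Bad G u v w ↔ Bad G v u w := by
  rw [Bad.rotate, Bad.swap]

theorem not_bad_self {G : SimpleGraph V} {u v : V} : ¬ Bad G u v v := fun h => h.ne.2.2 rfl

/-- The removed node can occupy either of the two free positions of a triple, whence the `2`. One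
sum updates one node, so a removal costs quadratic time and all removals together cubic time. -/
theorem badCount_erase {G : SimpleGraph V} {R : Finset V} {z : V} (hz : z ∈ R) (v : V) :
    badCount G R v = badCount G (R.erase z) v + 2 * ∑ w ∈ R, if Bad G z v w then 1 else 0 := by
  unfold badCount
  rw [sum_sum_erase hz (fun a b => by rw [Bad.swap]) (by rw [if_neg not_bad_self])]
  simp only [Bad.swap_left (u := v)]

theorem badWeight_erase {G : SimpleGraph V} {W : V → V → ℕ} (hW : ∀ a b, W a b = W b a)
    {R : Finset V} {z : V} (hz : z ∈ R) (v : V) :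
    badWeight G W R v =
      badWeight G W (R.erase z) v + 2 * ∑ w ∈ R, if Bad G z v w then W z w else 0 := by
  unfold badWeight
  rw [sum_sum_erase hz (fun a b => by rw [Bad.swap, hW]) (by rw [if_neg not_bad_self])]
  simp only [Bad.swap_left (u := v)]

/-- Invariant of PIVOT: `A` are the unclustered nodes, `out` names the clusters of the others. -/
def PivotInv [Fintype V] (G : SimpleGraph V) (W : V → V → ℕ) (T : ℕ) (nm : V → ℕ) (A : Finset V)
    (out : V → ℕ) : Prop :=
  ∃ L₀ : List (Finset V),
    (∀ L, ChargedRun G W T A L → ChargedRun G W T Finset.univ (L₀ ++ L)) ∧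
    (∀ K ∈ L₀, ∀ x ∈ K, x ∉ A) ∧
    (∀ u v, u ∉ A → v ∉ A → (out u = out v ↔ ∃ K ∈ L₀, u ∈ K ∧ v ∈ K)) ∧
    ∀ v, v ∉ A → ∀ a ∈ A, out v ≠ nm a

theorem PivotInv.init [Fintype V] (G : SimpleGraph V) (W : V → V → ℕ) (T : ℕ) (nm out : V → ℕ) :
    PivotInv G W T nm Finset.univ out :=
  ⟨[], fun L h => by simpa using h, by simp, by simp, by simp⟩

/-- Each cluster is named after its pivot; later pivots are still unclustered, so names never clash.
The past of the run is kept as a map on its possible completions, because `ChargedRun` builds its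
list from the front. -/
theorem PivotInv.step [Fintype V] {G : SimpleGraph V} {W : V → V → ℕ} {T : ℕ} {nm out out' : V → ℕ}
    (hnm : Function.Injective nm) {A A' : Finset V} (h : PivotInv G W T nm A out) {u : V} (hu : u ∈ A)
    (hT : badCount G A u * T ≤ 3 * badWeight G W A u)
    (hA' : ∀ v, v ∈ A' ↔ v ∈ A ∧ ¬ (v = u ∨ G.Adj u v))
    (h1 : ∀ v, v ∈ A → (v = u ∨ G.Adj u v) → out' v = nm u)
    (h2 : ∀ v, v ∉ A → out' v = out v) : PivotInv G W T nm A' out' := by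
  obtain ⟨L₀, hL, hK, hout, hnew⟩ := h
  set K := A.filter (fun v => v = u ∨ G.Adj u v) with hKdef
  have hAK : A' = A \ K := by
    ext v
    rw [hA', Finset.mem_sdiff, hKdef, Finset.mem_filter]
    tauto
  have hmem : ∀ v, v ∉ A' → v ∈ K ∨ (v ∉ A ∧ v ∉ K) := by
    intro v hv
    rw [hA'] at hv
    rw [hKdef, Finset.mem_filter]
    tauto
  have hKA : ∀ v ∈ K, v ∈ A := fun v hv => (Finset.mem_filter.1 hv).1
  have outK : ∀ v ∈ K, out' v = nm u := fun v hv => h1 v (hKA v hv) (Finset.mem_filter.1 hv).2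
  have notL : ∀ v ∈ K, ∀ K' ∈ L₀, v ∉ K' := fun v hv K' hK' hvK' => hK K' hK' v hvK' (hKA v hv)
  refine ⟨L₀ ++ [K], fun L hrun => ?_, ?_, ?_, ?_⟩
  · rw [List.append_assoc]
    refine hL _ (ChargedRun.cons A u L hu hT ?_)
    rw [hAK] at hrun
    exact hrun
  · intro K' hK' x hx hxA'
    rw [hA'] at hxA'
    rcases List.mem_append.1 hK' with hK' | hK'
    · exact hK K' hK' x hx hxA'.1
    · rw [List.mem_singleton] at hK'
      subst hK'
      exact hxA'.2 (Finset.mem_filter.1 hx).2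
  · intro v w hv hw
    simp only [List.mem_append, List.mem_singleton]
    rcases hmem v hv with hv | ⟨hv, hv'⟩ <;> rcases hmem w hw with hw | ⟨hw, hw'⟩
    · rw [outK v hv, outK w hw]
      simp only [true_iff]
      exact ⟨K, .inr rfl, hv, hw⟩
    · rw [outK v hv, h2 w hw]
      constructor
      · intro h; exact absurd h.symm (hnew w hw u hu)
      · rintro ⟨K', hK' | rfl, h, h'⟩
        · exact absurd h (notL v hv K' hK')
        · exact absurd h' hw'
    · rw [outK w hw, h2 v hv]
      constructor
      · intro h; exact absurd h (hnew v hv u hu)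
      · rintro ⟨K', hK' | rfl, h, h'⟩
        · exact absurd h' (notL w hw K' hK')
        · exact absurd h hv'
    · rw [h2 v hv, h2 w hw, hout v w hv hw]
      constructor
      · rintro ⟨K', hK', h⟩; exact ⟨K', .inl hK', h⟩
      · rintro ⟨K', hK' | rfl, h⟩
        · exact ⟨K', hK', h⟩
        · exact absurd h.1 hv'
  · intro v hv a ha
    have haA := (hA' a).1 ha
    rcases hmem v hv with hv | ⟨hv, hv'⟩
    · rw [outK v hv]
      intro h
      exact haA.2 (.inl (hnm h).symm)
    · rw [h2 v hv]
      exact hnew v hv a haA.1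

theorem PivotInv.run [Fintype V] {G : SimpleGraph V} {W : V → V → ℕ} {T : ℕ} {nm out : V → ℕ}
    (h : PivotInv G W T nm ∅ out) : ∃ L, ChargedRun G W T Finset.univ L ∧
      ∀ u v, out u = out v ↔ ∃ K ∈ L, u ∈ K ∧ v ∈ K := by
  obtain ⟨L₀, hL, _, hout, _⟩ := h
  exact ⟨L₀, by simpa using hL [] .nil, fun u v => hout u v (by simp) (by simp)⟩

end CCC

/-! ### Programs: PIVOT -/

namespace RamLang

open CCC

set_option linter.unusedSimpArgs false

/-- The test whether the nodes in three variables form a bad triple. -/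
def badTest (x y z : ℕ) : Bx :=
  .eq (.bin .add (.bin .add (.get 9 (.var x) (.var y)) (.get 9 (.var x) (.var z)))
    (.get 9 (.var y) (.var z))) (.lit 2)

/-- `1` for bad triples, `0` for other triples, computed from a code matrix. -/
def badInd (g : ℕ → ℕ → ℕ) (u v w : ℕ) : ℕ := if g u v + g u w + g v w = 2 then 1 else 0

open Classical in
theorem CodeRep.badInd {n : ℕ} {g : ℕ → ℕ → ℕ} {G : SimpleGraph (Fin n)} (hg : CodeRep g G)
    (u v w : Fin n) : badInd g u v w = if Bad G u v w then 1 else 0 := by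
  simp only [RamLang.badInd, hg u v, hg u w, hg v w, Bad]
  congr

theorem CodeRep.le {n : ℕ} {g : ℕ → ℕ → ℕ} {G : SimpleGraph (Fin n)} (hg : CodeRep g G) {u v : ℕ}
    (hu : u < n) (hv : v < n) : g u v ≤ 3 :=
  (hg ⟨u, hu⟩ ⟨v, hv⟩).trans_le (code_le _ _ _)

theorem wp_badTest {n M m : ℕ} {Q : St → Prop} {s : St} {x y z i j k : ℕ} {p p' : Pr} (hM : 32 ≤ M)
    {G : SimpleGraph (Fin n)} (hg : CodeRep (s.a 9) G) (hx : s.v x = i) (hy : s.v y = j)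
    (hz : s.v z = k) (hi : i < n) (hj : j < n) (hk : k < n)
    (h1 : badInd (s.a 9) i j k = 1 → wp n M m p Q s)
    (h0 : badInd (s.a 9) i j k = 0 → wp n M m p' Q s) : wp n M m (.ite (badTest x y z) p p') Q s := by
  have c1 := hg.le hi hj
  have c2 := hg.le hi hk
  have c3 := hg.le hj hk
  unfold badTest
  simp only [wp_ite, wp_seq, wp_skip, wp_assign, wp_set, Ex.ok, Ex.eval, Bx.ok, Bx.Holds,
    WordRAM.Op.eval, setV_v, setV_a, setA_v, setA_a, upd_apply, Nat.reduceEqDiff, ↓reduceIte,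
    true_and, and_true,
    hx, hy, hz, hi, hj, hk, show 2 < M by omega]
  exact ⟨⟨by omega, by omega⟩, fun h => h1 (by simp [badInd, h]), fun h => h0 (by simp [badInd, h])⟩

/-! #### Initial counts -/

def initCount : Pr :=
  .assign 5 (.lit 0) ;; .loop 3 0 (.loop 4 0 (.ite (badTest 2 3 4)
    (.assign 5 (.bin .add (.var 5) (.lit 1))) .skip)) ;; .set 13 (.lit 0) (.var 2) (.var 5)

def initSum : Pr :=
  .assign 5 (.lit 0) ;; .loop 3 0 (.loop 4 0 (.ite (badTest 2 3 4)
    (.assign 5 (.bin .add (.var 5) (.get 11 (.var 3) (.var 4)))) .skip)) ;;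
  .set 14 (.lit 0) (.var 2) (.var 5)

/-- Array `12` holds the status of a node: `0` unclustered, `1` clustered but still included in the
counts, `2` removed. Arrays `13` and `14` hold `badCount` and `badWeight` relative to the nodes not
yet removed. -/
def initPivot : Pr := .loop 2 0 (initCount ;; initSum ;; .set 12 (.lit 0) (.var 2) (.lit 0))

theorem badCount_le {n : ℕ} {G : SimpleGraph (Fin n)} (R : Finset (Fin n)) (u : Fin n) :
    badCount G R u ≤ n * n := by
  classical
  unfold badCount
  refine (Finset.sum_le_card_nsmul _ _ n fun a _ =>
    (Finset.sum_le_card_nsmul _ _ 1 fun b _ => ?_).trans ?_).trans ?_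
  · split_ifs <;> simp
  · simpa using Finset.card_le_univ R
  · simpa using Nat.mul_le_mul_right n (Finset.card_le_univ R)

theorem badWeight_le {n k : ℕ} {G : SimpleGraph (Fin n)} {W : Fin n → Fin n → ℕ}
    (hW : ∀ a b, W a b ≤ k) (R : Finset (Fin n)) (u : Fin n) :
    badWeight G W R u ≤ n * n * k := by
  classical
  unfold badWeight
  have hR : R.card ≤ n := by simpa using Finset.card_le_univ R
  refine (Finset.sum_le_card_nsmul _ _ (n * k) fun a _ =>
    (Finset.sum_le_card_nsmul _ _ k fun b _ => ?_).trans ?_).trans ?_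
  · split_ifs
    · exact hW a b
    · simp
  · simpa using Nat.mul_le_mul_right k hR
  · rw [smul_eq_mul, mul_assoc]; exact Nat.mul_le_mul_right _ hR

theorem sum_badInd {n : ℕ} {g : ℕ → ℕ → ℕ} {G : SimpleGraph (Fin n)} (hg : CodeRep g G)
    (u : Fin n) : ∑ i ∈ Finset.range n, ∑ j ∈ Finset.range n, badInd g u i j =
      badCount G Finset.univ u := by
  rw [sum_mat]
  exact Finset.sum_congr rfl fun a _ => Finset.sum_congr rfl fun b _ => hg.badInd u a b

theorem sum_badInd_mul {n : ℕ} {g B : ℕ → ℕ → ℕ} {G : SimpleGraph (Fin n)} (hg : CodeRep g G)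
    (u : Fin n) : ∑ i ∈ Finset.range n, ∑ j ∈ Finset.range n, badInd g u i j * B i j =
      badWeight G (mat n B) Finset.univ u := by
  rw [sum_mat]
  refine Finset.sum_congr rfl fun a _ => Finset.sum_congr rfl fun b _ => ?_
  rw [mat, hg.badInd, ite_mul, one_mul, zero_mul]
  rfl

theorem wp_initCount {n M m i : ℕ} {s : St} (hs : s.v 0 = n) (hM : 32 * (n + 1) * (n + 1) ≤ M)
    {G : SimpleGraph (Fin n)} (hg : CodeRep (s.a 9) G) (h2 : s.v 2 = i) (hi : i < n) :
    wp n M m initCount (fun s' => ∀ v < n, s'.a 13 0 v =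
      if v = i then badCount G Finset.univ ⟨i, hi⟩ else s.a 13 0 v) s := by
  have hM' : n * n < M ∧ 32 ≤ M := ⟨by nlinarith, by nlinarith⟩
  unfold initCount
  refine wp_seq.2 ?_
  simp only [wp_ite, wp_seq, wp_skip, wp_assign, wp_set, Ex.ok, Ex.eval, Bx.ok, Bx.Holds,
    WordRAM.Op.eval, setV_v, setV_a, setA_v, setA_a, upd_apply, Nat.reduceEqDiff, ↓reduceIte,
    true_and, and_true,
    show 0 < M by omega]
  refine wp_sum2 (c := 5) (fun j k => badInd (s.a 9) i j k) (by simp [hs]) (by decide) (by decide)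
    (by decide) (by decide) (by decide) rfl rfl (by simp) ?_ ?_
  · intro j hj k hk s1 hf1 h3 h4 hle
    have e9 : s1.a 9 = s.a 9 := hf1.2 9 rfl
    have e2 : s1.v 2 = i := (hf1.1 2 rfl).trans h2
    have hle' := hle.trans ((sum_badInd hg ⟨i, hi⟩).le.trans (badCount_le _ _))
    refine wp_badTest hM'.2 (by rwa [e9]) e2 h3 h4 hi hj hk ?_ ?_ <;> rw [e9] <;> intro hb
    · rw [hb] at hle' ⊢
      simp only [wp_ite, wp_seq, wp_skip, wp_assign, wp_set, Ex.ok, Ex.eval, Bx.ok, Bx.Holds,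
        WordRAM.Op.eval, setV_v, setV_a, setA_v, setA_a, upd_apply, Nat.reduceEqDiff, ↓reduceIte,
        true_and, and_true,
        show 1 < M by omega]
      omega
    · rw [hb]; rfl
  · intro s1 hf1 h
    have e2 : s1.v 2 = i := (hf1.1 2 rfl).trans h2
    have e13 : s1.a 13 = s.a 13 := hf1.2 13 rfl
    rw [sum_badInd hg ⟨i, hi⟩] at h
    simp only [wp_ite, wp_seq, wp_skip, wp_assign, wp_set, Ex.ok, Ex.eval, Bx.ok, Bx.Holds,
      WordRAM.Op.eval, setV_v, setV_a, setA_v, setA_a, upd_apply, Nat.reduceEqDiff, ↓reduceIte,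
      true_and, and_true,
      e2, hi, h, e13, show 0 < M by omega, show 0 < n by omega]
    exact fun _ _ => trivial

theorem wp_initSum {n M m i X : ℕ} {s : St} (hs : s.v 0 = n) (hM : 32 ≤ M)
    {G : SimpleGraph (Fin n)} (hg : CodeRep (s.a 9) G) (hB : ∀ a b, mat n (s.a 11) a b ≤ 2 * X)
    (hX : n * n * (2 * X) < M) (h2 : s.v 2 = i) (hi : i < n) :
    wp n M m initSum (fun s' => ∀ v < n, s'.a 14 0 v =
      if v = i then badWeight G (mat n (s.a 11)) Finset.univ ⟨i, hi⟩ else s.a 14 0 v) s := by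
  unfold initSum
  refine wp_seq.2 ?_
  simp only [wp_ite, wp_seq, wp_skip, wp_assign, wp_set, Ex.ok, Ex.eval, Bx.ok, Bx.Holds,
    WordRAM.Op.eval, setV_v, setV_a, setA_v, setA_a, upd_apply, Nat.reduceEqDiff, ↓reduceIte,
    true_and, and_true,
    show 0 < M by omega]
  refine wp_sum2 (c := 5) (fun j k => badInd (s.a 9) i j k * s.a 11 j k) (by simp [hs]) (by decide)
    (by decide) (by decide) (by decide) (by decide) rfl rfl (by simp) ?_ ?_
  · intro j hj k hk s1 hf1 h3 h4 hle
    have e9 : s1.a 9 = s.a 9 := hf1.2 9 rfl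
    have e11 : s1.a 11 = s.a 11 := hf1.2 11 rfl
    have e2 : s1.v 2 = i := (hf1.1 2 rfl).trans h2
    have hle' := hle.trans ((sum_badInd_mul hg ⟨i, hi⟩).le.trans (badWeight_le hB _ _))
    refine wp_badTest hM (by rwa [e9]) e2 h3 h4 hi hj hk ?_ ?_ <;> rw [e9] <;> intro hb
    · rw [hb, one_mul] at hle' ⊢
      simp only [wp_ite, wp_seq, wp_skip, wp_assign, wp_set, Ex.ok, Ex.eval, Bx.ok, Bx.Holds,
        WordRAM.Op.eval, setV_v, setV_a, setA_v, setA_a, upd_apply, Nat.reduceEqDiff, ↓reduceIte,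
        true_and, and_true,
        e11, h3, h4, hj, hk]
      omega
    · rw [hb, zero_mul]; rfl
  · intro s1 hf1 h
    have e2 : s1.v 2 = i := (hf1.1 2 rfl).trans h2
    have e14 : s1.a 14 = s.a 14 := hf1.2 14 rfl
    rw [sum_badInd_mul hg ⟨i, hi⟩] at h
    simp only [wp_ite, wp_seq, wp_skip, wp_assign, wp_set, Ex.ok, Ex.eval, Bx.ok, Bx.Holds,
      WordRAM.Op.eval, setV_v, setV_a, setA_v, setA_a, upd_apply, Nat.reduceEqDiff, ↓reduceIte,
      true_and, and_true,
      e2, hi, h, e14, show 0 < M by omega, show 0 < n by omega]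
    exact fun _ _ => trivial

/-- The nodes that are not yet removed, and those that are not yet clustered. -/
def remaining (n : ℕ) (st : ℕ → ℕ) : Finset (Fin n) := Finset.univ.filter fun v => st v ≠ 2

def alive (n : ℕ) (st : ℕ → ℕ) : Finset (Fin n) := Finset.univ.filter fun v => st v = 0

/-- Invariant after `t` nodes have been removed. -/
structure PivotState {n : ℕ} (G : SimpleGraph (Fin n)) (W : Fin n → Fin n → ℕ) (T t : ℕ) (s : St) :
    Prop where
  st : ∀ v < n, s.a 12 0 v ≤ 2
  card : (remaining n (s.a 12 0)).card + t = n
  count : ∀ v ∈ remaining n (s.a 12 0), s.a 13 0 v = badCount G (remaining n (s.a 12 0)) v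
  sum : ∀ v ∈ remaining n (s.a 12 0), s.a 14 0 v = badWeight G W (remaining n (s.a 12 0)) v
  inv : PivotInv G W T (fun v => v) (alive n (s.a 12 0)) (fun v => s.a 0 0 v)

theorem wp_initPivot {n M m X T : ℕ} {s : St} (hs : s.v 0 = n) (hM : 32 * (n + 1) * (n + 1) ≤ M)
    {G : SimpleGraph (Fin n)} (hg : CodeRep (s.a 9) G) (hB : ∀ a b, mat n (s.a 11) a b ≤ 2 * X)
    (hX : n * n * (2 * X) < M) :
    wp n M m initPivot (fun s' => PivotState G (mat n (s.a 11)) T 0 s') s := by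
  have hM' : 32 ≤ M := by nlinarith
  refine wp_loop0 (fun i s' => ∀ v : Fin n, (v : ℕ) < i → s'.a 12 0 v = 0 ∧
    s'.a 13 0 v = badCount G Finset.univ v ∧
    s'.a 14 0 v = badWeight G (mat n (s.a 11)) Finset.univ v) hs (by simp) ?_ ?_
  · intro i hi s' hf hI
    have e0 : s'.v 0 = n := (hf.1 0 rfl).trans hs
    have e9 : s'.a 9 = s.a 9 := hf.2 9 rfl
    have e11 : s'.a 11 = s.a 11 := hf.2 11 rfl
    refine wp_seq.2 (wp_conseq (wp_initCount (i := i) (by simp [e0]) hM (by simpa [e9] using hg) (by simp) hi)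
      fun s1 hf1 h1 => ?_)
    have f0 : s1.v 0 = n := (hf1.1 0 rfl).trans (by simp [e0])
    have f2 : s1.v 2 = i := (hf1.1 2 rfl).trans (by simp)
    have f9 : s1.a 9 = s.a 9 := (hf1.2 9 rfl).trans e9
    have f11 : s1.a 11 = s.a 11 := (hf1.2 11 rfl).trans e11
    have f12 : s1.a 12 = s'.a 12 := hf1.2 12 rfl
    have f14 : s1.a 14 = s'.a 14 := hf1.2 14 rfl
    refine wp_seq.2 (wp_conseq (wp_initSum (i := i) f0 hM' (by rwa [f9]) (by rwa [f11]) hX f2 hi)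
      fun s2 hf2 h2 => ?_)
    have k2 : s2.v 2 = i := (hf2.1 2 rfl).trans f2
    have k12 : s2.a 12 = s'.a 12 := (hf2.2 12 rfl).trans f12
    have k13 : s2.a 13 = s1.a 13 := hf2.2 13 rfl
    simp only [wp_ite, wp_seq, wp_skip, wp_assign, wp_set, Ex.ok, Ex.eval, Bx.ok, Bx.Holds,
      WordRAM.Op.eval, setV_v, setV_a, setA_v, setA_a, upd_apply, Nat.reduceEqDiff, ↓reduceIte,
      true_and, and_true,
      k2, hi, show 0 < M by omega, show 0 < n by omega]
    intro v hv
    rw [k12, k13, h1 v v.2, h2 v v.2, f11, f14]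
    by_cases h : (v : ℕ) = i
    · have hv' : v = ⟨i, hi⟩ := Fin.ext h
      simp [hv']
    · simpa [h] using hI v (by omega)
  · intro s' hf hI
    have hR : remaining n ((s'.setV 2 n).a 12 0) = Finset.univ := by
      refine Finset.filter_true_of_mem fun v _ => ?_
      rw [setV_a, (hI v v.2).1]; decide
    have hA : alive n ((s'.setV 2 n).a 12 0) = Finset.univ :=
      Finset.filter_true_of_mem fun v _ => (hI v v.2).1
    refine ⟨fun v hv => ?_, ?_, ?_, ?_, ?_⟩
    · rw [setV_a, (hI ⟨v, hv⟩ hv).1]; decide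
    · rw [hR]; simp
    · rw [hR]; exact fun v _ => (hI v v.2).2.1
    · rw [hR]; exact fun v _ => (hI v v.2).2.2
    · rw [hA]; exact PivotInv.init _ _ _ _ _

end RamLang

/-! ### Programs: the steps of PIVOT -/

namespace RamLang

open CCC

set_option linter.unusedSimpArgs false

/-! #### Removing a node -/

def removeCount : Pr :=
  .assign 5 (.lit 0) ;; .loop 3 0 (.ite (.eq (.get 12 (.lit 0) (.var 3)) (.lit 2)) .skip
    (.ite (badTest 18 2 3) (.assign 5 (.bin .add (.var 5) (.lit 1))) .skip)) ;;
  .set 13 (.lit 0) (.var 2)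
    (.bin .sub (.get 13 (.lit 0) (.var 2)) (.bin .add (.var 5) (.var 5)))

def removeSum : Pr :=
  .assign 5 (.lit 0) ;; .loop 3 0 (.ite (.eq (.get 12 (.lit 0) (.var 3)) (.lit 2)) .skip
    (.ite (badTest 18 2 3) (.assign 5 (.bin .add (.var 5) (.get 11 (.var 18) (.var 3)))) .skip)) ;;
  .set 14 (.lit 0) (.var 2)
    (.bin .sub (.get 14 (.lit 0) (.var 2)) (.bin .add (.var 5) (.var 5)))

def removeNode : Pr :=
  .loop 2 0 (removeCount ;; removeSum) ;; .set 12 (.lit 0) (.var 18) (.lit 2)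

open Classical in
theorem sum_remaining {n : ℕ} (st f : ℕ → ℕ) :
    (∑ j ∈ Finset.range n, if st j = 2 then 0 else f j) = ∑ w ∈ remaining n st, f w := by
  rw [Finset.sum_range fun j => if st j = 2 then 0 else f j, remaining, Finset.sum_filter]
  refine Finset.sum_congr rfl fun w _ => ?_
  by_cases h : st w = 2 <;> simp [h]

open Classical in
theorem wp_removeCount {n M m i z : ℕ} {s : St} (hs : s.v 0 = n)
    (hM : 32 * (n + 1) * (n + 1) ≤ M) {G : SimpleGraph (Fin n)} (hg : CodeRep (s.a 9) G)
    (h2 : s.v 2 = i) (hi : i < n) (h18 : s.v 18 = z) (hz : z < n) :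
    wp n M m removeCount (fun s' => ∀ v < n, s'.a 13 0 v =
      if v = i then s.a 13 0 i -
        2 * ∑ w ∈ remaining n (s.a 12 0), (if Bad G ⟨z, hz⟩ ⟨i, hi⟩ w then 1 else 0)
      else s.a 13 0 v) s := by
  have hM' : 2 * n < M ∧ 32 ≤ M := ⟨by nlinarith, by nlinarith⟩
  unfold removeCount
  refine wp_seq.2 ?_
  simp only [wp_ite, wp_seq, wp_skip, wp_assign, wp_set, Ex.ok, Ex.eval, Bx.ok, Bx.Holds,
    WordRAM.Op.eval, setV_v, setV_a, setA_v, setA_a, upd_apply, Nat.reduceEqDiff, ↓reduceIte,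
    true_and, and_true,
    show 0 < M by omega]
  refine wp_sum (c := 5) (fun j => if s.a 12 0 j = 2 then 0 else badInd (s.a 9) z i j) (by simp [hs])
    (by decide) (by simp) ?_ ?_
  · intro j hj s1 hf1 h3 h5
    have e2 : s1.v 2 = i := (hf1.1 2 rfl).trans h2
    have e18 : s1.v 18 = z := (hf1.1 18 rfl).trans h18
    have e9 : s1.a 9 = s.a 9 := hf1.2 9 rfl
    have e12 : s1.a 12 = s.a 12 := hf1.2 12 rfl
    have hle := sum_range_lt (g := fun j => if s.a 12 0 j = 2 then 0 else badInd (s.a 9) z i j) (b := 1)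
      (M := M) (fun x _ => by unfold badInd; split_ifs <;> simp) hj (by omega)
    rw [← h5] at hle
    refine wp_ite.2 ⟨?_, fun h => ?_, fun h => ?_⟩
    · simp only [wp_ite, wp_seq, wp_skip, wp_assign, wp_set, Ex.ok, Ex.eval, Bx.ok, Bx.Holds,
        WordRAM.Op.eval, setV_v, setV_a, setA_v, setA_a, upd_apply, Nat.reduceEqDiff, ↓reduceIte,
        true_and, and_true,
        h3, hj, show 0 < M by omega, show 0 < n by omega, show 2 < M by omega]
    · simp only [wp_ite, wp_seq, wp_skip, wp_assign, wp_set, Ex.ok, Ex.eval, Bx.ok, Bx.Holds,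
        WordRAM.Op.eval, setV_v, setV_a, setA_v, setA_a, upd_apply, Nat.reduceEqDiff, ↓reduceIte,
        true_and, and_true,
        h3, e12] at h
      simp [h]
    simp only [wp_ite, wp_seq, wp_skip, wp_assign, wp_set, Ex.ok, Ex.eval, Bx.ok, Bx.Holds,
      WordRAM.Op.eval, setV_v, setV_a, setA_v, setA_a, upd_apply, Nat.reduceEqDiff, ↓reduceIte,
      true_and, and_true,
      h3, e12] at h
    simp only [h, if_false] at hle ⊢
    refine wp_badTest hM'.2 (by rwa [e9]) e18 e2 h3 hz hi hj ?_ ?_ <;> rw [e9] <;> intro hb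
    · rw [hb] at hle ⊢
      simp only [wp_ite, wp_seq, wp_skip, wp_assign, wp_set, Ex.ok, Ex.eval, Bx.ok, Bx.Holds,
        WordRAM.Op.eval, setV_v, setV_a, setA_v, setA_a, upd_apply, Nat.reduceEqDiff, ↓reduceIte,
        true_and, and_true,
        show 1 < M by omega]
      omega
    · rw [hb]; rfl
  · intro s1 hf1 h
    have e2 : s1.v 2 = i := (hf1.1 2 rfl).trans h2
    have e13 : s1.a 13 = s.a 13 := hf1.2 13 rfl
    have hle : s1.v 5 ≤ n := by
      rw [h]
      refine (Finset.sum_le_card_nsmul _ _ 1 fun x _ => ?_).trans (by simp)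
      unfold badInd; split_ifs <;> simp
    rw [sum_remaining] at h
    have hsum : ∑ w ∈ remaining n (s.a 12 0), badInd (s.a 9) z i w =
        ∑ w ∈ remaining n (s.a 12 0), (if Bad G ⟨z, hz⟩ ⟨i, hi⟩ w then 1 else 0) :=
      Finset.sum_congr rfl fun w _ => hg.badInd ⟨z, hz⟩ ⟨i, hi⟩ w
    rw [hsum] at h
    simp only [wp_ite, wp_seq, wp_skip, wp_assign, wp_set, Ex.ok, Ex.eval, Bx.ok, Bx.Holds,
      WordRAM.Op.eval, setV_v, setV_a, setA_v, setA_a, upd_apply, Nat.reduceEqDiff, ↓reduceIte,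
      true_and, and_true,
      e2, hi, e13, show 0 < M by omega, show 0 < n by omega]
    refine ⟨by omega, fun v hv => ?_⟩
    rw [h, two_mul]

open Classical in
theorem wp_removeSum {n M m i z X : ℕ} {s : St} (hs : s.v 0 = n)
    (hM : 32 ≤ M) {G : SimpleGraph (Fin n)} (hg : CodeRep (s.a 9) G)
    (hB : ∀ a b, mat n (s.a 11) a b ≤ 2 * X) (hX : n * (4 * X) < M)
    (h2 : s.v 2 = i) (hi : i < n) (h18 : s.v 18 = z) (hz : z < n) :
    wp n M m removeSum (fun s' => ∀ v < n, s'.a 14 0 v =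
      if v = i then s.a 14 0 i -
        2 * ∑ w ∈ remaining n (s.a 12 0),
          (if Bad G ⟨z, hz⟩ ⟨i, hi⟩ w then mat n (s.a 11) ⟨z, hz⟩ w else 0)
      else s.a 14 0 v) s := by
  have hX2 : n * (2 * X) + n * (2 * X) < M := by
    rw [← mul_add, ← add_mul]; exact hX
  unfold removeSum
  refine wp_seq.2 ?_
  simp only [wp_ite, wp_seq, wp_skip, wp_assign, wp_set, Ex.ok, Ex.eval, Bx.ok, Bx.Holds,
    WordRAM.Op.eval, setV_v, setV_a, setA_v, setA_a, upd_apply, Nat.reduceEqDiff, ↓reduceIte,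
    true_and, and_true,
    show 0 < M by omega]
  have hbd : ∀ j < n, (if s.a 12 0 j = 2 then 0 else badInd (s.a 9) z i j * s.a 11 z j) ≤ 2 * X := by
    intro j hj
    have := hB ⟨z, hz⟩ ⟨j, hj⟩
    unfold mat at this
    unfold badInd
    split_ifs <;> simp
    exact this
  refine wp_sum (c := 5) (fun j => if s.a 12 0 j = 2 then 0 else badInd (s.a 9) z i j * s.a 11 z j)
    (by simp [hs]) (by decide) (by simp) ?_ ?_
  · intro j hj s1 hf1 h3 h5
    have e2 : s1.v 2 = i := (hf1.1 2 rfl).trans h2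
    have e18 : s1.v 18 = z := (hf1.1 18 rfl).trans h18
    have e9 : s1.a 9 = s.a 9 := hf1.2 9 rfl
    have e11 : s1.a 11 = s.a 11 := hf1.2 11 rfl
    have e12 : s1.a 12 = s.a 12 := hf1.2 12 rfl
    have hle := sum_range_lt hbd hj (M := M) (by omega)
    rw [← h5] at hle
    refine wp_ite.2 ⟨?_, fun h => ?_, fun h => ?_⟩
    · simp only [wp_ite, wp_seq, wp_skip, wp_assign, wp_set, Ex.ok, Ex.eval, Bx.ok, Bx.Holds,
        WordRAM.Op.eval, setV_v, setV_a, setA_v, setA_a, upd_apply, Nat.reduceEqDiff, ↓reduceIte,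
        true_and, and_true,
        h3, hj, show 0 < M by omega, show 0 < n by omega, show 2 < M by omega]
    · simp only [wp_ite, wp_seq, wp_skip, wp_assign, wp_set, Ex.ok, Ex.eval, Bx.ok, Bx.Holds,
        WordRAM.Op.eval, setV_v, setV_a, setA_v, setA_a, upd_apply, Nat.reduceEqDiff, ↓reduceIte,
        true_and, and_true,
        h3, e12] at h
      simp [h]
    simp only [wp_ite, wp_seq, wp_skip, wp_assign, wp_set, Ex.ok, Ex.eval, Bx.ok, Bx.Holds,
      WordRAM.Op.eval, setV_v, setV_a, setA_v, setA_a, upd_apply, Nat.reduceEqDiff, ↓reduceIte,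
      true_and, and_true,
      h3, e12] at h
    simp only [h, if_false] at hle ⊢
    refine wp_badTest hM (by rwa [e9]) e18 e2 h3 hz hi hj ?_ ?_ <;> rw [e9] <;> intro hb
    · rw [hb, one_mul] at hle ⊢
      simp only [wp_ite, wp_seq, wp_skip, wp_assign, wp_set, Ex.ok, Ex.eval, Bx.ok, Bx.Holds,
        WordRAM.Op.eval, setV_v, setV_a, setA_v, setA_a, upd_apply, Nat.reduceEqDiff, ↓reduceIte,
        true_and, and_true,
        e11, e18, h3, hz, hj]
      omega
    · rw [hb, zero_mul]; rfl
  · intro s1 hf1 h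
    have e2 : s1.v 2 = i := (hf1.1 2 rfl).trans h2
    have e14 : s1.a 14 = s.a 14 := hf1.2 14 rfl
    have hle : s1.v 5 ≤ n * (2 * X) := by
      rw [h]
      exact (Finset.sum_le_card_nsmul _ _ (2 * X) fun x hx => hbd x (Finset.mem_range.1 hx)).trans
        (by simp)
    rw [sum_remaining] at h
    have hsum : ∑ w ∈ remaining n (s.a 12 0), badInd (s.a 9) z i w * s.a 11 z w =
        ∑ w ∈ remaining n (s.a 12 0),
          (if Bad G ⟨z, hz⟩ ⟨i, hi⟩ w then mat n (s.a 11) ⟨z, hz⟩ w else 0) := by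
      refine Finset.sum_congr rfl fun w _ => ?_
      rw [hg.badInd ⟨z, hz⟩ ⟨i, hi⟩ w, ite_mul, one_mul, zero_mul]
      rfl
    rw [hsum] at h
    simp only [wp_ite, wp_seq, wp_skip, wp_assign, wp_set, Ex.ok, Ex.eval, Bx.ok, Bx.Holds,
      WordRAM.Op.eval, setV_v, setV_a, setA_v, setA_a, upd_apply, Nat.reduceEqDiff, ↓reduceIte,
      true_and, and_true,
      e2, hi, e14, show 0 < M by omega, show 0 < n by omega]
    refine ⟨by omega, fun v hv => ?_⟩
    rw [h, two_mul]

theorem wp_removeNode {n M m z t T X : ℕ} {s : St} (hs : s.v 0 = n)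
    (hM : 32 * (n + 1) * (n + 1) ≤ M) {G : SimpleGraph (Fin n)} (hg : CodeRep (s.a 9) G)
    (hB : ∀ a b, mat n (s.a 11) a b ≤ 2 * X) (hX : n * (4 * X) < M)
    (hsymm : ∀ a b, mat n (s.a 11) a b = mat n (s.a 11) b a)
    (h18 : s.v 18 = z) (hz : z < n) (h1 : s.a 12 0 z = 1)
    (h : PivotState G (mat n (s.a 11)) T t s) :
    wp n M m removeNode (fun s' => PivotState G (mat n (s.a 11)) T (t + 1) s') s := by
  classical
  have hM' : 32 ≤ M := by nlinarith
  set R := remaining n (s.a 12 0) with hR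
  set W := mat n (s.a 11) with hW
  refine wp_seq.2 ?_
  -- All updates refer to the old set `R`, which contains `z`, since the status of `z` changes only
  -- after the loop. This is harmless, as a bad triple cannot contain `z` twice.
  refine wp_loop0 (fun i s' => ∀ v : Fin n,
    (s'.a 13 0 v = if (v : ℕ) < i then
      s.a 13 0 v - 2 * ∑ w ∈ R, (if Bad G ⟨z, hz⟩ v w then 1 else 0) else s.a 13 0 v) ∧
    (s'.a 14 0 v = if (v : ℕ) < i then
      s.a 14 0 v - 2 * ∑ w ∈ R, (if Bad G ⟨z, hz⟩ v w then W ⟨z, hz⟩ w else 0) else s.a 14 0 v))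
    hs (by simp) ?_ ?_
  · intro i hi s' hf hI
    have e0 : s'.v 0 = n := (hf.1 0 rfl).trans hs
    have e18 : s'.v 18 = z := (hf.1 18 rfl).trans h18
    have e9 : s'.a 9 = s.a 9 := hf.2 9 rfl
    have e11 : s'.a 11 = s.a 11 := hf.2 11 rfl
    have e12 : s'.a 12 = s.a 12 := hf.2 12 rfl
    refine wp_seq.2 (wp_conseq (wp_removeCount (i := i) (z := z) (by simp [e0]) hM
      (by simpa [e9] using hg) (by simp) hi (by simp [e18]) hz) fun s1 hf1 h1 => ?_)
    have f0 : s1.v 0 = n := (hf1.1 0 rfl).trans (by simp [e0])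
    have f2 : s1.v 2 = i := (hf1.1 2 rfl).trans (by simp)
    have f18 : s1.v 18 = z := (hf1.1 18 rfl).trans (by simp [e18])
    have f9 : s1.a 9 = s.a 9 := (hf1.2 9 rfl).trans e9
    have f11 : s1.a 11 = s.a 11 := (hf1.2 11 rfl).trans e11
    have f12 : s1.a 12 = s.a 12 := (hf1.2 12 rfl).trans e12
    have f14 : s1.a 14 = s'.a 14 := hf1.2 14 rfl
    refine wp_conseq (wp_removeSum (i := i) (z := z) (X := X) f0 hM' (by rwa [f9]) (by rwa [f11]) hX
      f2 hi f18 hz) fun s2 hf2 h2 => ?_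
    have k13 : s2.a 13 = s1.a 13 := hf2.2 13 rfl
    intro v
    rw [k13, h1 v v.2, h2 v v.2, f14, f12, f11, setV_a, e12, ← hR, ← hW]
    obtain ⟨i1, i2⟩ := hI v
    by_cases hv : (v : ℕ) = i
    · have hv' : v = ⟨i, hi⟩ := Fin.ext hv
      subst hv'
      simp only [lt_irrefl, if_false] at i1 i2
      simp [i1, i2]
    · have hlt : (v : ℕ) < i + 1 ↔ (v : ℕ) < i := by omega
      simp only [hv, if_false, hlt]
      exact ⟨i1, i2⟩
  · intro s' hf hI
    have e18 : s'.v 18 = z := (hf.1 18 rfl).trans h18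
    have e12 : s'.a 12 = s.a 12 := hf.2 12 rfl
    have eo : s'.a 0 = s.a 0 := hf.2 0 rfl
    simp only [wp_ite, wp_seq, wp_skip, wp_assign, wp_set, Ex.ok, Ex.eval, Bx.ok, Bx.Holds,
      WordRAM.Op.eval, setV_v, setV_a, setA_v, setA_a, upd_apply, Nat.reduceEqDiff, ↓reduceIte,
      true_and, and_true,
      e18, hz, show 0 < M by omega, show 2 < M by omega, show 0 < n by omega]
    have hzR : (⟨z, hz⟩ : Fin n) ∈ R := by
      rw [hR, remaining, Finset.mem_filter]
      exact ⟨Finset.mem_univ _, by simp [h1]⟩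
    have hrem : remaining n (upd (s.a 12) 0 z 2 0) = R.erase ⟨z, hz⟩ := by
      ext v
      simp only [remaining, upd_apply, hR, Finset.mem_filter, Finset.mem_univ, true_and,
        Finset.mem_erase, ne_eq, Fin.ext_iff]
      by_cases hv : (v : ℕ) = z <;> simp [hv]
    have halive : alive n (upd (s.a 12) 0 z 2 0) = alive n (s.a 12 0) := by
      ext v
      simp only [alive, upd_apply, Finset.mem_filter, Finset.mem_univ, true_and]
      by_cases hv : (v : ℕ) = z <;> simp [hv, h1]
    constructor
    · intro v hv
      simp only [setA_a, setV_a, ↓reduceIte, upd_apply, e12, true_and]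
      split_ifs
      · exact le_rfl
      · exact h.st v hv
    · simp only [setA_a, setV_a, ↓reduceIte, e12, hrem]
      have := Finset.card_erase_add_one hzR
      have := h.card
      rw [← hR] at this
      omega
    · simp only [setA_a, setV_a, ↓reduceIte, e12, hrem, Nat.reduceEqDiff]
      intro v hv
      -- The truncated subtraction is exact, because `badCount_erase` writes the old value as a sum
      -- with the subtracted term.
      rw [(hI v).1, if_pos v.2, h.count v (Finset.mem_of_mem_erase hv), ← hR, badCount_erase hzR v,
        Nat.add_sub_cancel]
      convert rfl
    · simp only [setA_a, setV_a, ↓reduceIte, e12, hrem, Nat.reduceEqDiff]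
      intro v hv
      rw [(hI v).2, if_pos v.2, h.sum v (Finset.mem_of_mem_erase hv), ← hR,
        badWeight_erase hsymm hzR v, Nat.add_sub_cancel]
      convert rfl
    · simp only [setA_a, setV_a, ↓reduceIte, e12, halive, Nat.reduceEqDiff, eo]
      exact h.inv

end RamLang

/-! ### Programs: PIVOT, choice of the pivots -/

namespace RamLang

open CCC

set_option linter.unusedSimpArgs false

def choosePending : Pr :=
  .loop 2 0 (.ite (.eq (.get 12 (.lit 0) (.var 2)) (.lit 1)) (.assign 18 (.var 2)) .skip)

def choosePivot : Pr :=
  .loop 2 0 (.ite (.eq (.get 12 (.lit 0) (.var 2)) (.lit 0))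
    (.ite (.lt (.bin .mul (.lit 3) (.get 14 (.lit 0) (.var 2)))
      (.bin .mul (.get 13 (.lit 0) (.var 2)) (.var 13))) .skip (.assign 18 (.var 2))) .skip)

def markCluster : Pr :=
  .loop 2 0 (.ite (.eq (.get 12 (.lit 0) (.var 2)) (.lit 0))
    (.ite (.lt (.lit 0) (.get 9 (.var 18) (.var 2)))
      (.set 12 (.lit 0) (.var 2) (.lit 1) ;; .set 0 (.lit 0) (.var 2) (.var 18)) .skip) .skip)

/-- Each step removes exactly one node, so `n` steps of quadratic cost replace a loop over pivots. A
new pivot is chosen only when no clustered node is waiting for removal, and just then the counts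
refer to the unclustered nodes. -/
def pivotStep : Pr :=
  .assign 18 (.var 0) ;; choosePending ;;
  .ite (.lt (.var 18) (.var 0)) .skip (choosePivot ;; markCluster) ;; removeNode

def pivot : Pr := initPivot ;; .loop 19 0 pivotStep

theorem wp_choosePending {n M m : ℕ} {s : St} (hs : s.v 0 = n) (hM : 32 ≤ M) (h18 : s.v 18 = n) :
    wp n M m choosePending (fun s' => (s'.v 18 < n ∧ s.a 12 0 (s'.v 18) = 1) ∨
      (s'.v 18 = n ∧ ∀ i < n, s.a 12 0 i ≠ 1)) s := by
  refine wp_search (r := 18) (fun i => s.a 12 0 i = 1) hs (by decide) h18 ?_ fun _ _ h => h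
  intro i hi s' hf hx
  have e12 : s'.a 12 = s.a 12 := hf.2 12 rfl
  simp only [wp_ite, wp_seq, wp_skip, wp_assign, wp_set, Ex.ok, Ex.eval, Bx.ok, Bx.Holds,
    WordRAM.Op.eval, setV_v, setV_a, setA_v, setA_a, upd_apply, Nat.reduceEqDiff, ↓reduceIte,
    true_and, and_true,
    hx, e12, hi, show 0 < M by omega, show 1 < M by omega, show 0 < n by omega]
  exact ⟨fun h => .inl h, fun h => .inr h⟩

theorem wp_choosePivot {n M m X : ℕ} {s : St} (hs : s.v 0 = n) (hM : 32 ≤ M) (h18 : s.v 18 = n)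
    (hX : n * n * (6 * X) < M) (hT : s.v 13 ≤ X)
    (h13 : ∀ v < n, s.a 12 0 v = 0 → s.a 13 0 v ≤ n * n)
    (h14 : ∀ v < n, s.a 12 0 v = 0 → s.a 14 0 v ≤ n * n * (2 * X)) :
    wp n M m choosePivot (fun s' =>
      (s'.v 18 < n ∧ (s.a 12 0 (s'.v 18) = 0 ∧
        s.a 13 0 (s'.v 18) * s.v 13 ≤ 3 * s.a 14 0 (s'.v 18))) ∨
      (s'.v 18 = n ∧ ∀ i < n, ¬ (s.a 12 0 i = 0 ∧ s.a 13 0 i * s.v 13 ≤ 3 * s.a 14 0 i))) s := by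
  refine wp_search (r := 18) (fun i => s.a 12 0 i = 0 ∧ s.a 13 0 i * s.v 13 ≤ 3 * s.a 14 0 i)
    hs (by decide) h18 ?_ fun _ _ h => h
  intro i hi s' hf hx
  have e12 : s'.a 12 = s.a 12 := hf.2 12 rfl
  have e13 : s'.a 13 = s.a 13 := hf.2 13 rfl
  have e14 : s'.a 14 = s.a 14 := hf.2 14 rfl
  have eT : s'.v 13 = s.v 13 := hf.1 13 rfl
  simp only [wp_ite, wp_seq, wp_skip, wp_assign, wp_set, Ex.ok, Ex.eval, Bx.ok, Bx.Holds,
    WordRAM.Op.eval, setV_v, setV_a, setA_v, setA_a, upd_apply, Nat.reduceEqDiff, ↓reduceIte,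
    true_and, and_true,
    hx, e12, e13, e14, eT, hi, show 0 < M by omega, show 3 < M by omega, show 0 < n by omega]
  refine ⟨fun h => ⟨⟨?_, ?_⟩, fun hlt => ?_, fun hge => ?_⟩, fun h => ?_⟩
  · have := h14 i hi h
    have e : n * n * (6 * X) = 3 * (n * n * (2 * X)) := by ring
    omega
  · have := Nat.mul_le_mul (h13 i hi h) hT
    have e : n * n * (6 * X) = 6 * (n * n * X) := by ring
    omega
  · exact .inr fun h' => absurd h'.2 (not_le.2 hlt)
  · exact .inl ⟨h, not_lt.1 hge⟩
  · exact .inr fun h' => h h'.1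

theorem wp_markCluster {n M m z : ℕ} {s : St} (hs : s.v 0 = n) (hM : 32 ≤ M) (h18 : s.v 18 = z)
    (hz : z < n) :
    wp n M m markCluster (fun s' => ∀ v < n,
      (s'.a 12 0 v = if s.a 12 0 v = 0 ∧ 0 < s.a 9 z v then 1 else s.a 12 0 v) ∧
      (s'.a 0 0 v = if s.a 12 0 v = 0 ∧ 0 < s.a 9 z v then z else s.a 0 0 v)) s := by
  refine wp_loop0 (fun i s' => ∀ v < n,
      (s'.a 12 0 v = if v < i ∧ s.a 12 0 v = 0 ∧ 0 < s.a 9 z v then 1 else s.a 12 0 v) ∧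
      (s'.a 0 0 v = if v < i ∧ s.a 12 0 v = 0 ∧ 0 < s.a 9 z v then z else s.a 0 0 v)) hs
    (by simp) ?_ ?_
  · intro i hi s' hf hI
    have e18 : s'.v 18 = z := (hf.1 18 rfl).trans h18
    have e9 : s'.a 9 = s.a 9 := hf.2 9 rfl
    have hi12 := (hI i hi).1
    simp only [lt_irrefl, false_and, if_false] at hi12
    simp only [wp_ite, wp_seq, wp_skip, wp_assign, wp_set, Ex.ok, Ex.eval, Bx.ok, Bx.Holds,
      WordRAM.Op.eval, setV_v, setV_a, setA_v, setA_a, upd_apply, Nat.reduceEqDiff, ↓reduceIte,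
      true_and, and_true,
      e18, e9, hz, hi, hi12, show 0 < M by omega, show 1 < M by omega, show 0 < n by omega]
    have hne : ∀ v, v ≠ i → (v < i + 1 ↔ v < i) := by omega
    refine ⟨fun h1 => ⟨fun h2 v hv => ?_, fun h2 v hv => ?_⟩, fun h1 v hv => ?_⟩ <;>
      obtain ⟨i1, i2⟩ := hI v hv <;> by_cases hvi : v = i
    · subst hvi; simp [h1, h2]
    · simp only [hvi, if_false, hne v hvi]; exact ⟨i1, i2⟩
    · subst hvi; simp_all
    · simp only [hne v hvi]; exact ⟨i1, i2⟩
    · subst hvi; simp_all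
    · simp only [hne v hvi]; exact ⟨i1, i2⟩
  · intro s' hf hI v hv
    simpa [hv] using hI v hv

theorem wp_pivotStep {n M m t T X : ℕ} {s : St} (hs : s.v 0 = n)
    (hM : 32 * (n + 1) * (n + 1) ≤ M) {G : SimpleGraph (Fin n)} (hg : CodeRep (s.a 9) G)
    (hB : ∀ a b, mat n (s.a 11) a b ≤ 2 * X) (hX : n * (4 * X) < M) (hX2 : n * n * (6 * X) < M)
    (hT : s.v 13 = T) (hTX : T ≤ X) (hF : Feasible G (mat n (s.a 11)) T) (ht : t < n)
    (h : PivotState G (mat n (s.a 11)) T t s) :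
    wp n M m pivotStep (fun s' => PivotState G (mat n (s.a 11)) T (t + 1) s') s := by
  have hM' : n < M ∧ 32 ≤ M := ⟨by nlinarith, by nlinarith⟩
  unfold pivotStep
  refine wp_seq.2 ?_
  simp only [wp_ite, wp_seq, wp_skip, wp_assign, wp_set, Ex.ok, Ex.eval, Bx.ok, Bx.Holds,
    WordRAM.Op.eval, setV_v, setV_a, setA_v, setA_a, upd_apply, Nat.reduceEqDiff, ↓reduceIte,
    true_and, and_true,
    hs]
  refine wp_conseq (wp_choosePending (by simp [hs]) hM'.2 (by simp)) fun s1 hf1 h1 => ?_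
  simp only [setV_a] at h1
  have a0 : s1.v 0 = n := (hf1.1 0 rfl).trans hs
  have aT : s1.v 13 = T := (hf1.1 13 rfl).trans hT
  have aa : s1.a = s.a := funext fun t => hf1.2 t rfl
  refine wp_seq.2 (wp_ite.2 ⟨⟨trivial, trivial⟩, fun hlt => ?_, fun hge => ?_⟩)
  · simp only [wp_ite, wp_seq, wp_skip, wp_assign, wp_set, Ex.ok, Ex.eval, Bx.ok, Bx.Holds,
      WordRAM.Op.eval, setV_v, setV_a, setA_v, setA_a, upd_apply, Nat.reduceEqDiff, ↓reduceIte,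
      true_and, and_true,
      a0] at hlt
    have h12 := (h1.resolve_right (by omega)).2
    have hrm := wp_removeNode (m := m) (z := s1.v 18) (t := t) (T := T) a0 hM (by rwa [aa])
      (by rwa [aa]) hX (by rw [aa]; exact hF.symm) rfl hlt (by rwa [aa])
      (by rw [aa]; exact ⟨by rw [aa]; exact h.st, by rw [aa]; exact h.card, by rw [aa]; exact h.count,
        by rw [aa]; exact h.sum, by rw [aa]; exact h.inv⟩)
    rw [aa] at hrm
    exact hrm
  · simp only [wp_ite, wp_seq, wp_skip, wp_assign, wp_set, Ex.ok, Ex.eval, Bx.ok, Bx.Holds,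
      WordRAM.Op.eval, setV_v, setV_a, setA_v, setA_a, upd_apply, Nat.reduceEqDiff, ↓reduceIte,
      true_and, and_true,
      a0] at hge
    obtain ⟨h18, hnone⟩ := h1.resolve_left fun h' => hge h'.1
    -- No node has status `1` here, so the remaining nodes are exactly the unclustered ones.
    have hRA : remaining n (s.a 12 0) = alive n (s.a 12 0) := by
      ext v
      simp only [remaining, alive, Finset.mem_filter, Finset.mem_univ, true_and]
      have := h.st v v.2
      have := hnone v v.2
      omega
    have hmem : ∀ v : Fin n, v ∈ alive n (s.a 12 0) ↔ s.a 12 0 v = 0 := by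
      intro v; simp [alive]
    have hne : (alive n (s.a 12 0)).Nonempty := by
      rw [← hRA, ← Finset.card_pos]
      have := h.card
      omega
    have hcount := h.count
    have hsum := h.sum
    rw [hRA] at hcount hsum
    refine wp_seq.2 (wp_conseq (wp_choosePivot (X := X) a0 hM'.2 h18 hX2 (by rw [aT]; exact hTX)
      ?_ ?_) fun s2 hf2 h2 => ?_)
    · intro v hv h0
      rw [aa] at h0 ⊢
      rw [hcount ⟨v, hv⟩ ((hmem ⟨v, hv⟩).2 h0)]
      exact badCount_le _ _
    · intro v hv h0
      rw [aa] at h0 ⊢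
      rw [hsum ⟨v, hv⟩ ((hmem ⟨v, hv⟩).2 h0)]
      exact badWeight_le hB _ _
    rw [aa, aT] at h2
    have b0 : s2.v 0 = n := (hf2.1 0 rfl).trans a0
    have ba : s2.a = s.a := (funext fun t => hf2.2 t rfl : s2.a = s1.a).trans aa
    -- The search cannot fail: feasible weights guarantee a pivot that is paid for.
    obtain ⟨hz, hz0, hcharge⟩ := h2.resolve_right fun h' => by
      obtain ⟨u, hu, hle⟩ := exists_charged_pivot hne hF.cover
      refine h'.2 u u.2 ⟨(hmem u).1 hu, ?_⟩
      rw [hcount u hu, hsum u hu]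
      exact hle
    set z : Fin n := ⟨s2.v 18, hz⟩ with hzdef
    have hzA : z ∈ alive n (s.a 12 0) := (hmem z).2 hz0
    rw [show s.a 13 0 (s2.v 18) = _ from hcount z hzA,
      show s.a 14 0 (s2.v 18) = _ from hsum z hzA] at hcharge
    refine wp_conseq (wp_markCluster b0 hM'.2 rfl hz) fun s3 hf3 h3 => ?_
    rw [ba] at h3
    have c0 : s3.v 0 = n := (hf3.1 0 rfl).trans b0
    have c18 : s3.v 18 = z := hf3.1 18 rfl
    have c9 : s3.a 9 = s.a 9 := (hf3.2 9 rfl).trans (by rw [ba])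
    have c11 : s3.a 11 = s.a 11 := (hf3.2 11 rfl).trans (by rw [ba])
    have c13 : s3.a 13 = s.a 13 := (hf3.2 13 rfl).trans (by rw [ba])
    have c14 : s3.a 14 = s.a 14 := (hf3.2 14 rfl).trans (by rw [ba])
    have hcode : ∀ v : Fin n, 0 < s.a 9 (s2.v 18) v ↔ (v = z ∨ G.Adj z v) := by
      intro v
      rw [show s.a 9 (s2.v 18) v = _ from hg z v, code_pos]
    have hR3 : remaining n (s3.a 12 0) = remaining n (s.a 12 0) := by
      ext v
      simp only [remaining, Finset.mem_filter, Finset.mem_univ, true_and, (h3 v v.2).1]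
      split_ifs with hc
      · simp [hc.1]
      · rfl
    have hst : PivotState G (mat n (s3.a 11)) T t s3 := by
      rw [c11]
      refine ⟨fun v hv => ?_, by rw [hR3]; exact h.card, by rw [hR3, c13]; exact h.count,
        by rw [hR3, c14]; exact h.sum, ?_⟩
      · rw [(h3 v hv).1]
        have := h.st v hv
        split_ifs <;> omega
      · refine h.inv.step Fin.val_injective hzA hcharge ?_ ?_ ?_
        · intro v
          rw [hmem, alive, Finset.mem_filter, (h3 v v.2).1, ← hcode]
          simp only [Finset.mem_univ, true_and]
          split_ifs with hc
          · simp [hc.2]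
          · tauto
        · intro v hv hv'
          rw [(h3 v v.2).2, if_pos ⟨(hmem v).1 hv, (hcode v).2 hv'⟩]
        · intro v hv
          rw [(h3 v v.2).2, if_neg fun hc => hv ((hmem v).2 hc.1)]
    have hrm := wp_removeNode (m := m) (z := z) (t := t) (T := T) c0 hM (by rwa [c9])
      (by rwa [c11]) hX (by rw [c11]; exact hF.symm) c18 z.2 ?_ hst
    · rw [c11] at hrm
      exact hrm
    · rw [(h3 z z.2).1, if_pos ⟨hz0, (hcode z).2 (.inl rfl)⟩]

theorem wp_pivot {n M m T X : ℕ} {s : St} (hs : s.v 0 = n)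
    (hM : 32 * (n + 1) * (n + 1) * (X * X) ≤ M) (hX : 0 < X) {G : SimpleGraph (Fin n)}
    (hg : CodeRep (s.a 9) G) (hB : ∀ a b, mat n (s.a 11) a b ≤ 2 * X)
    (hT : s.v 13 = T) (hTX : T ≤ X) (hF : Feasible G (mat n (s.a 11)) T) :
    wp n M m pivot (fun s' => ∃ L, ChargedRun G (mat n (s.a 11)) T Finset.univ L ∧
      ∀ u v : Fin n, s'.a 0 0 u = s'.a 0 0 v ↔ ∃ K ∈ L, u ∈ K ∧ v ∈ K) s := by
  have hXX : X ≤ X * X := Nat.le_mul_of_pos_left _ hX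
  have hM1 : 32 * (n + 1) * (n + 1) ≤ M :=
    (Nat.le_mul_of_pos_right _ (by positivity)).trans hM
  have hM2 : 32 * (n + 1) * (n + 1) * X ≤ M := (Nat.mul_le_mul_left _ hXX).trans hM
  have hb1 : n * (4 * X) < M := by nlinarith [Nat.zero_le (n * n * X), Nat.zero_le (n * X)]
  have hb2 : n * n * (6 * X) < M := by nlinarith [Nat.zero_le (n * n * X), Nat.zero_le (n * X)]
  have hb3 : n * n * (2 * X) < M := by nlinarith [Nat.zero_le (n * n * X), Nat.zero_le (n * X)]
  refine wp_seq.2 (wp_conseq (wp_initPivot (T := T) hs hM1 hg hB hb3) fun s1 hf1 h1 => ?_)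
  have e0 : s1.v 0 = n := (hf1.1 0 rfl).trans hs
  have eT : s1.v 13 = T := (hf1.1 13 rfl).trans hT
  have e9 : s1.a 9 = s.a 9 := hf1.2 9 rfl
  have e11 : s1.a 11 = s.a 11 := hf1.2 11 rfl
  refine wp_loop0 (fun t s' => PivotState G (mat n (s.a 11)) T t s') e0 h1 ?_ ?_
  · intro t ht s' hf hI
    have k0 : s'.v 0 = n := (hf.1 0 rfl).trans e0
    have kT : s'.v 13 = T := (hf.1 13 rfl).trans eT
    have k9 : s'.a 9 = s.a 9 := (hf.2 9 rfl).trans e9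
    have k11 : s'.a 11 = s.a 11 := (hf.2 11 rfl).trans e11
    have := wp_pivotStep (m := m) (s := s'.setV 19 t) (t := t) (T := T) (G := G) (by simp [k0]) hM1
      (by simpa [k9] using hg) (by simpa [k11] using hB) hb1 hb2 (by simp [kT]) hTX
      (by simpa [k11] using hF) ht
    simp only [setV_a, k11] at this
    exact this ⟨hI.1, hI.2, hI.3, hI.4, hI.5⟩
  · intro s' hf hI
    have hR : remaining n (s'.a 12 0) = ∅ := by
      rw [← Finset.card_eq_zero]; have := hI.card; omega
    have hA : alive n (s'.a 12 0) = ∅ := by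
      rw [Finset.eq_empty_iff_forall_notMem] at hR ⊢
      intro v hv
      refine hR v ?_
      simp only [alive, remaining, Finset.mem_filter, Finset.mem_univ, true_and] at hv ⊢
      omega
    have := hI.inv
    rw [hA] at this
    exact this.run

end RamLang

/-! ### The algorithm -/

namespace RamLang

open CCC WordRAM

set_option linter.unusedSimpArgs false

def algorithm (q : ℕ) : Pr :=
  components ;; hostility ;;
  .ite (.eq (.var 10) (.lit 0))
    (clean ;; degrees ;; dropLoop ;; transform ;; phases q ;; weights q ;; pivot ;;
      .assign 20 (.lit 1))
    (.assign 20 (.lit 0))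

/-- The threshold stays below this value. -/
def maxThreshold (q n : ℕ) : ℕ := 4 * q ^ 2 * (8 * (n + 2)) ^ (2 * rate q)

/-- Since `2 ^ l ≤ 2 * n + 1`, exponentially many in `l` means polynomially many in `n`; thus words
of logarithmic length hold all weights. -/
theorem le_maxThreshold {q n l : ℕ} (hl : 2 ^ l ≤ 2 * n + 1) :
    4 * q ^ 2 * 4 ^ (rate q * (l + 2)) ≤ maxThreshold q n := by
  have h2 : 2 ^ (l + 2) ≤ 8 * (n + 2) := by rw [pow_add]; omega
  have h4 : 4 ^ (rate q * (l + 2)) = (2 ^ (l + 2)) ^ (2 * rate q) := by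
    rw [show 4 = 2 ^ 2 by norm_num, ← pow_mul, ← pow_mul]
    congr 1
    ring
  rw [h4]
  exact Nat.mul_le_mul_left _ (Nat.pow_le_pow_left h2 _)

theorem rate_pos {q : ℕ} (hq : 0 < q) : 0 < rate q := by unfold rate; positivity

theorem maxThreshold_ge {q n : ℕ} (hq : 0 < q) :
    n + 2 ≤ maxThreshold q n ∧ rate q ≤ maxThreshold q n := by
  have h1 : 1 ≤ 4 * q ^ 2 := Nat.pos_of_ne_zero (by positivity)
  have h2 := Nat.mul_le_mul_right ((8 * (n + 2)) ^ (2 * rate q)) h1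
  rw [one_mul] at h2
  constructor
  · refine le_trans ?_ h2
    refine le_trans (by omega) (Nat.le_self_pow (n := 2 * rate q) ?_ (8 * (n + 2)))
    have := rate_pos hq
    omega
  · refine le_trans ?_ h2
    have := Nat.lt_pow_self (n := 2 * rate q) (show 1 < 8 * (n + 2) by omega)
    omega

/-- For positive cost of `D`, `2 * cost C * T ≤ 3 * ∑ W ≤ 3 * factor q * (2 * cost D) * T`, and `2 *
T` cancels. For cost zero there are no bad triples and PIVOT makes no mistake. -/
theorem isTransformPivotAnswer_ker {n q T : ℕ} {I : Inst (Fin n)} (hself : ¬ ∃ U, I.Hostile U U)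
    {A : SimpleGraph (Fin n)} (hA : I.IsDropResult A) {W : Fin n → Fin n → ℕ} (hT : 0 < T)
    (hW : ∀ D, 0 < cost (I.round A) D →
      (∑ a, ∑ b, (W a b : ℝ)) ≤ factor q * (2 * cost (I.round A) D) * T)
    {L : List (Finset (Fin n))} (hL : ChargedRun (I.round A) W T Finset.univ L) {out : Fin n → ℕ}
    (hout : ∀ u v : Fin n, out u = out v ↔ ∃ K ∈ L, u ∈ K ∧ v ∈ K) {α : ℝ}
    (hα : 3 * factor q ≤ α) : I.IsTransformPivotAnswer α (some (Setoid.ker out)) := by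
  have hC : ∀ u v, Setoid.ker out u v ↔ ∃ K ∈ L, u ∈ K ∧ v ∈ K := hout
  refine ⟨hself, A, hA, ⟨L, hL.pivotRun, hC⟩, fun D => ?_⟩
  rcases Nat.eq_zero_or_pos (cost (I.round A) D) with h0 | h0
  · rw [hL.pivotRun.cost_eq_zero h0 hC, h0]; simp
  · have h1 : (2 * cost (I.round A) (Setoid.ker out) * T : ℝ) ≤ 3 * ∑ a, ∑ b, (W a b : ℝ) := by
      exact_mod_cast hL.cost_le hC
    have hT' : (0 : ℝ) < T := by exact_mod_cast hT
    have h2 := hW D h0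
    have h3 : (cost (I.round A) (Setoid.ker out) : ℝ) * (2 * T) ≤
        (3 * factor q) * cost (I.round A) D * (2 * T) := by nlinarith
    have h4 := le_of_mul_le_mul_right h3 (by positivity)
    exact h4.trans (mul_le_mul_of_nonneg_right hα (Nat.cast_nonneg _))

theorem wp_algorithm {n M m q : ℕ} {s : St} (hs : s.v 0 = n) (hq : 0 < q)
    (hM : 32 * (n + 1) * (n + 1) * (maxThreshold q n * maxThreshold q n) ≤ M)
    (hm : rate q * (Nat.log 2 (n + 2) + 3) ≤ m) {I : Inst (Fin n)}
    (hE : Rep (s.a 0) I.E) (hF : Rep (s.a 1) I.F) (hH : Rep (s.a 2) I.H)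
    (h4 : ∀ i < n, ∀ j < n, s.a 4 i j = 0) {α : ℝ} (hα : 3 * factor q ≤ α) :
    wp n M m (algorithm q) (fun s' => (s'.v 20 = 0 ∧ I.IsTransformPivotAnswer α none) ∨
      (s'.v 20 = 1 ∧ I.IsTransformPivotAnswer α
        (some (Setoid.ker fun v : Fin n => s'.a 0 0 v)))) s := by
  set X := maxThreshold q n with hXdef
  obtain ⟨hX1, hX2⟩ := maxThreshold_ge (n := n) hq
  rw [← hXdef] at hX1 hX2
  have hXX : (n + 2) * (n + 2) ≤ X * X := Nat.mul_le_mul hX1 hX1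
  have hXr : rate q * (n + 2) ≤ X * X := Nat.mul_le_mul hX2 hX1
  have hM1 : 32 * (n + 1) * (n + 1) ≤ M :=
    (Nat.le_mul_of_pos_right _ (Nat.mul_pos (by omega) (by omega))).trans hM
  have hM32 : 32 ≤ M := le_trans (by nlinarith) hM1
  have hM4 : 9 * (n * n) * (n * n) < M := by
    refine lt_of_lt_of_le ?_ ((Nat.mul_le_mul_left (32 * (n + 1) * (n + 1)) hXX).trans hM)
    have h5 : 9 * (n * n) * (n * n) < 32 * ((n + 1) * (n + 1)) * ((n + 2) * (n + 2)) := by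
      refine Nat.mul_lt_mul_of_le_of_lt ?_ ?_ (by positivity) <;> nlinarith
    rwa [mul_assoc 32]
  have hMr : rate q * (n + 2) < M := by
    have h5 : 32 * (X * X) ≤ M := le_trans (Nat.mul_le_mul_right _ (by nlinarith)) hM
    have h6 := Nat.mul_pos (show 0 < X by omega) (show 0 < X by omega)
    omega
  unfold algorithm
  refine wp_seq.2 (wp_conseq (wp_components hs hM32 hF) fun s1 hf1 h1 => ?_)
  have a0 : s1.v 0 = n := (hf1.1 0 rfl).trans hs
  have aE : s1.a 0 = s.a 0 := hf1.2 0 rfl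
  have aH : s1.a 2 = s.a 2 := hf1.2 2 rfl
  have a4 : s1.a 4 = s.a 4 := hf1.2 4 rfl
  refine wp_seq.2 (wp_conseq (wp_hostility a0 hM32 (by rwa [aH]) h1 (by rwa [a4]))
    fun s2 hf2 ⟨h2, hflag⟩ => ?_)
  have b0 : s2.v 0 = n := (hf2.1 0 rfl).trans a0
  have bE : s2.a 0 = s.a 0 := (hf2.2 0 rfl).trans aE
  have b3 : s2.a 3 = s1.a 3 := hf2.2 3 rfl
  rw [← b3] at h1 h2
  refine wp_ite.2 ⟨⟨trivial, show 0 < M by omega⟩, fun hself => ?_, fun hself => ?_⟩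
  swap
  · simp only [wp_ite, wp_seq, wp_skip, wp_assign, wp_set, Ex.ok, Ex.eval, Bx.ok, Bx.Holds,
      WordRAM.Op.eval, setV_v, setV_a, setA_v, setA_a, upd_apply, Nat.reduceEqDiff, ↓reduceIte,
      true_and, and_true,
      show 0 < M by omega]
    simp only [wp_ite, wp_seq, wp_skip, wp_assign, wp_set, Ex.ok, Ex.eval, Bx.ok, Bx.Holds,
      WordRAM.Op.eval, setV_v, setV_a, setA_v, setA_a, upd_apply, Nat.reduceEqDiff, ↓reduceIte,
      true_and, and_true,
      hflag] at hself
    exact .inl (not_not.1 hself)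
  simp only [wp_ite, wp_seq, wp_skip, wp_assign, wp_set, Ex.ok, Ex.eval, Bx.ok, Bx.Holds,
    WordRAM.Op.eval, setV_v, setV_a, setA_v, setA_a, upd_apply, Nat.reduceEqDiff, ↓reduceIte,
    true_and, and_true,
    hflag] at hself
  refine wp_seq.2 (wp_conseq (wp_clean b0 hM32 (by rwa [bE]) h1 h2 hself) fun s3 hf3 h3 => ?_)
  have c0 : s3.v 0 = n := (hf3.1 0 rfl).trans b0
  have c3 : s3.a 3 = s2.a 3 := hf3.2 3 rfl
  have c4 : s3.a 4 = s2.a 4 := hf3.2 4 rfl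
  rw [← c3] at h1 h2
  rw [← c4] at h2
  refine wp_seq.2 (wp_conseq (wp_degrees c0 hM1 h3) fun s4 hf4 h4 => ?_)
  have d0 : s4.v 0 = n := (hf4.1 0 rfl).trans c0
  have d3 : s4.a 3 = s3.a 3 := hf4.2 3 rfl
  have d4 : s4.a 4 = s3.a 4 := hf4.2 4 rfl
  have d5 : s4.a 5 = s3.a 5 := hf4.2 5 rfl
  rw [← d3] at h1 h2 h4
  rw [← d4] at h2
  rw [← d5] at h3 h4
  refine wp_seq.2 (wp_conseq (wp_dropLoop d0 hM32 h1 h2 hself h3 h4)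
    fun s5 hf5 ⟨A, hA, h5, h6⟩ => ?_)
  have e0 : s5.v 0 = n := (hf5.1 0 rfl).trans d0
  have e3 : s5.a 3 = s4.a 3 := hf5.2 3 rfl
  rw [← e3] at h1
  refine wp_seq.2 (wp_conseq (wp_transform e0 hM1 hM4 hself h1 hA h5 h6) fun s6 hf6 h7 => ?_)
  have f0 : s6.v 0 = n := (hf6.1 0 rfl).trans e0
  refine wp_seq.2 (wp_conseq (wp_phases f0 hM1 hMr) fun s7 hf7 ⟨l, hl1, hl2, hl3⟩ => ?_)
  have g0 : s7.v 0 = n := (hf7.1 0 rfl).trans f0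
  have g9 : s7.a 9 = s6.a 9 := hf7.2 9 rfl
  rw [← g9] at h7
  -- The program uses its own exponent `l`, which may exceed `Nat.log 2 (n + 2)` by one; this is the
  -- reason for `+ 3` rather than `+ 2` in the bound on `m`.
  have hlog : l ≤ Nat.log 2 (n + 2) + 1 := by
    have hlt : 2 ^ l < 2 ^ (Nat.log 2 (n + 2) + 1 + 1) := by
      have := Nat.lt_pow_succ_log_self (b := 2) (by norm_num) (n + 2)
      rw [pow_succ]
      simp only [Nat.succ_eq_add_one] at this
      omega
    have := (Nat.pow_lt_pow_iff_right (by norm_num)).1 hlt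
    omega
  have hphase : s7.v 1 ≤ m := by
    rw [hl3]
    exact (Nat.mul_le_mul_left _ (by omega)).trans hm
  refine wp_seq.2 (wp_conseq (wp_weights (X := X) g0 hq hphase hM
    (by rw [hl3]; exact le_maxThreshold hl2) h7) fun s8 hf8 h8 => ?_)
  rw [hl3] at h8
  have k0 : s8.v 0 = n := (hf8.1 0 rfl).trans g0
  have k9 : s8.a 9 = s7.a 9 := hf8.2 9 rfl
  rw [← k9] at h7
  refine wp_seq.2 (wp_conseq (wp_pivot k0 hM (by omega) h7 h8.topB rfl h8.topTb h8.inv.feasB)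
    fun s9 hf9 ⟨L, hL, hout⟩ => ?_)
  simp only [wp_ite, wp_seq, wp_skip, wp_assign, wp_set, Ex.ok, Ex.eval, Bx.ok, Bx.Holds,
    WordRAM.Op.eval, setV_v, setV_a, setA_v, setA_a, upd_apply, Nat.reduceEqDiff, ↓reduceIte,
    true_and, and_true,
    show 1 < M by omega]
  exact .inr (isTransformPivotAnswer_ker hself hA h8.inv.posB
    (fun D hD => h8.near_optimal hq hl1 hD) hL hout hα)

/-! #### Input and output -/

noncomputable def initial {n : ℕ} (I : Inst (Fin n)) : St where
  v := I.encode.reg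
  a t i j := I.encode.mem ((t * n + i) * n + j)

theorem encode_mem {n : ℕ} (I : Inst (Fin n)) (t : ℕ) {i j : ℕ} (hi : i < n) (hj : j < n) :
    I.encode.mem ((t * n + i) * n + j) = by
      classical exact if (t = 0 ∧ I.E.Adj ⟨i, hi⟩ ⟨j, hj⟩) ∨ (t = 1 ∧ I.F.Adj ⟨i, hi⟩ ⟨j, hj⟩) ∨
        (t = 2 ∧ I.H.Adj ⟨i, hi⟩ ⟨j, hj⟩) then 1 else 0 := by
  have key : ∀ (t' : ℕ) (G : SimpleGraph (Fin n)),
      (∃ u v : Fin n, G.Adj u v ∧ (t * n + i) * n + j = (t' * n + u) * n + v) ↔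
        t = t' ∧ G.Adj ⟨i, hi⟩ ⟨j, hj⟩ := by
    intro t' G
    constructor
    · rintro ⟨u, v, h, he⟩
      obtain ⟨h1, h2, h3⟩ := addr_inj hi hj u.2 v.2 he
      refine ⟨h1, ?_⟩
      rwa [show (⟨i, hi⟩ : Fin n) = u from Fin.ext h2, show (⟨j, hj⟩ : Fin n) = v from Fin.ext h3]
    · rintro ⟨rfl, h⟩
      exact ⟨_, _, h, rfl⟩
  unfold Inst.encode
  simp only
  congr 1
  rw [eq_iff_iff, ← key, ← key, ← key, ← exists_or, ← exists_or]
  refine exists_congr fun u => ?_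
  rw [← exists_or, ← exists_or]
  refine exists_congr fun v => ?_
  rw [show (0 * n + (u : ℕ)) * n + v = u * n + v by ring,
    show (1 * n + (u : ℕ)) * n + v = n * n + (u * n + v) by ring,
    show (2 * n + (u : ℕ)) * n + v = 2 * (n * n) + (u * n + v) by ring]

theorem rel_initial {n M : ℕ} (I : Inst (Fin n)) (hM : n + 2 ≤ M) : Rel n M (initial I) I.encode := by
  refine ⟨fun _ _ => rfl, fun x _ => ?_, fun _ _ _ _ _ _ => rfl, fun t _ i _ j _ => ?_, ?_⟩
  · simp only [initial, Inst.encode]; split_ifs <;> omega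
  · simp only [initial, Inst.encode]; split_ifs <;> omega
  · simp [initial, Inst.encode]

/-- The language cannot assign register `0`, which holds `n`, so the flag is first put into variable
`20` and copied at the very end. The cluster names lie in row `0` of array `0`, that is, in the
cells `0, …, n - 1`, over the part of `E` no longer needed. -/
noncomputable def program (q : ℕ) : Cmd :=
  .seq (algorithm q).comp (.seq (.const 64 0) (.op .add 0 20 64))

/-- Since `n + 2 ≥ 2`, a constant `c` is at most `(n + 2) ^ c`. This leads to a single exponent that
depends on `q` alone, also for small `n`. -/
theorem words_suffice {q n : ℕ} :
    32 * (n + 1) * (n + 1) * (maxThreshold q n * maxThreshold q n) ≤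
      (n + 2) ^ (5 + 2 + 2 * (4 * q ^ 2 + 4 * (2 * rate q))) := by
  have hc : ∀ c, c ≤ (n + 2) ^ c := fun c => (Nat.lt_pow_self (by omega)).le
  have h8 : 8 * (n + 2) ≤ (n + 2) ^ 4 := by
    rw [pow_succ]
    exact Nat.mul_le_mul_right _ (le_trans (by norm_num) (Nat.pow_le_pow_left (show 2 ≤ n + 2 by omega) 3))
  have hX : maxThreshold q n ≤ (n + 2) ^ (4 * q ^ 2 + 4 * (2 * rate q)) := by
    unfold maxThreshold
    rw [pow_add, pow_mul (n + 2) 4 (2 * rate q)]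
    exact Nat.mul_le_mul (hc _) (Nat.pow_le_pow_left h8 _)
  rw [pow_add, pow_add, mul_comm 2, pow_mul _ _ 2, sq ((n + 2) ^ _), sq (n + 2), mul_assoc 32]
  refine Nat.mul_le_mul (Nat.mul_le_mul ?_ (Nat.mul_le_mul (by omega) (by omega)))
    (Nat.mul_le_mul hX hX)
  exact le_trans (by norm_num) (Nat.pow_le_pow_left (show 2 ≤ n + 2 by omega) 5)

theorem time_algorithm (q n : ℕ) :
    (algorithm q).time n (rate q * (Nat.log 2 (n + 2) + 3)) + 2 ≤
      ((algorithm q).size * (4 * rate q + 1) + 2) * (n + 1) ^ 3 * Nat.log 2 (n + 2) ^ 1 := by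
  have hlog : 1 ≤ Nat.log 2 (n + 2) := Nat.log_pos (by norm_num) (by omega)
  have h := (algorithm q).time_le n (rate q * (Nat.log 2 (n + 2) + 3))
  -- Both depths are found by evaluation: three nested loops over nodes, and one loop over the
  -- phases.
  rw [show (algorithm q).depth = 3 from rfl, show (algorithm q).depth' = 1 from rfl] at h
  generalize Nat.log 2 (n + 2) = l at *
  have h1 : rate q * (l + 3) + 1 ≤ (4 * rate q + 1) * l := by nlinarith
  have h2 : 1 ≤ (n + 1) ^ 3 * l := Nat.mul_pos (by positivity) hlog
  calc _ ≤ (algorithm q).size * ((n + 1) ^ 3 * ((4 * rate q + 1) * l)) + 2 * ((n + 1) ^ 3 * l) := by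
        rw [pow_one] at h
        refine Nat.add_le_add (h.trans ?_) (by omega)
        gcongr
    _ = _ := by ring

theorem program_solves {q : ℕ} (hq : 0 < q) {α : ℝ} (hα : 3 * factor q ≤ α) :
    SolvesInSoftCubicTime (program q) fun _ I a => I.IsTransformPivotAnswer α a := by
  refine ⟨5 + 2 + 2 * (4 * q ^ 2 + 4 * (2 * rate q)), (algorithm q).size * (4 * rate q + 1) + 2, 1,
    fun n I w hw => ?_⟩
  have hM := (words_suffice (q := q) (n := n)).trans hw
  obtain ⟨hX1, -⟩ := maxThreshold_ge (n := n) hq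
  have hM1 : 32 * (n + 1) * (n + 1) ≤ 2 ^ w :=
    (Nat.le_mul_of_pos_right _ (Nat.mul_pos (by omega) (by omega))).trans hM
  have hwp := wp_algorithm (s := initial I) (n := n) (M := 2 ^ w) (q := q) (I := I)
    (by simp [initial, Inst.encode]) hq hM le_rfl
    (fun u v => by
      simp only [initial, encode_mem I 0 u.2 v.2]
      exact ⟨fun h => by simp [h], fun h => by simp [h]⟩)
    (fun u v => by
      simp only [initial, encode_mem I 1 u.2 v.2]
      exact ⟨fun h => by simp [h], fun h => by simp [h]⟩)
    (fun u v => by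
      simp only [initial, encode_mem I 2 u.2 v.2]
      exact ⟨fun h => by simp [h], fun h => by simp [h]⟩)
    (fun i hi j hj => by simp only [initial, encode_mem I 4 hi hj]; simp) hα
  obtain ⟨τ, t, s', hex, hrel, hpost, ht⟩ :=
    (algorithm q).sound hM1 rfl _ _ _ (rel_initial I (by nlinarith)) hwp
  have hlast := Exec.seq hex (Exec.seq (Exec.const τ 64 0) (Exec.op _ .add 0 20 64))
  refine ⟨_, _, hlast, le_trans (by omega) (time_algorithm q n), ?_⟩
  have hreg : ∀ x, x = s'.v 20 →
      ((τ.setReg 64 (0 % 2 ^ w)).setReg 0 ((Op.add).eval ((τ.setReg 64 (0 % 2 ^ w)).reg 20)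
        ((τ.setReg 64 (0 % 2 ^ w)).reg 64) % 2 ^ w)).reg 0 = x := by
    rintro x rfl
    simp only [setReg_reg, Op.eval, if_true, Nat.zero_mod, add_zero]
    rw [if_neg (by norm_num), hrel.reg 20 (by norm_num), Nat.mod_eq_of_lt (hrel.regB 20 (by norm_num))]
  have hmem : ∀ v : Fin n, τ.mem v = s'.a 0 0 v := by
    intro v
    have := hrel.mem 0 (by norm_num) 0 (by have := v.2; omega) v v.2
    simpa using this
  unfold answer
  rcases hpost with ⟨h0, h⟩ | ⟨h1, h⟩
  · rw [if_pos (hreg 0 h0.symm)]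
    exact h
  · rw [if_neg (by rw [hreg 1 h1.symm]; norm_num)]
    simp only [setReg_mem]
    simpa only [hmem] using h

end RamLang

/-! ### Choice of the precision and conclusion -/

namespace CCC

theorem SolvesInSoftCubicTime.mono {P : WordRAM.Cmd}
    {S S' : ∀ n : ℕ, Inst (Fin n) → Option (Setoid (Fin n)) → Prop}
    (h : SolvesInSoftCubicTime P S) (hS : ∀ n I a, S n I a → S' n I a) :
    SolvesInSoftCubicTime P S' := by
  obtain ⟨κ, c, k, h⟩ := h
  refine ⟨κ, c, k, fun n I w hw => ?_⟩
  obtain ⟨σ, t, h1, h2, h3⟩ := h n I w hw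
  exact ⟨σ, t, h1, h2, hS _ _ _ h3⟩

/-- `factor q` tends to `1` as `q` grows, so `3 * factor q` eventually drops below `3 + ε`. -/
theorem exists_factor_le {ε : ℝ} (hε : 0 < ε) : ∃ q : ℕ, 0 < q ∧ 3 * factor q ≤ 3 + ε := by
  have h1 : Filter.Tendsto (fun q : ℕ => 1 / (q : ℝ)) Filter.atTop (nhds 0) :=
    tendsto_one_div_atTop_nhds_zero_nat
  have h2 : Filter.Tendsto (fun q : ℕ => 3 * factor q) Filter.atTop (nhds 3) := by
    have : Filter.Tendsto (fun q : ℕ => 3 * ((1 + 2 * (1 / (q : ℝ))) * (1 + 1 / q) * (1 + 1 / q)))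
        Filter.atTop (nhds (3 * ((1 + 2 * 0) * (1 + 0) * (1 + 0)))) :=
      ((((h1.const_mul 2).const_add 1).mul (h1.const_add 1)).mul (h1.const_add 1)).const_mul 3
    refine (this.congr fun q => ?_).trans (by norm_num)
    unfold factor growth
    ring
  have h3 := (h2.eventually (ge_mem_nhds (show (3 : ℝ) < 3 + ε by linarith))).and
    (Filter.eventually_gt_atTop 0)
  obtain ⟨q, hq⟩ := h3.exists
  exact ⟨q, hq.2, hq.1⟩

end CCC

theorem theorem1 :
    (∃ P : WordRAM.Cmd, CCC.SolvesInSoftCubicTime P fun _ I a => I.IsApproxAnswer 16 a) ∧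
    ∀ ε : ℝ, 0 < ε → ∃ P : WordRAM.Cmd, CCC.SolvesInSoftCubicTime P fun _ I a =>
      I.IsTransformPivotAnswer (3 + ε) a ∧
      I.IsApproxAnswer (((3 + ε) + 1) * (1 + √5) + (3 + ε)) a := by
  constructor
  -- With `α = 13 / 4` the factor `3 * (α + 1) + α` is exactly `16`.
  · obtain ⟨q, hq, hα⟩ := CCC.exists_factor_le (ε := 1 / 4) (by norm_num)
    exact ⟨_, (RamLang.program_solves hq hα).mono fun n I a h =>
      h.isApproxAnswer (by norm_num) (by norm_num)⟩
  · intro ε hε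
    obtain ⟨q, hq, hα⟩ := CCC.exists_factor_le hε
    refine ⟨_, (RamLang.program_solves hq hα).mono fun n I a h =>
      ⟨h, h.isApproxAnswer (by linarith) ?_⟩⟩
    -- The factor obtained is `3 * (α + 1) + α`, and `3 ≤ 1 + √5`.
    have h5 : (2 : ℝ) ≤ √5 := Real.le_sqrt_of_sq_le (by norm_num)
    nlinarith
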